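/- **Setting.** Let $L>0$, $\Omega=(0,L)^2$ with periodic boundary conditions, and fix positive parameters $\alpha,\beta,\varepsilon,\eta,\xi,\delta,\mathcal M$. Write $f(s)=\tfrac14 s^2(1-s)^2$, $H(s)=s\ln s+(1-s)\ln(1-s)$ and $|\nabla^\delta u|=(|\nabla u|^2+\delta^2)^{1/2}$. The regularised binary fluid-surfactant system is the $H^{-1}$ gradient flow $$\phi_t=\mathcal M\Delta\mu_\phi,\qquad \rho_t=\mathcal M\Delta\mu_\rho,$$ $$\mu_\phi=\frac{f'(\phi)}{\varepsilon}-(\varepsilon+\alpha)\Delta\phi+\eta^2\Delta^2\phi+\alpha\nabla\cdot\Big(\frac{\rho\nabla\phi}{|\nabla^\delta\phi|}\Big),\qquad \mu_\rho=\alpha\big(\rho-|\nabla^\delta\phi|\big)-\xi\Delta\rho+\beta H'(\rho)$$ of the energy $\int_\Omega \frac{f(\phi)}{\varepsilon}+\frac\varepsilon2|\nabla\phi|^2+\frac{\eta^2}2|\Delta\phi|^2+\frac\xi2|\nabla\rho|^2+\frac\alpha2(\rho-|\nabla^\delta\phi|)^2+\beta H(\rho)$. **Discretisation.** For $K\in\mathbb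 N$ put $N=2K+1$, $h=L/N$, and consider doubly $N$-periodic grid functions at the points $(p_i,p_j)$, $p_i=(i-\frac12)h$. Let $D_x,D_y$ be the differences from cells to edges ($D_xg_{i+1/2,j}=(g_{i+1,j}-g_{i,j})/h$), $\nabla_h=(D_x,D_y)$, $\nabla_h\cdot$ the difference divergence from edges to cells, $\Delta_h=\nabla_h\cdot\nabla_h$ the five-point Laplacian, and $$(\mathcal A|\nabla_h^\delta\phi|)_{i,j}=\Big(\tfrac12\big((D_x\phi)_{i+\frac12,j}^2+(D_x\phi)_{i-\frac12,j}^2+(D_y\phi)_{i,j+\frac12}^2+(D_y\phi)_{i,j-\frac12}^2\big)+\delta^2\Big)^{1/2};$$ for a cell function $g$, $\mathcal A(g)$ on an edge is the mean of the two adjacent cell values. Further $\|g\|_2^2=h^2\sum_{i,j=1}^N g_{i,j}^2$, $\|\nabla_hg\|_2^2=h^2\sum_{i,j=1}^N\big((D_xg)_{i+\frac12,j}^2+(D_yg)_{i,j+\frac12}^2\big)$, and, for $g$ of zero mean, $\|g\|_{-1,h}=\|\nabla_h\psi\|_2$, where $\psi$ is the grid function of zero mean with $-\Delta_h\psi=g$.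 Let $\mathcal P_N$ be the Fourier projection onto trigonometric polynomials of degree at most $K$ in each variable, and $\mathcal P_h$ the restriction to the grid points. For a time step $\Delta t>0$ put $t_m=m\Delta t$. A numerical solution consists of $\phi^0=\mathcal P_h\mathcal P_N\Phi(\cdot,0)$, $\rho^0=\mathcal P_h\mathcal P_N\Psi(\cdot,0)$ and, for all $n\ge0$ with $t_{n+1}\le T$, grid functions $\phi^{n+1},\rho^{n+1}$ with $0<\rho^{n+1}<1$ at every grid point and $$\frac{\phi^{n+1}-\phi^n}{\Delta t}=\mathcal M\Delta_h\mu_\phi^{n+1},\qquad \frac{\rho^{n+1}-\rho^n}{\Delta t}=\mathcal M\Delta_h\mu_\rho^{n+1},$$ $$\mu_\phi^{n+1}=\tfrac1\varepsilon(\phi^{n+1}-\tfrac12)^3-(\varepsilon+\alpha+\tfrac\alpha\delta)\Delta_h\phi^{n+1}+\eta^2\Delta_h^2\phi^{n+1}+\alpha\nabla_h\cdot\Big(\mathcal A\Big(\frac{\rho^{n+1}}{\mathcal A|\nabla_h^\delta\phi^{n+1}|}\Big)\nabla_h\phi^{n+1}\Big)-\tfrac1{4\varepsilon}(\phi^n-\tfrac12)+\tfrac\alpha\delta\Delta_h\phi^n,$$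 $$\mu_\rho^{n+1}=-\xi\Delta_h\rho^{n+1}+\beta\big(\ln\rho^{n+1}-\ln(1-\rho^{n+1})\big)+\sqrt2\,\alpha\rho^{n+1}-\alpha\mathcal A|\nabla_h^\delta\phi^{n+1}|-\alpha(\sqrt2-1)\rho^n.$$ The errors are $\tilde\phi^m=\mathcal P_h\mathcal P_N\Phi(\cdot,t_m)-\phi^m$ and $\tilde\rho^m=\mathcal P_h\mathcal P_N\Psi(\cdot,t_m)-\rho^m$. **Theorem 3.3.** There is $\Delta t_0>0$, depending only on $L$ and the parameters $\alpha,\beta,\varepsilon,\eta,\xi,\delta,\mathcal M$, such that the following holds. Let $T>0$ and let $(\Phi,\Psi)$ be a solution of the regularised system on $[0,T]$ (the equations holding at every point of space for almost every time, and $0<\Psi<1$ on $\Omega\times[0,T]$) with $\Phi(\cdot,0)\in C^8_{per}(\Omega)$, $\Psi(\cdot,0)\in C^6_{per}(\Omega)$ and $$\Phi\in H^2(0,T;C_{per}(\Omega))\cap L^\infty(0,T;C^8_{per}(\Omega)),\qquad \Psi\in H^2(0,T;C_{per}(\Omega))\cap L^\infty(0,T;C^6_{per}(\Omega))$$ (both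 taken as continuous functions of $t\in[0,T]$ with values in $C_{per}(\Omega)$). Then there is $C>0$, independent of $n$, $\Delta t$ and $h$, such that for all $K\in\mathbb N$, all $0<\Delta t\le\Delta t_0$, every numerical solution, and all integers $n\ge0$ with $t_{n+1}\le T$, $$\|\tilde\phi^{n+1}\|_{-1,h}+\|\tilde\rho^{n+1}\|_{-1,h}+\Big(\mathcal M\Delta t\sum_{k=0}^{n+1}\big(\eta^2\|\Delta_h\tilde\phi^k\|_2^2+\varepsilon\|\nabla_h\tilde\phi^k\|_2^2+\xi\|\nabla_h\tilde\rho^k\|_2^2\big)\Big)^{1/2}\le C(\Delta t+h^2).$$ -/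

import Mathlib

open MeasureTheory

noncomputable section

namespace Surfactant

/-! ## Parameters, the torus, spatial derivatives -/

/-- The (fixed, positive) physical and regularisation parameters of the model. -/
structure Params where
  α : ℝ
  β : ℝ
  ε : ℝ
  η : ℝ
  ξ : ℝ
  δ : ℝ
  M : ℝ
  α_pos : 0 < α
  β_pos : 0 < β
  ε_pos : 0 < ε
  η_pos : 0 < η
  ξ_pos : 0 < ξ
  δ_pos : 0 < δ
  M_pos : 0 < M

/-- The periodic square of side `L`. The Banach space `C_per(Ω)` is `C(Torus L, ℝ)`. -/
abbrev Torus (L : ℝ) : Type := AddCircle L × AddCircle L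

/-- The `L`-periodic function on the plane given by a function on the torus. -/
def lift {L : ℝ} (u : C(Torus L, ℝ)) : ℝ × ℝ → ℝ :=
  fun p => u ((p.1 : AddCircle L), (p.2 : AddCircle L))

/-- `∂f/∂x`. -/
def px (f : ℝ × ℝ → ℝ) : ℝ × ℝ → ℝ := fun p => deriv (fun s => f (s, p.2)) p.1

/-- `∂f/∂y`. -/
def py (f : ℝ × ℝ → ℝ) : ℝ × ℝ → ℝ := fun p => deriv (fun s => f (p.1, s)) p.2

/-- The Laplacian in the plane. -/
def laplace (f : ℝ × ℝ → ℝ) : ℝ × ℝ → ℝ := fun p => px (px f) p + py (py f) p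

/-- `|∇^δ f| = (f_x ^ 2 + f_y ^ 2 + δ ^ 2) ^ (1/2)`. -/
def modGrad (δ : ℝ) (f : ℝ × ℝ → ℝ) : ℝ × ℝ → ℝ :=
  fun p => Real.sqrt (px f p ^ 2 + py f p ^ 2 + δ ^ 2)

/-! ## The regularised binary fluid-surfactant system -/

/-- `f'(s)` for the double well `f(s) = s² (1 - s)² / 4`. -/
def dDoubleWell (s : ℝ) : ℝ := s * (1 - s) * (1 - 2 * s) / 2

/-- `H'(s)` for `H(s) = s ln s + (1 - s) ln (1 - s)`. -/
def dEntropy (s : ℝ) : ℝ := Real.log s - Real.log (1 - s)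

/-- `δG/δφ` for the energy
`G = ∫ f(φ)/ε + (ε/2)|∇φ|² + (η²/2)|Δφ|² + (ξ/2)|∇ρ|² + (α/2)(ρ - |∇^δ φ|)² + β H(ρ)`, that is,
`f'(φ)/ε - εΔφ + η²Δ²φ + α ∇·(ρ ∇φ / |∇^δ φ|) - αΔφ`. -/
def muPhi (P : Params) (φ ρ : ℝ × ℝ → ℝ) : ℝ × ℝ → ℝ := fun p =>
  dDoubleWell (φ p) / P.ε - P.ε * laplace φ p + P.η ^ 2 * laplace (laplace φ) p
    + P.α * (px (fun q => ρ q * px φ q / modGrad P.δ φ q) p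
        + py (fun q => ρ q * py φ q / modGrad P.δ φ q) p)
    - P.α * laplace φ p

/-- `δG/δρ` for the same energy: `α (ρ - |∇^δ φ|) - ξΔρ + β H'(ρ)`. -/
def muRho (P : Params) (φ ρ : ℝ × ℝ → ℝ) : ℝ × ℝ → ℝ := fun p =>
  P.α * (ρ p - modGrad P.δ φ p) - P.ξ * laplace ρ p + P.β * dEntropy (ρ p)

/-- `(Φ, Ψ)` solves `φ_t = M Δ(δG/δφ)`, `ρ_t = M Δ(δG/δρ)` on `(0, T)` with periodic boundary
conditions, for almost every time and at every point, with `0 < Ψ < 1`. -/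
structure IsExactSolution {L : ℝ} (P : Params) (T : ℝ) (Φ Ψ : ℝ → C(Torus L, ℝ)) : Prop where
  pos : ∀ t ∈ Set.Icc 0 T, ∀ z, 0 < Ψ t z ∧ Ψ t z < 1
  phi_eq : ∀ᵐ t ∂(volume.restrict (Set.Ioo 0 T)), ∀ p : ℝ × ℝ,
    HasDerivAt (fun s => lift (Φ s) p)
      (P.M * laplace (muPhi P (lift (Φ t)) (lift (Ψ t))) p) t
  rho_eq : ∀ᵐ t ∂(volume.restrict (Set.Ioo 0 T)), ∀ p : ℝ × ℝ,
    HasDerivAt (fun s => lift (Ψ s) p)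
      (P.M * laplace (muRho P (lift (Φ t)) (lift (Ψ t))) p) t

/-! ## Regularity classes -/

/-- `v` is the weak derivative of `u` on `(0, T)`, for functions with values in `X`. -/
def HasWeakDeriv {X : Type*} [NormedAddCommGroup X] [NormedSpace ℝ X]
    (T : ℝ) (u v : ℝ → X) : Prop :=
  ∀ θ : ℝ → ℝ, ContDiff ℝ (⊤ : ℕ∞) θ → HasCompactSupport θ → tsupport θ ⊆ Set.Ioo 0 T →
    ∫ t in Set.Ioo 0 T, deriv θ t • u t = -∫ t in Set.Ioo 0 T, θ t • v t

/-- `u ∈ H²(0, T; X)`. -/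
def MemH2 {X : Type*} [NormedAddCommGroup X] [NormedSpace ℝ X] (T : ℝ) (u : ℝ → X) : Prop :=
  MemLp u 2 (volume.restrict (Set.Ioo 0 T)) ∧
  ∃ v w : ℝ → X, MemLp v 2 (volume.restrict (Set.Ioo 0 T)) ∧
    MemLp w 2 (volume.restrict (Set.Ioo 0 T)) ∧ HasWeakDeriv T u v ∧ HasWeakDeriv T v w

/-- `u ∈ L^∞(0, T; C^k_per(Ω))`: for almost every `t` the function `u t` is `C^k`, and its
derivatives of order at most `k` are bounded uniformly in space and essentially in time. -/
def MemLinftyC {L : ℝ} (k : ℕ) (T : ℝ) (u : ℝ → C(Torus L, ℝ)) : Prop :=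
  ∃ B : ℝ, ∀ᵐ t ∂(volume.restrict (Set.Ioo 0 T)),
    ContDiff ℝ k (lift (u t)) ∧ ∀ m ≤ k, ∀ p, ‖iteratedFDeriv ℝ m (lift (u t)) p‖ ≤ B

/-- `u ∈ H²(0, T; C_per(Ω)) ∩ L^∞(0, T; C^k_per(Ω))` with `u(0) ∈ C^k_per(Ω)`; here `u` is the
continuous representative on `[0, T]` of its class. -/
structure RegularClass {L : ℝ} [Fact (0 < L)] (k : ℕ) (T : ℝ) (u : ℝ → C(Torus L, ℝ)) : Prop where
  cont : ContinuousOn u (Set.Icc 0 T)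
  h2 : MemH2 T u
  linfty : MemLinftyC k T u
  init : ContDiff ℝ k (lift (u 0))

/-! ## Fourier projection and interpolation -/

/-- The Fourier coefficient `L⁻² ∫_Ω u(x, y) exp(-2πi (k x + l y) / L) dx dy`. -/
def coeff {L : ℝ} [Fact (0 < L)] (u : C(Torus L, ℝ)) (k l : ℤ) : ℂ :=
  ∫ z : Torus L, fourier (-k) z.1 * fourier (-l) z.2 * ((u z : ℝ) : ℂ)
    ∂((AddCircle.haarAddCircle (T := L)).prod (AddCircle.haarAddCircle (T := L)))

/-- The Fourier projection onto the trigonometric polynomials of degree at most `K`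
(in each variable). The sum is real, since `u` is real. -/
def fourierProj {L : ℝ} [Fact (0 < L)] (K : ℕ) (u : C(Torus L, ℝ)) (z : Torus L) : ℝ :=
  (∑ k ∈ Finset.Icc (-(K : ℤ)) K, ∑ l ∈ Finset.Icc (-(K : ℤ)) K,
    coeff u k l * (fourier k z.1 * fourier l z.2)).re

/-! ## Grid functions

An `N`-periodic doubly indexed family is a function on `ZMod N × ZMod N`. For cell-centred
functions `(i, j)` stands for the node `(p_i, p_j)`, `p_i = (i - 1/2) h`. For edge-centred functions
in the `x` (resp. `y`) direction, the index `(i, j)` stands for `(i + 1/2, j)`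
(resp. `(i, j + 1/2)`). -/

/-- Doubly periodic grid functions. -/
abbrev Grid (N : ℕ) : Type := ZMod N → ZMod N → ℝ

section GridOps

variable {N : ℕ}

/-- Centre-to-edge average in `x`. -/
def Ax (g : Grid N) : Grid N := fun i j => (g (i + 1) j + g i j) / 2

/-- Centre-to-edge average in `y`. -/
def Ay (g : Grid N) : Grid N := fun i j => (g i (j + 1) + g i j) / 2

/-- Centre-to-edge difference in `x`. -/
def Dx (h : ℝ) (g : Grid N) : Grid N := fun i j => (g (i + 1) j - g i j) / h

/-- Centre-to-edge difference in `y`. -/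
def Dy (h : ℝ) (g : Grid N) : Grid N := fun i j => (g i (j + 1) - g i j) / h

/-- Edge-to-centre average in `x`. -/
def ax (f : Grid N) : Grid N := fun i j => (f i j + f (i - 1) j) / 2

/-- Edge-to-centre average in `y`. -/
def ay (f : Grid N) : Grid N := fun i j => (f i j + f i (j - 1)) / 2

/-- Edge-to-centre difference in `x`. -/
def dx (h : ℝ) (f : Grid N) : Grid N := fun i j => (f i j - f (i - 1) j) / h

/-- Edge-to-centre difference in `y`. -/
def dy (h : ℝ) (f : Grid N) : Grid N := fun i j => (f i j - f i (j - 1)) / h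

/-- The discrete Laplacian `Δ_h`. -/
def lapH (h : ℝ) (g : Grid N) : Grid N := dx h (Dx h g) + dy h (Dy h g)

/-- `𝒜|∇_h^δ g|`, the square root of the cell average of the squared differences plus `δ²`. -/
def modGradH (h δ : ℝ) (g : Grid N) : Grid N := fun i j =>
  Real.sqrt ((Dx h g i j ^ 2 + Dx h g (i - 1) j ^ 2 + Dy h g i j ^ 2 + Dy h g i (j - 1) ^ 2) / 2
    + δ ^ 2)

/-- `∇_h · (𝒜 (ρ / 𝒜|∇_h^δ φ|) ∇_h φ)`. -/
def divNonlin (h δ : ℝ) (φ ρ : Grid N) : Grid N :=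
  dx h (Ax (ρ / modGradH h δ φ) * Dx h φ) + dy h (Ay (ρ / modGradH h δ φ) * Dy h φ)

/-- The discrete chemical potential `δ_φ E_c(φ₁, ρ₁) - δ_φ E_e(φ₀, ρ₀)`. -/
def muPhiH (P : Params) (h : ℝ) (φ₀ φ₁ ρ₁ : Grid N) : Grid N := fun i j =>
  (φ₁ i j - 1 / 2) ^ 3 / P.ε - (P.ε + P.α + P.α / P.δ) * lapH h φ₁ i j
    + P.η ^ 2 * lapH h (lapH h φ₁) i j + P.α * divNonlin h P.δ φ₁ ρ₁ i j
    - (φ₀ i j - 1 / 2) / (4 * P.ε) + P.α / P.δ * lapH h φ₀ i j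

/-- The discrete chemical potential `δ_ρ E_c(φ₁, ρ₁) - δ_ρ E_e(φ₀, ρ₀)`. -/
def muRhoH (P : Params) (h : ℝ) (ρ₀ φ₁ ρ₁ : Grid N) : Grid N := fun i j =>
  -P.ξ * lapH h ρ₁ i j + P.β * dEntropy (ρ₁ i j) + Real.sqrt 2 * P.α * ρ₁ i j
    - P.α * modGradH h P.δ φ₁ i j - P.α * (Real.sqrt 2 - 1) * ρ₀ i j

variable [NeZero N]

/-- `⟨u, v⟩_Ω = h² ∑ u v`. -/
def inner2 (h : ℝ) (u v : Grid N) : ℝ := h ^ 2 * ∑ i, ∑ j, u i j * v i j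

/-- `‖u‖₂²`. -/
def normSq (h : ℝ) (u : Grid N) : ℝ := inner2 h u u

/-- `‖∇_h u‖₂² = [D_x u, D_x u]_x + [D_y u, D_y u]_y`, where `[f, g]_x = ⟨a_x (f g), 1⟩_Ω` and
`[f, g]_y = ⟨a_y (f g), 1⟩_Ω`. -/
def gradSq (h : ℝ) (u : Grid N) : ℝ :=
  inner2 h (ax (Dx h u * Dx h u)) 1 + inner2 h (ay (Dy h u * Dy h u)) 1

/-- The grid average. -/
def mean (u : Grid N) : ℝ := (∑ i, ∑ j, u i j) / (N : ℝ) ^ 2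

/-- `(-Δ_h)⁻¹ (u - mean u)`: the mean-zero `ψ` with `-Δ_h ψ = u - mean u`. It exists and is unique
for `h ≠ 0`, see `existsUnique_invLap`. -/
def invLap (h : ℝ) (u : Grid N) : Grid N :=
  Classical.epsilon fun ψ => mean ψ = 0 ∧ ∀ i j, -lapH h ψ i j = u i j - mean u

/-- `‖u‖_{-1,h} = ‖∇_h ψ‖₂` with `ψ = (-Δ_h)⁻¹ u`, for mean-zero `u`. -/
def negNorm (h : ℝ) (u : Grid N) : ℝ := Real.sqrt (gradSq h (invLap h u))

theorem sum_shift_x (f : Grid N) : ∑ i, ∑ j, f (i - 1) j = ∑ i, ∑ j, f i j :=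
  Equiv.sum_comp (Equiv.subRight (1 : ZMod N)) fun i => ∑ j, f i j

theorem sum_shift_y (f : Grid N) : ∑ i, ∑ j, f i (j - 1) = ∑ i, ∑ j, f i j :=
  Finset.sum_congr rfl fun i _ => Equiv.sum_comp (Equiv.subRight (1 : ZMod N)) fun j => f i j

theorem sum_lapH (h : ℝ) (u : Grid N) : ∑ i, ∑ j, lapH h u i j = 0 := by
  have hx := sum_shift_x (Dx h u)
  have hy := sum_shift_y (Dy h u)
  simp only [lapH, Pi.add_apply, dx, dy, Finset.sum_add_distrib, ← Finset.sum_div,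
    Finset.sum_sub_distrib, hx, hy]
  simp

theorem sum_lapH_mul (h : ℝ) (u : Grid N) :
    ∑ i, ∑ j, -lapH h u i j * u i j = ∑ i, ∑ j, (Dx h u i j ^ 2 + Dy h u i j ^ 2) := by
  have hx := sum_shift_x (fun i j => Dx h u i j * u (i + 1) j / h)
  have hy := sum_shift_y (fun i j => Dy h u i j * u i (j + 1) / h)
  simp only [sub_add_cancel] at hx hy
  have e1 : ∀ i j, -lapH h u i j * u i j
      = (Dx h u (i - 1) j * u i j / h - Dx h u i j * u i j / h)
        + (Dy h u i (j - 1) * u i j / h - Dy h u i j * u i j / h) := by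
    intro i j
    simp only [lapH, Pi.add_apply, dx, dy]
    ring
  have e2 : ∀ i j, Dx h u i j ^ 2 + Dy h u i j ^ 2
      = (Dx h u i j * u (i + 1) j / h - Dx h u i j * u i j / h)
        + (Dy h u i j * u i (j + 1) / h - Dy h u i j * u i j / h) := by
    intro i j
    simp only [Dx, Dy]
    ring
  simp only [e1, e2, Finset.sum_add_distrib, Finset.sum_sub_distrib, hx, hy]

theorem const_of_lapH_eq_zero {h : ℝ} (hh : h ≠ 0) {u : Grid N} (hu : ∀ i j, lapH h u i j = 0)
    (i j : ZMod N) : u i j = u 0 0 := by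
  have h0 : ∑ i, ∑ j, (Dx h u i j ^ 2 + Dy h u i j ^ 2) = 0 := by
    rw [← sum_lapH_mul]
    simp [hu]
  have h1 : ∀ i j, Dx h u i j ^ 2 + Dy h u i j ^ 2 = 0 := by
    intro i j
    have hi := (Finset.sum_eq_zero_iff_of_nonneg
      (fun i _ => Finset.sum_nonneg fun j _ => by positivity)).1 h0 i (Finset.mem_univ i)
    exact (Finset.sum_eq_zero_iff_of_nonneg (fun j _ => by positivity)).1 hi j (Finset.mem_univ j)
  have hX : ∀ i j, u (i + 1) j = u i j := by
    intro i j
    have h2 : Dx h u i j = 0 := by nlinarith [h1 i j, sq_nonneg (Dx h u i j), sq_nonneg (Dy h u i j)]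
    simp only [Dx, div_eq_zero_iff, hh, or_false] at h2
    linarith
  have hY : ∀ i j, u i (j + 1) = u i j := by
    intro i j
    have h2 : Dy h u i j = 0 := by nlinarith [h1 i j, sq_nonneg (Dx h u i j), sq_nonneg (Dy h u i j)]
    simp only [Dy, div_eq_zero_iff, hh, or_false] at h2
    linarith
  have hX' : ∀ (n : ℕ) (j : ZMod N), u (n : ZMod N) j = u 0 j := by
    intro n j
    induction n with
    | zero => simp
    | succ n ih => rw [Nat.cast_succ, hX, ih]
  have hY' : ∀ n : ℕ, u 0 (n : ZMod N) = u 0 0 := by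
    intro n
    induction n with
    | zero => simp
    | succ n ih => rw [Nat.cast_succ, hY, ih]
  have := hX' i.val j
  have h3 := hY' j.val
  rw [ZMod.natCast_zmod_val] at this h3
  rw [this, h3]

/-- `ψ ↦ -Δ_h ψ + mean ψ` as a linear map. -/
def auxLin (N : ℕ) [NeZero N] (h : ℝ) : Grid N →ₗ[ℝ] Grid N where
  toFun ψ := fun i j => -lapH h ψ i j + mean ψ
  map_add' a b := by
    funext i j
    simp only [lapH, dx, dy, Dx, Dy, mean, Pi.add_apply, Finset.sum_add_distrib]
    ring
  map_smul' c a := by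
    funext i j
    simp only [lapH, dx, dy, Dx, Dy, mean, Pi.add_apply, Pi.smul_apply, smul_eq_mul,
      ← Finset.mul_sum, RingHom.id_apply]
    ring

theorem sum_const_grid (c : ℝ) : ∑ _i : ZMod N, ∑ _j : ZMod N, c = (N : ℝ) ^ 2 * c := by
  simp only [Finset.sum_const, Finset.card_univ, ZMod.card, nsmul_eq_mul]
  ring

theorem mean_auxLin (h : ℝ) (ψ : Grid N) : mean (auxLin N h ψ) = mean ψ := by
  have hN : ((N : ℝ) ^ 2) ≠ 0 := pow_ne_zero 2 (Nat.cast_ne_zero.2 (NeZero.ne N))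
  have h1 : ∑ i, ∑ j, auxLin N h ψ i j = (N : ℝ) ^ 2 * mean ψ := by
    have : ∀ i j, auxLin N h ψ i j = -lapH h ψ i j + mean ψ := fun _ _ => rfl
    simp only [this, Finset.sum_add_distrib, Finset.sum_neg_distrib, sum_lapH, sum_const_grid]
    simp
  rw [mean, h1, mul_div_cancel_left₀ _ hN]

theorem auxLin_injective {h : ℝ} (hh : h ≠ 0) : Function.Injective (auxLin N h) := by
  rw [← LinearMap.ker_eq_bot, LinearMap.ker_eq_bot']
  intro ψ hψ
  have hN : ((N : ℝ) ^ 2) ≠ 0 := pow_ne_zero 2 (Nat.cast_ne_zero.2 (NeZero.ne N))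
  have hm : mean ψ = 0 := by
    rw [← mean_auxLin h, hψ]
    simp [mean]
  have hl : ∀ i j, lapH h ψ i j = 0 := by
    intro i j
    have : -lapH h ψ i j + mean ψ = 0 := congrFun (congrFun hψ i) j
    linarith
  have hc := const_of_lapH_eq_zero hh hl
  have h0 : ψ 0 0 = 0 := by
    have : mean ψ = ψ 0 0 := by
      simp only [mean, hc]
      rw [sum_const_grid, mul_div_cancel_left₀ _ hN]
    rw [← this, hm]
  funext i j
  rw [hc, h0]
  rfl

theorem existsUnique_invLap {h : ℝ} (hh : h ≠ 0) (u : Grid N) :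
    ∃! ψ : Grid N, mean ψ = 0 ∧ ∀ i j, -lapH h ψ i j = u i j - mean u := by
  have hN : ((N : ℝ) ^ 2) ≠ 0 := pow_ne_zero 2 (Nat.cast_ne_zero.2 (NeZero.ne N))
  have hinj := auxLin_injective (N := N) hh
  obtain ⟨ψ, hψ⟩ := (LinearMap.injective_iff_surjective.1 hinj) (fun i j => u i j - mean u)
  have hm : mean ψ = 0 := by
    rw [← mean_auxLin h, hψ]
    simp only [mean, Finset.sum_sub_distrib]
    rw [sum_const_grid, mul_div_cancel₀ _ hN, sub_self, zero_div]
  refine ⟨ψ, ⟨hm, fun i j => ?_⟩, fun ψ' h' => hinj ?_⟩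
  · have : -lapH h ψ i j + mean ψ = u i j - mean u := congrFun (congrFun hψ i) j
    linarith
  · rw [hψ]
    funext i j
    change -lapH h ψ' i j + mean ψ' = _
    rw [h'.1, h'.2, add_zero]

theorem invLap_spec {h : ℝ} (hh : h ≠ 0) (u : Grid N) :
    mean (invLap h u) = 0 ∧ ∀ i j, -lapH h (invLap h u) i j = u i j - mean u :=
  Classical.epsilon_spec (p := fun ψ : Grid N => mean ψ = 0 ∧ ∀ i j, -lapH h ψ i j = u i j - mean u)
    (existsUnique_invLap hh u).exists

end GridOps

/-! ## The numerical solution and its error -/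

/-- The mesh size for `N = 2K + 1` cells in each direction. -/
def mesh (L : ℝ) (K : ℕ) : ℝ := L / ((2 * K + 1 : ℕ) : ℝ)

/-- Pointwise interpolation at the cell centres `((i - 1/2) h, (j - 1/2) h)`. -/
def interp {L : ℝ} (K : ℕ) (u : Torus L → ℝ) : Grid (2 * K + 1) := fun i j =>
  u ((((i.val : ℝ) - 1 / 2) * mesh L K : ℝ), (((j.val : ℝ) - 1 / 2) * mesh L K : ℝ))

/-- `𝒫_h (𝒫_N u)`. -/
def proj {L : ℝ} [Fact (0 < L)] (K : ℕ) (u : C(Torus L, ℝ)) : Grid (2 * K + 1) :=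
  interp K (fourierProj K u)

/-- `(φ^n, ρ^n)`, for `0 ≤ n Δt ≤ T`, is generated by the convex splitting scheme with time step
`dt` from the projected initial data `(Φ₀, Ψ₀)`, with `0 < ρ^{n+1} < 1`. -/
structure IsNumericalSolution {L : ℝ} [Fact (0 < L)] (P : Params) (T : ℝ) (K : ℕ) (dt : ℝ)
    (Φ₀ Ψ₀ : C(Torus L, ℝ)) (φ ρ : ℕ → Grid (2 * K + 1)) : Prop where
  phi_zero : φ 0 = proj K Φ₀
  rho_zero : ρ 0 = proj K Ψ₀
  pos : ∀ n : ℕ, ((n : ℝ) + 1) * dt ≤ T → ∀ i j, 0 < ρ (n + 1) i j ∧ ρ (n + 1) i j < 1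
  phi_step : ∀ n : ℕ, ((n : ℝ) + 1) * dt ≤ T → ∀ i j,
    (φ (n + 1) i j - φ n i j) / dt
      = P.M * lapH (mesh L K) (muPhiH P (mesh L K) (φ n) (φ (n + 1)) (ρ (n + 1))) i j
  rho_step : ∀ n : ℕ, ((n : ℝ) + 1) * dt ≤ T → ∀ i j,
    (ρ (n + 1) i j - ρ n i j) / dt
      = P.M * lapH (mesh L K) (muRhoH P (mesh L K) (ρ n) (φ (n + 1)) (ρ (n + 1))) i j

/-- The error `𝒫_h 𝒫_N U(t_m) - u^m`, `t_m = m Δt`. -/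
def err {L : ℝ} [Fact (0 < L)] (K : ℕ) (dt : ℝ) (U : ℝ → C(Torus L, ℝ))
    (u : ℕ → Grid (2 * K + 1)) (m : ℕ) : Grid (2 * K + 1) :=
  proj K (U ((m : ℝ) * dt)) - u m

end Surfactant

end

open Surfactant

noncomputable section

namespace Surfactant

/-! ## Grid functions: summation by parts, Poincaré and interpolation inequalities -/

section Grids

variable {N : ℕ} {h : ℝ}

/-! The proof is an energy estimate in the discrete `H^{-1}` norm. The numerical solution `(f, s)`
is compared with a reference pair `(U, R)` that solves the fully implicit scheme, without lagged
terms, up to small residuals. The difference of the two equations is tested with `(-Δ_h)⁻¹` of the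
errors `e = U - f` and `g = R - s`, so that the chemical potentials end up tested with `e` and `g`
themselves. The cubic and the logarithmic terms are monotone and are dropped; the linear terms give
the dissipation. The delicate term is `∇·(ρ∇φ/|∇^δ φ|)`. The numerical coefficient is at most `1/δ`
because `0 < s < 1`, and the difference of the coefficients only multiplies the reference gradient,
which is bounded relative to its own regularised modulus. Hence this term costs multiples of `‖∇_h
e‖²` and `‖g‖²` with constants that see `α` and `δ` only (`inner2_divNonlin_sub_ge`). No norm of
either solution enters, which is why the restriction on the time step depends on `L` and the
parameters alone. Interpolation between the dissipation and the `H^{-1}` norms absorbs these costs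
(`lower_order_le`); the outcome is `step_energy`, summed by `discrete_gronwall` and packaged as
`comparison`.

The reference on fine grids consists of the grid values of the exact solution, not of its Fourier
projection, plus a constant that makes the grid mean equal to the conserved numerical mean; errors
then have mean zero. The constant is `O(h²)`, since the time derivative of the exact solution is a
discrete Laplacian up to `O(h²)` and so its grid mean hardly drifts.

Consistency in space avoids Taylor expansions of the individual operators. Everything is a function
of `(h, x, y)`, smooth and even in `h`. Centred differences and averages preserve this class, a
difference costing one derivative, and at `h = 0` they become derivatives and the identity. An even
`C²` function of `h` differs from its value at `0` by `O(h²)` (`Reg.abs_sub_le`). The count is `8 =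
4 + 2 + 2` for `Φ` and `6 = 2 + 2 + 2` for `Ψ`: the potential, the outer Laplacian, evenness.

In time, `H²` with values in continuous functions yields a pointwise derivative whose increments are
integrals of one square integrable function, uniform in space (`time_regularity`). This handles the
backward difference quotient, and the lagged terms need only the maximum norm of the increments.
Estimates known for almost every time pass to every time by continuity.

The projection error is added at the end by the triangle inequality (`proj_error`). On coarse grids
the recentred solution may leave `(0, 1)`; there constants serve as the reference, since they solve
the scheme exactly and `h` is bounded below. -/

theorem lapH_sub (u v : Grid N) : lapH h (u - v) = lapH h u - lapH h v := by
  funext i j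
  simp only [lapH, dx, dy, Dx, Dy, Pi.add_apply, Pi.sub_apply]
  ring

theorem Dx_sub (u v : Grid N) : Dx h (u - v) = Dx h u - Dx h v := by
  funext i j
  simp only [Dx, Pi.sub_apply]
  ring

theorem Dy_sub (u v : Grid N) : Dy h (u - v) = Dy h u - Dy h v := by
  funext i j
  simp only [Dy, Pi.sub_apply]
  ring

theorem Dx_add (u v : Grid N) : Dx h (u + v) = Dx h u + Dx h v := by
  funext i j
  simp only [Dx, Pi.add_apply]
  ring

theorem Dy_add (u v : Grid N) : Dy h (u + v) = Dy h u + Dy h v := by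
  funext i j
  simp only [Dy, Pi.add_apply]
  ring

theorem lapH_add (u v : Grid N) : lapH h (u + v) = lapH h u + lapH h v := by
  funext i j
  simp only [lapH, dx, dy, Dx, Dy, Pi.add_apply]
  ring

variable [NeZero N]

theorem sum_dx_mul (F v : Grid N) :
    ∑ i, ∑ j, dx h F i j * v i j = -∑ i, ∑ j, F i j * Dx h v i j := by
  have hx := sum_shift_x (fun i j => F i j * v (i + 1) j / h)
  simp only [sub_add_cancel] at hx
  have e1 : ∀ i j, dx h F i j * v i j = F i j * v i j / h - F (i - 1) j * v i j / h := by
    intro i j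
    simp only [dx]
    ring
  have e2 : ∀ i j, F i j * Dx h v i j = F i j * v (i + 1) j / h - F i j * v i j / h := by
    intro i j
    simp only [Dx]
    ring
  simp only [e1, e2, Finset.sum_sub_distrib, hx]
  ring

theorem sum_dy_mul (F v : Grid N) :
    ∑ i, ∑ j, dy h F i j * v i j = -∑ i, ∑ j, F i j * Dy h v i j := by
  have hx := sum_shift_y (fun i j => F i j * v i (j + 1) / h)
  simp only [sub_add_cancel] at hx
  have e1 : ∀ i j, dy h F i j * v i j = F i j * v i j / h - F i (j - 1) * v i j / h := by
    intro i j
    simp only [dy]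
    ring
  have e2 : ∀ i j, F i j * Dy h v i j = F i j * v i (j + 1) / h - F i j * v i j / h := by
    intro i j
    simp only [Dy]
    ring
  simp only [e1, e2, Finset.sum_sub_distrib, hx]
  ring

/-- The inner product of the edge gradients. -/
def gradIn (h : ℝ) (u v : Grid N) : ℝ :=
  h ^ 2 * ∑ i, ∑ j, (Dx h u i j * Dx h v i j + Dy h u i j * Dy h v i j)

theorem gradSq_eq (u : Grid N) : gradSq h u = gradIn h u u := by
  have hx := sum_shift_x (Dx h u * Dx h u)
  have hy := sum_shift_y (Dy h u * Dy h u)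
  simp only [gradSq, gradIn, inner2, ax, ay, Pi.one_apply, mul_one, ← Finset.sum_div,
    Finset.sum_add_distrib, hx, hy]
  simp only [Pi.mul_apply]
  ring

theorem inner2_lapH (u v : Grid N) : inner2 h (lapH h u) v = -gradIn h u v := by
  simp only [inner2, gradIn, lapH, Pi.add_apply, add_mul, Finset.sum_add_distrib, sum_dx_mul,
    sum_dy_mul]
  ring

theorem inner2_comm (u v : Grid N) : inner2 h u v = inner2 h v u := by
  simp only [inner2, mul_comm]

theorem gradIn_comm (u v : Grid N) : gradIn h u v = gradIn h v u := by
  simp only [gradIn, mul_comm]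

theorem inner2_lapH_comm (u v : Grid N) : inner2 h (lapH h u) v = inner2 h u (lapH h v) := by
  rw [inner2_comm u, inner2_lapH, inner2_lapH, gradIn_comm]

theorem inner2_sub_left (u v w : Grid N) : inner2 h (u - v) w = inner2 h u w - inner2 h v w := by
  simp only [inner2, Pi.sub_apply, sub_mul, Finset.sum_sub_distrib, mul_sub]

theorem inner2_add_left (u v w : Grid N) : inner2 h (u + v) w = inner2 h u w + inner2 h v w := by
  simp only [inner2, Pi.add_apply, add_mul, Finset.sum_add_distrib, mul_add]

theorem inner2_smul_left (c : ℝ) (u w : Grid N) : inner2 h (c • u) w = c * inner2 h u w := by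
  simp only [inner2, Pi.smul_apply, smul_eq_mul, Finset.mul_sum]
  refine Finset.sum_congr rfl fun i _ => Finset.sum_congr rfl fun j _ => by ring

theorem normSq_nonneg (u : Grid N) : 0 ≤ normSq h u :=
  mul_nonneg (sq_nonneg h)
    (Finset.sum_nonneg fun _ _ => Finset.sum_nonneg fun _ _ => mul_self_nonneg _)

theorem gradSq_nonneg (u : Grid N) : 0 ≤ gradSq h u := by
  rw [gradSq_eq]
  exact mul_nonneg (sq_nonneg h) (Finset.sum_nonneg fun _ _ => Finset.sum_nonneg fun _ _ =>
    add_nonneg (mul_self_nonneg _) (mul_self_nonneg _))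

theorem mul_le_young {θ : ℝ} (hθ : 0 < θ) (x y : ℝ) : x * y ≤ θ / 2 * (x * x) + 1 / (2 * θ) * (y * y) := by
  have h1 : θ / 2 * (x * x) + 1 / (2 * θ) * (y * y) - x * y = (θ * x - y) ^ 2 / (2 * θ) := by
    field_simp
    ring
  have h2 : 0 ≤ (θ * x - y) ^ 2 / (2 * θ) := by positivity
  linarith

theorem inner2_le_young {θ : ℝ} (hθ : 0 < θ) (u v : Grid N) :
    inner2 h u v ≤ θ / 2 * normSq h u + 1 / (2 * θ) * normSq h v := by
  have e : θ / 2 * normSq h u + 1 / (2 * θ) * normSq h v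
      = h ^ 2 * ∑ i, ∑ j, (θ / 2 * (u i j * u i j) + 1 / (2 * θ) * (v i j * v i j)) := by
    simp only [normSq, inner2, Finset.sum_add_distrib, ← Finset.mul_sum]
    ring
  rw [e]
  exact mul_le_mul_of_nonneg_left (Finset.sum_le_sum fun i _ => Finset.sum_le_sum fun j _ =>
    mul_le_young hθ _ _) (sq_nonneg h)

theorem gradIn_le_young {θ : ℝ} (hθ : 0 < θ) (u v : Grid N) :
    gradIn h u v ≤ θ / 2 * gradSq h u + 1 / (2 * θ) * gradSq h v := by
  have e : θ / 2 * gradSq h u + 1 / (2 * θ) * gradSq h v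
      = h ^ 2 * ∑ i, ∑ j, ((θ / 2 * (Dx h u i j * Dx h u i j) + 1 / (2 * θ) * (Dx h v i j * Dx h v i j))
        + (θ / 2 * (Dy h u i j * Dy h u i j) + 1 / (2 * θ) * (Dy h v i j * Dy h v i j))) := by
    simp only [gradSq_eq, gradIn, Finset.sum_add_distrib, ← Finset.mul_sum]
    ring
  rw [e]
  exact mul_le_mul_of_nonneg_left (Finset.sum_le_sum fun i _ => Finset.sum_le_sum fun j _ =>
    add_le_add (mul_le_young hθ _ _) (mul_le_young hθ _ _)) (sq_nonneg h)

theorem neg_inner2 (u v : Grid N) : inner2 h (-u) v = -inner2 h u v := by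
  have := inner2_smul_left (h := h) (-1) u v
  simpa using this

theorem normSq_neg (u : Grid N) : normSq h (-u) = normSq h u := by
  simp [normSq, inner2]

theorem abs_inner2_le_young {θ : ℝ} (hθ : 0 < θ) (u v : Grid N) :
    |inner2 h u v| ≤ θ / 2 * normSq h u + 1 / (2 * θ) * normSq h v := by
  refine abs_le.2 ⟨?_, inner2_le_young hθ u v⟩
  have := inner2_le_young (h := h) hθ (-u) v
  rw [neg_inner2, normSq_neg] at this
  linarith

theorem normSq_add_le (u v : Grid N) : normSq h (u + v) ≤ 2 * normSq h u + 2 * normSq h v := by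
  have : normSq h (u + v) = normSq h u + normSq h v + 2 * inner2 h u v := by
    simp only [normSq]
    rw [inner2_add_left, inner2_comm u, inner2_comm v, inner2_add_left, inner2_add_left,
      inner2_comm v u]
    ring
  have h1 := inner2_le_young (h := h) one_pos u v
  linarith

theorem gradIn_sub_left (u v w : Grid N) : gradIn h (u - v) w = gradIn h u w - gradIn h v w := by
  simp only [gradIn, Dx_sub, Dy_sub, Pi.sub_apply, sub_mul, Finset.sum_sub_distrib,
    Finset.sum_add_distrib]
  ring

theorem gradIn_add_left (u v w : Grid N) : gradIn h (u + v) w = gradIn h u w + gradIn h v w := by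
  simp only [gradIn, Dx_add, Dy_add, Pi.add_apply, add_mul, mul_add,
    Finset.sum_add_distrib]
  ring

theorem gradSq_add_le (u v : Grid N) : gradSq h (u + v) ≤ 2 * gradSq h u + 2 * gradSq h v := by
  have h1 := gradIn_le_young (h := h) one_pos u v
  have : gradSq h (u + v) = gradSq h u + gradSq h v + 2 * gradIn h u v := by
    simp only [gradSq_eq]
    rw [gradIn_add_left, gradIn_comm u, gradIn_comm v, gradIn_add_left, gradIn_add_left,
      gradIn_comm v u]
    ring
  linarith

/-- `‖u‖_{-1,h}²`. -/
def negSq (h : ℝ) (u : Grid N) : ℝ := gradSq h (invLap h u)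

theorem negSq_nonneg (u : Grid N) : 0 ≤ negSq h u := gradSq_nonneg _

theorem sum_eq_zero_of_mean {u : Grid N} (hu : mean u = 0) : ∑ i, ∑ j, u i j = 0 := by
  have hN : ((N : ℝ) ^ 2) ≠ 0 := pow_ne_zero 2 (Nat.cast_ne_zero.2 (NeZero.ne N))
  rw [mean, div_eq_zero_iff] at hu
  exact hu.resolve_right hN

theorem mean_sub (u v : Grid N) : mean (u - v) = mean u - mean v := by
  simp only [mean, Pi.sub_apply, Finset.sum_sub_distrib, sub_div]

theorem mean_add (u v : Grid N) : mean (u + v) = mean u + mean v := by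
  simp only [mean, Pi.add_apply, Finset.sum_add_distrib, add_div]

theorem mean_const (c : ℝ) : mean (fun _ _ => c : Grid N) = c := by
  have hN : ((N : ℝ) ^ 2) ≠ 0 := pow_ne_zero 2 (Nat.cast_ne_zero.2 (NeZero.ne N))
  rw [mean, sum_const_grid, mul_div_cancel_left₀ _ hN]

theorem mean_smul (c : ℝ) (u : Grid N) : mean (c • u) = c * mean u := by
  simp only [mean, Pi.smul_apply, smul_eq_mul, ← Finset.mul_sum, mul_div_assoc]

theorem mean_lapH (u : Grid N) : mean (lapH h u) = 0 := by
  rw [mean, sum_lapH, zero_div]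

theorem invLap_unique (hh : h ≠ 0) {u ψ : Grid N} (h1 : mean ψ = 0)
    (h2 : ∀ i j, -lapH h ψ i j = u i j - mean u) : invLap h u = ψ :=
  (existsUnique_invLap hh u).unique (invLap_spec hh u) ⟨h1, h2⟩

theorem invLap_sub (hh : h ≠ 0) (u v : Grid N) : invLap h (u - v) = invLap h u - invLap h v := by
  have hu := invLap_spec hh u
  have hv := invLap_spec hh v
  refine invLap_unique hh (by rw [mean_sub, hu.1, hv.1, sub_zero]) fun i j => ?_
  have a := hu.2 i j
  have b := hv.2 i j
  rw [lapH_sub, mean_sub, Pi.sub_apply, Pi.sub_apply, Pi.sub_apply, Pi.sub_apply]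
  linarith

theorem invLap_add (hh : h ≠ 0) (u v : Grid N) : invLap h (u + v) = invLap h u + invLap h v := by
  have hu := invLap_spec hh u
  have hv := invLap_spec hh v
  refine invLap_unique hh (by rw [mean_add, hu.1, hv.1, add_zero]) fun i j => ?_
  have a := hu.2 i j
  have b := hv.2 i j
  rw [lapH_add, mean_add, Pi.add_apply, Pi.add_apply, Pi.add_apply, Pi.add_apply]
  linarith

theorem inner2_eq_gradIn_invLap (hh : h ≠ 0) (u : Grid N) {ψ : Grid N} (hψ : mean ψ = 0) :
    inner2 h u ψ = gradIn h (invLap h u) ψ := by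
  have hu := invLap_spec hh u
  have e : u = -lapH h (invLap h u) + fun _ _ => mean u := by
    funext i j
    have := hu.2 i j
    simp only [Pi.add_apply, Pi.neg_apply]
    linarith
  have hc : inner2 h (fun _ _ => mean u : Grid N) ψ = 0 := by
    simp only [inner2, ← Finset.mul_sum, sum_eq_zero_of_mean hψ, mul_zero]
  conv_lhs => rw [e]
  rw [inner2_add_left, hc, neg_inner2, inner2_lapH]
  ring

/-- Convexity of the squared norm, with the inner product rewritten through `(-Δ_h)⁻¹`: the usual
gain from an implicit Euler step. -/
theorem negSq_sub_le (hh : h ≠ 0) (u v : Grid N) :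
    negSq h u - negSq h v ≤ 2 * inner2 h (u - v) (invLap h u) := by
  rw [inner2_eq_gradIn_invLap hh _ (invLap_spec hh u).1, invLap_sub hh, gradIn_sub_left, ← gradSq_eq]
  have := gradIn_le_young (h := h) one_pos (invLap h v) (invLap h u)
  simp only [negSq]
  linarith

theorem negSq_add_le (hh : h ≠ 0) (u v : Grid N) :
    negSq h (u + v) ≤ 2 * negSq h u + 2 * negSq h v := by
  simp only [negSq, invLap_add hh]
  exact gradSq_add_le _ _

/-- Summation by parts against `ψ = (-Δ_h)⁻¹ u` gives `‖u‖² = (∇_h u, ∇_h ψ)`; then Young. This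
interpolates `ℓ²` between `H¹` and `H^{-1}`. -/
theorem normSq_le_negSq (hh : h ≠ 0) {u : Grid N} (hu : mean u = 0) {θ : ℝ} (hθ : 0 < θ) :
    normSq h u ≤ θ * gradSq h u + 1 / θ * negSq h u := by
  have h1 : normSq h u = gradIn h u (invLap h u) := by
    rw [normSq, inner2_eq_gradIn_invLap hh u hu, gradIn_comm]
  rw [h1]
  refine (gradIn_le_young hθ _ _).trans ?_
  have a := gradSq_nonneg (h := h) u
  have b := negSq_nonneg (h := h) u
  have : 1 / (2 * θ) * gradSq h (invLap h u) = 1 / θ * negSq h u / 2 := by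
    rw [negSq]
    field_simp
  rw [this]
  have : 0 ≤ θ * gradSq h u := by positivity
  have : 0 ≤ 1 / θ * negSq h u := by positivity
  linarith

theorem gradSq_le_lapH {u : Grid N} {θ : ℝ} (hθ : 0 < θ) :
    gradSq h u ≤ θ / 2 * normSq h (lapH h u) + 1 / (2 * θ) * normSq h u := by
  have := inner2_le_young (h := h) hθ (-lapH h u) u
  rw [neg_inner2, inner2_lapH, neg_neg, normSq_neg, ← gradSq_eq] at this
  exact this

/-- Two interpolations are chained, `H¹` between `H²` and `ℓ²`, and `ℓ²` between `H¹` and `H^{-1}`.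
The weights are matched so that exactly half of `gradSq` returns on the right and is absorbed. -/
theorem gradSq_le_negSq (hh : h ≠ 0) {u : Grid N} (hu : mean u = 0) {θ : ℝ} (hθ : 0 < θ) :
    gradSq h u ≤ θ * normSq h (lapH h u) + 1 / θ ^ 2 * negSq h u := by
  have h1 := gradSq_le_lapH (h := h) (u := u) hθ
  have h2 := normSq_le_negSq hh hu hθ
  have h3 : 1 / (2 * θ) * normSq h u ≤ 1 / (2 * θ) * (θ * gradSq h u + 1 / θ * negSq h u) :=
    mul_le_mul_of_nonneg_left h2 (by positivity)
  have h4 : 1 / (2 * θ) * (θ * gradSq h u + 1 / θ * negSq h u)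
      = gradSq h u / 2 + 1 / θ ^ 2 * negSq h u / 2 := by
    field_simp
  linarith

/-- Walk around the cycle from `b` to `a` in fewer than `N` steps and apply Cauchy–Schwarz. -/
theorem sq_sub_le_sum_diff (f : ZMod N → ℝ) (a b : ZMod N) :
    (f a - f b) ^ 2 ≤ N * ∑ i, (f (i + 1) - f i) ^ 2 := by
  set k := (a - b).val with hk
  have hkN : k < N := ZMod.val_lt _
  have e1 : f a - f b = ∑ m ∈ Finset.range k, (f (b + (m : ZMod N) + 1) - f (b + (m : ZMod N))) := by
    have := Finset.sum_range_sub (fun m : ℕ => f (b + (m : ZMod N))) k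
    simp only [Nat.cast_add, Nat.cast_one, ← add_assoc, Nat.cast_zero, add_zero] at this
    rw [this, hk, ZMod.natCast_zmod_val, add_sub_cancel]
  have e2 := sq_sum_le_card_mul_sum_sq (s := Finset.range k)
    (f := fun m : ℕ => f (b + (m : ZMod N) + 1) - f (b + (m : ZMod N)))
  rw [← e1, Finset.card_range] at e2
  have e3 : ∑ m ∈ Finset.range k, (f (b + (m : ZMod N) + 1) - f (b + (m : ZMod N))) ^ 2
      ≤ ∑ i, (f (i + 1) - f i) ^ 2 := by
    -- The walk is shorter than a full turn, so it uses each edge at most once.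
    have hinj : Set.InjOn (fun m : ℕ => b + (m : ZMod N)) (Finset.range k : Set ℕ) := by
      intro m hm m' hm' hmm
      have hm1 : m < N := lt_trans (by simpa using hm) hkN
      have hm2 : m' < N := lt_trans (by simpa using hm') hkN
      have := congrArg ZMod.val (add_left_cancel hmm)
      rwa [ZMod.val_natCast_of_lt hm1, ZMod.val_natCast_of_lt hm2] at this
    rw [← Finset.sum_image (f := fun i => (f (i + 1) - f i) ^ 2) hinj]
    exact Finset.sum_le_sum_of_subset_of_nonneg (Finset.subset_univ _) fun i _ _ => sq_nonneg _
  have h0 : (0 : ℝ) ≤ ∑ i, (f (i + 1) - f i) ^ 2 := Finset.sum_nonneg fun i _ => sq_nonneg _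
  have hkN' : (k : ℝ) ≤ N := by exact_mod_cast hkN.le
  calc _ ≤ _ := e2
    _ ≤ (k : ℝ) * ∑ i, (f (i + 1) - f i) ^ 2 := mul_le_mul_of_nonneg_left e3 (Nat.cast_nonneg k)
    _ ≤ _ := mul_le_mul_of_nonneg_right hkN' h0

/-- For mean zero, the sum of `(u p - u p')²` over all pairs of nodes is `2 N² ∑ u²`. Each pair is
joined through the corner `(i', j)`, one leg in a column and one in a row. -/
theorem sum_sq_le_of_mean_zero {u : Grid N} (hu : mean u = 0) :
    ∑ i, ∑ j, u i j ^ 2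
      ≤ (N : ℝ) ^ 2 * ∑ i, ∑ j, ((u (i + 1) j - u i j) ^ 2 + (u i (j + 1) - u i j) ^ 2) := by
  have hN : (0 : ℝ) < N := Nat.cast_pos.2 (NeZero.pos N)
  have hs := sum_eq_zero_of_mean hu
  set S := ∑ i, ∑ j, u i j ^ 2 with hS
  set A := ∑ i, ∑ j, (u (i + 1) j - u i j) ^ 2 with hA
  set B := ∑ i, ∑ j, (u i (j + 1) - u i j) ^ 2 with hB
  have hcol : ∀ i i' j, (u i j - u i' j) ^ 2 ≤ N * ∑ m, (u (m + 1) j - u m j) ^ 2 :=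
    fun i i' j => sq_sub_le_sum_diff (fun m => u m j) i i'
  have hrow : ∀ i j j', (u i j - u i j') ^ 2 ≤ N * ∑ m, (u i (m + 1) - u i m) ^ 2 :=
    fun i j j' => sq_sub_le_sum_diff (fun m => u i m) j j'
  have key : ∑ i, ∑ j, ∑ i', ∑ j', (u i j - u i' j') ^ 2
      ≤ ∑ i : ZMod N, ∑ j, ∑ i', ∑ _j' : ZMod N, (2 * (N * ∑ m, (u (m + 1) j - u m j) ^ 2)
        + 2 * (N * ∑ m, (u i' (m + 1) - u i' m) ^ 2)) := by
    refine Finset.sum_le_sum fun i _ => Finset.sum_le_sum fun j _ => Finset.sum_le_sum fun i' _ =>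
      Finset.sum_le_sum fun j' _ => ?_
    have a := hcol i i' j
    have b := hrow i' j j'
    nlinarith [sq_nonneg ((u i j - u i' j) - (u i' j - u i' j'))]
  have lhs : ∑ i, ∑ j, ∑ i', ∑ j', (u i j - u i' j') ^ 2 = 2 * (N : ℝ) ^ 2 * S := by
    have e : ∀ i j i' j', (u i j - u i' j') ^ 2 = u i j ^ 2 + u i' j' ^ 2 - 2 * (u i j * u i' j') := by
      intros
      ring
    simp only [e, Finset.sum_add_distrib, Finset.sum_sub_distrib, ← Finset.mul_sum, hs, ← hS]
    simp only [Finset.sum_const, Finset.card_univ, ZMod.card, nsmul_eq_mul, ← Finset.mul_sum,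
      ← hS]
    simp
    ring
  have rhs : ∑ i : ZMod N, ∑ j, ∑ i', ∑ _j' : ZMod N, (2 * (N * ∑ m, (u (m + 1) j - u m j) ^ 2)
        + 2 * (N * ∑ m, (u i' (m + 1) - u i' m) ^ 2)) = 2 * (N : ℝ) ^ 4 * (A + B) := by
    have hA' : ∑ j, ∑ m, (u (m + 1) j - u m j) ^ 2 = A := Finset.sum_comm
    simp only [Finset.sum_const, Finset.card_univ, ZMod.card, nsmul_eq_mul, ← Finset.mul_sum,
      Finset.sum_add_distrib, hA', ← hB]
    ring
  rw [lhs, rhs] at key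
  have e2 : ∑ i, ∑ j, ((u (i + 1) j - u i j) ^ 2 + (u i (j + 1) - u i j) ^ 2) = A + B := by
    simp only [Finset.sum_add_distrib, hA, hB]
  rw [e2]
  have h2 : 0 < 2 * (N : ℝ) ^ 2 := by positivity
  refine le_of_mul_le_mul_left ?_ h2
  calc _ ≤ _ := key
    _ = _ := by ring

/-- The discrete Poincaré inequality. -/
theorem normSq_le_gradSq (hh : h ≠ 0) {u : Grid N} (hu : mean u = 0) :
    normSq h u ≤ (h * N) ^ 2 * gradSq h u := by
  have h1 := sum_sq_le_of_mean_zero hu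
  have e : ∑ i, ∑ j, ((u (i + 1) j - u i j) ^ 2 + (u i (j + 1) - u i j) ^ 2)
      = h ^ 2 * ∑ i, ∑ j, (Dx h u i j * Dx h u i j + Dy h u i j * Dy h u i j) := by
    simp only [Finset.mul_sum]
    refine Finset.sum_congr rfl fun i _ => Finset.sum_congr rfl fun j _ => ?_
    simp only [Dx, Dy]
    field_simp
  rw [e] at h1
  rw [gradSq_eq, gradIn]
  have : normSq h u = h ^ 2 * ∑ i, ∑ j, u i j ^ 2 := by
    simp only [normSq, inner2, sq]
  rw [this]
  calc _ ≤ h ^ 2 * _ := mul_le_mul_of_nonneg_left h1 (sq_nonneg h)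
    _ = _ := by ring

/-- The `H^{-1}` norm is controlled by the `ℓ²` norm. -/
theorem negSq_le_normSq (hh : h ≠ 0) (hN : 0 < h * N) (u : Grid N) :
    negSq h u ≤ (h * N) ^ 2 * normSq h u := by
  have h0 := invLap_spec hh u
  have e : negSq h u = inner2 h u (invLap h u) := by
    rw [inner2_eq_gradIn_invLap hh u h0.1, negSq, gradSq_eq]
  -- With the Poincaré constant as weight, the term in `invLap h u` is at most half of `negSq h u`.
  have h1 := inner2_le_young (h := h) (θ := (h * N) ^ 2) (by positivity) u (invLap h u)
  have h2 := normSq_le_gradSq hh h0.1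
  have h3 : 1 / (2 * (h * N) ^ 2) * normSq h (invLap h u)
      ≤ 1 / (2 * (h * N) ^ 2) * ((h * N) ^ 2 * negSq h u) :=
    mul_le_mul_of_nonneg_left h2 (by positivity)
  have h4 : 1 / (2 * (h * N) ^ 2) * ((h * N) ^ 2 * negSq h u) = negSq h u / 2 := by
    have := hN.ne'
    generalize h * (N : ℝ) = H at *
    field_simp
  linarith

theorem normSq_le_of_abs_le {u : Grid N} {b : ℝ} (hb : ∀ i j, |u i j| ≤ b) :
    normSq h u ≤ (h * N) ^ 2 * b ^ 2 := by
  have : ∑ i, ∑ j, u i j * u i j ≤ ∑ _i : ZMod N, ∑ _j : ZMod N, b ^ 2 :=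
    Finset.sum_le_sum fun i _ => Finset.sum_le_sum fun j _ => by
      have := abs_le.1 (hb i j)
      nlinarith
  rw [sum_const_grid] at this
  calc _ ≤ _ := mul_le_mul_of_nonneg_left this (sq_nonneg h)
    _ = _ := by ring

end Grids

/-! ## Estimates for the nonlinear terms -/

section Nonlinear

variable {N : ℕ} {h δ : ℝ}

/-- The cell average of the edge gradient, as in `modGradH` without regularisation. -/
def cellGrad (h : ℝ) (g : Grid N) : Grid N := fun i j =>
  Real.sqrt ((Dx h g i j ^ 2 + Dx h g (i - 1) j ^ 2 + Dy h g i j ^ 2 + Dy h g i (j - 1) ^ 2) / 2)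

/-- Minkowski's inequality for Euclidean vectors with entries the four differences and `√2 δ`; the
last entry is common to both vectors and cancels in the difference. -/
theorem sqrt_sub_sqrt_le (a b c d a' b' c' d' δ : ℝ) :
    Real.sqrt ((a ^ 2 + b ^ 2 + c ^ 2 + d ^ 2) / 2 + δ ^ 2)
      ≤ Real.sqrt ((a' ^ 2 + b' ^ 2 + c' ^ 2 + d' ^ 2) / 2 + δ ^ 2)
        + Real.sqrt (((a - a') ^ 2 + (b - b') ^ 2 + (c - c') ^ 2 + (d - d') ^ 2) / 2) := by
  set S := (a' ^ 2 + b' ^ 2 + c' ^ 2 + d' ^ 2) / 2 + δ ^ 2 with hS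
  set E := ((a - a') ^ 2 + (b - b') ^ 2 + (c - c') ^ 2 + (d - d') ^ 2) / 2 with hE
  have hS0 : 0 ≤ S := by positivity
  have hE0 : 0 ≤ E := by positivity
  have hcs : (a' * (a - a') + b' * (b - b') + c' * (c - c') + d' * (d - d')) / 2
      ≤ Real.sqrt S * Real.sqrt E := by
    rw [← Real.sqrt_mul hS0]
    refine Real.le_sqrt_of_sq_le ?_
    have h1 : ((a' * (a - a') + b' * (b - b') + c' * (c - c') + d' * (d - d')) / 2) ^ 2
        ≤ ((a' ^ 2 + b' ^ 2 + c' ^ 2 + d' ^ 2) / 2) * E := by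
      rw [hE]
      generalize a - a' = x
      generalize b - b' = y
      generalize c - c' = z
      generalize d - d' = w
      nlinarith [sq_nonneg (a' * y - b' * x), sq_nonneg (a' * z - c' * x), sq_nonneg (a' * w - d' * x),
        sq_nonneg (b' * z - c' * y), sq_nonneg (b' * w - d' * y), sq_nonneg (c' * w - d' * z)]
    refine h1.trans (mul_le_mul_of_nonneg_right ?_ hE0)
    rw [hS]
    nlinarith [sq_nonneg δ]
  refine Real.sqrt_le_iff.2 ⟨by positivity, ?_⟩
  rw [add_sq, Real.sq_sqrt hS0, Real.sq_sqrt hE0]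
  nlinarith

theorem abs_modGradH_sub_le (a b : Grid N) (i j : ZMod N) :
    |modGradH h δ a i j - modGradH h δ b i j| ≤ cellGrad h (a - b) i j := by
  simp only [modGradH, cellGrad, Dx_sub, Dy_sub, Pi.sub_apply]
  have h1 := sqrt_sub_sqrt_le (Dx h a i j) (Dx h a (i - 1) j) (Dy h a i j) (Dy h a i (j - 1))
    (Dx h b i j) (Dx h b (i - 1) j) (Dy h b i j) (Dy h b i (j - 1)) δ
  have h2 := sqrt_sub_sqrt_le (Dx h b i j) (Dx h b (i - 1) j) (Dy h b i j) (Dy h b i (j - 1))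
    (Dx h a i j) (Dx h a (i - 1) j) (Dy h a i j) (Dy h a i (j - 1)) δ
  simp only [sub_sq_comm (Dx h b _ _), sub_sq_comm (Dy h b _ _)] at h2
  rw [abs_sub_le_iff]
  constructor <;> linarith

theorem le_modGradH (a : Grid N) (i j : ZMod N) : δ ≤ modGradH h δ a i j := by
  refine Real.le_sqrt_of_sq_le ?_
  have := sq_nonneg (Dx h a i j)
  have := sq_nonneg (Dx h a (i - 1) j)
  have := sq_nonneg (Dy h a i j)
  have := sq_nonneg (Dy h a i (j - 1))
  linarith

theorem sqrt_two_mul_modGradH (a : Grid N) (i j : ZMod N) :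
    (Real.sqrt 2 * modGradH h δ a i j) ^ 2
      = Dx h a i j ^ 2 + Dx h a (i - 1) j ^ 2 + Dy h a i j ^ 2 + Dy h a i (j - 1) ^ 2 + 2 * δ ^ 2 := by
  rw [mul_pow, Real.sq_sqrt zero_le_two, modGradH, Real.sq_sqrt (by positivity)]
  ring

/-- An edge difference enters the cell average on both sides of its edge. The primed versions refer
to the cell on the far side. -/
theorem abs_Dx_le (a : Grid N) (i j : ZMod N) :
    |Dx h a i j| ≤ Real.sqrt 2 * modGradH h δ a i j := by
  refine abs_le_of_sq_le_sq ?_ (mul_nonneg (Real.sqrt_nonneg _) (Real.sqrt_nonneg _))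
  rw [sqrt_two_mul_modGradH]
  nlinarith [sq_nonneg (Dx h a (i - 1) j), sq_nonneg (Dy h a i j), sq_nonneg (Dy h a i (j - 1)),
    sq_nonneg δ]

theorem abs_Dx_le' (a : Grid N) (i j : ZMod N) :
    |Dx h a i j| ≤ Real.sqrt 2 * modGradH h δ a (i + 1) j := by
  refine abs_le_of_sq_le_sq ?_ (mul_nonneg (Real.sqrt_nonneg _) (Real.sqrt_nonneg _))
  rw [sqrt_two_mul_modGradH, add_sub_cancel_right]
  nlinarith [sq_nonneg (Dx h a (i + 1) j), sq_nonneg (Dy h a (i + 1) j),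
    sq_nonneg (Dy h a (i + 1) (j - 1)), sq_nonneg δ]

theorem abs_Dy_le (a : Grid N) (i j : ZMod N) :
    |Dy h a i j| ≤ Real.sqrt 2 * modGradH h δ a i j := by
  refine abs_le_of_sq_le_sq ?_ (mul_nonneg (Real.sqrt_nonneg _) (Real.sqrt_nonneg _))
  rw [sqrt_two_mul_modGradH]
  nlinarith [sq_nonneg (Dx h a (i - 1) j), sq_nonneg (Dx h a i j), sq_nonneg (Dy h a i (j - 1)),
    sq_nonneg δ]

theorem abs_Dy_le' (a : Grid N) (i j : ZMod N) :
    |Dy h a i j| ≤ Real.sqrt 2 * modGradH h δ a i (j + 1) := by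
  refine abs_le_of_sq_le_sq ?_ (mul_nonneg (Real.sqrt_nonneg _) (Real.sqrt_nonneg _))
  rw [sqrt_two_mul_modGradH, add_sub_cancel_right]
  nlinarith [sq_nonneg (Dx h a i (j + 1)), sq_nonneg (Dx h a (i - 1) (j + 1)),
    sq_nonneg (Dy h a i (j + 1)), sq_nonneg δ]

/-- `|r / W - s / V| |A| ≤ √2 (|r - s| + E / δ)`, squared. -/
theorem sq_ratio_mul_le {r s W V A E : ℝ} (hδ : 0 < δ) (hW : δ ≤ W) (hV : δ ≤ V)
    (hs0 : 0 ≤ s) (hs1 : s ≤ 1) (hE : |W - V| ≤ E) (hA : |A| ≤ Real.sqrt 2 * W) :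
    ((r / W - s / V) * A) ^ 2 ≤ 4 * ((r - s) ^ 2 + E ^ 2 / δ ^ 2) := by
  have hW0 : 0 < W := hδ.trans_le hW
  have hV0 : 0 < V := hδ.trans_le hV
  have hE0 : 0 ≤ E := (abs_nonneg _).trans hE
  -- The gradient `A` is divided by its own modulus `W`, leaving a bounded factor; what remains
  -- involves the other pair only through `s ≤ 1` and `V ≥ δ`.
  have e : (r / W - s / V) * A = ((r - s) + s * (V - W) / V) * (A / W) := by
    field_simp
    ring
  have h1 : (A / W) ^ 2 ≤ 2 := by
    rw [div_pow, div_le_iff₀ (by positivity)]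
    have := sq_le_sq' (by linarith [abs_nonneg A, neg_abs_le A]) hA
    rw [sq_abs, mul_pow, Real.sq_sqrt zero_le_two] at this
    exact this
  have h2 : (s * (V - W) / V) ^ 2 ≤ E ^ 2 / δ ^ 2 := by
    rw [← div_pow]
    refine sq_le_sq' ?_ ?_
    all_goals
      have hb : |s * (V - W) / V| ≤ E / δ := by
        rw [abs_div, abs_mul, abs_of_pos hV0, abs_of_nonneg hs0, abs_sub_comm]
        have : s * |W - V| ≤ E := by nlinarith [abs_nonneg (W - V)]
        gcongr
      have := abs_le.1 hb
      linarith
  rw [e, mul_pow]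
  have h3 : (r - s + s * (V - W) / V) ^ 2 ≤ 2 * ((r - s) ^ 2 + E ^ 2 / δ ^ 2) := by
    nlinarith [sq_nonneg (r - s - s * (V - W) / V)]
  calc _ ≤ (2 * ((r - s) ^ 2 + E ^ 2 / δ ^ 2)) * 2 := by gcongr
    _ = _ := by ring

/-- Write the flux difference as `p̄ (A - B)` plus `(q̄ - p̄) A`, bars denoting edge averages. Only
the bounded coefficient `p` meets the gradient error directly, and the coefficient error always
carries the gradient `A` that belongs to `q`. -/
theorem edge_flux_le {q q' p p' A B G G' : ℝ} (hp : p ≤ 1 / δ) (hp' : p' ≤ 1 / δ)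
    (hG : ((q - p) * A) ^ 2 ≤ G) (hG' : ((q' - p') * A) ^ 2 ≤ G') :
    ((q' + q) / 2 * A - (p' + p) / 2 * B) * (A - B)
      ≤ 1 / δ * (A - B) ^ 2 + (G + G') / 4 + (A - B) ^ 2 / 2 := by
  have e : ((q' + q) / 2 * A - (p' + p) / 2 * B) * (A - B)
      = (p' + p) / 2 * (A - B) ^ 2 + ((q - p) * A) * (A - B) / 2 + ((q' - p') * A) * (A - B) / 2 := by
    ring
  have h1 : (p' + p) / 2 * (A - B) ^ 2 ≤ 1 / δ * (A - B) ^ 2 :=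
    mul_le_mul_of_nonneg_right (by linarith) (sq_nonneg _)
  rw [e]
  nlinarith [sq_nonneg ((q - p) * A - (A - B)), sq_nonneg ((q' - p') * A - (A - B))]

variable [NeZero N]

theorem sum_shift_x' (f : Grid N) : ∑ i, ∑ j, f (i + 1) j = ∑ i, ∑ j, f i j :=
  Equiv.sum_comp (Equiv.addRight (1 : ZMod N)) fun i => ∑ j, f i j

theorem sum_shift_y' (f : Grid N) : ∑ i, ∑ j, f i (j + 1) = ∑ i, ∑ j, f i j :=
  Finset.sum_congr rfl fun i _ => Equiv.sum_comp (Equiv.addRight (1 : ZMod N)) fun j => f i j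

theorem sum_cellGrad_sq (e : Grid N) :
    ∑ i, ∑ j, cellGrad h e i j ^ 2 = ∑ i, ∑ j, (Dx h e i j ^ 2 + Dy h e i j ^ 2) := by
  have hx := sum_shift_x (fun i j => Dx h e i j ^ 2)
  have hy := sum_shift_y (fun i j => Dy h e i j ^ 2)
  have e1 : ∀ i j, cellGrad h e i j ^ 2
      = (Dx h e i j ^ 2 + Dx h e (i - 1) j ^ 2 + Dy h e i j ^ 2 + Dy h e i (j - 1) ^ 2) / 2 :=
    fun i j => Real.sq_sqrt (by positivity)
  simp only [e1, ← Finset.sum_div, Finset.sum_add_distrib, hx, hy]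
  ring

theorem gradSq_eq_sum (e : Grid N) :
    gradSq h e = h ^ 2 * ∑ i, ∑ j, (Dx h e i j ^ 2 + Dy h e i j ^ 2) := by
  simp only [gradSq_eq, gradIn, sq]

theorem normSq_eq_sum (e : Grid N) : normSq h e = h ^ 2 * ∑ i, ∑ j, e i j ^ 2 := by
  simp only [normSq, inner2, sq]

theorem normSq_modGradH_sub_le (a b : Grid N) :
    normSq h (modGradH h δ a - modGradH h δ b) ≤ gradSq h (a - b) := by
  rw [gradSq_eq_sum, normSq_eq_sum, ← sum_cellGrad_sq]
  refine mul_le_mul_of_nonneg_left (Finset.sum_le_sum fun i _ => Finset.sum_le_sum fun j _ => ?_)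
    (sq_nonneg h)
  exact sq_le_sq.2 ((abs_modGradH_sub_le a b i j).trans (le_abs_self _))

theorem inner2_divNonlin (a r e : Grid N) :
    inner2 h (divNonlin h δ a r) e = -(h ^ 2 * ∑ i, ∑ j,
      (Ax (r / modGradH h δ a) i j * Dx h a i j * Dx h e i j
        + Ay (r / modGradH h δ a) i j * Dy h a i j * Dy h e i j)) := by
  simp only [inner2, divNonlin, Pi.add_apply, add_mul, Finset.sum_add_distrib, sum_dx_mul,
    sum_dy_mul, Pi.mul_apply]
  ring

/-- The nonlinear diffusion is one-sided Lipschitz, with constants that depend on `δ` only. -/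
theorem inner2_divNonlin_sub_ge (hδ : 0 < δ) (a b r s : Grid N)
    (hs : ∀ i j, 0 ≤ s i j ∧ s i j ≤ 1) :
    -(1 / δ * gradSq h (a - b) + 4 * normSq h (r - s) + (4 / δ ^ 2 + 1 / 2) * gradSq h (a - b))
      ≤ inner2 h (divNonlin h δ a r - divNonlin h δ b s) (a - b) := by
  rw [inner2_sub_left, inner2_divNonlin, inner2_divNonlin, gradSq_eq_sum, normSq_eq_sum]
  set W := modGradH h δ a with hW
  set V := modGradH h δ b with hV
  set E := cellGrad h (a - b) with hE
  -- `G` bounds the squared coefficient error times any of the four edge differences of `a` around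
  -- the cell, so one grid function serves both directions.
  set G : Grid N := fun i j => 4 * ((r i j - s i j) ^ 2 + E i j ^ 2 / δ ^ 2) with hG
  have hs' : ∀ i j, s i j / V i j ≤ 1 / δ := fun i j =>
    div_le_div₀ zero_le_one (hs i j).2 hδ (le_modGradH b i j)
  have hx : ∀ i j, (Ax (r / W) i j * Dx h a i j - Ax (s / V) i j * Dx h b i j) * Dx h (a - b) i j
      ≤ 1 / δ * Dx h (a - b) i j ^ 2 + (G i j + G (i + 1) j) / 4 + Dx h (a - b) i j ^ 2 / 2 := by
    intro i j
    rw [Dx_sub]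
    exact edge_flux_le (hs' i j) (hs' (i + 1) j)
      (sq_ratio_mul_le hδ (le_modGradH a i j) (le_modGradH b i j) (hs i j).1 (hs i j).2
        (abs_modGradH_sub_le a b i j) (abs_Dx_le a i j))
      (sq_ratio_mul_le hδ (le_modGradH a (i + 1) j) (le_modGradH b (i + 1) j) (hs (i + 1) j).1
        (hs (i + 1) j).2 (abs_modGradH_sub_le a b (i + 1) j) (abs_Dx_le' a i j))
  have hy : ∀ i j, (Ay (r / W) i j * Dy h a i j - Ay (s / V) i j * Dy h b i j) * Dy h (a - b) i j
      ≤ 1 / δ * Dy h (a - b) i j ^ 2 + (G i j + G i (j + 1)) / 4 + Dy h (a - b) i j ^ 2 / 2 := by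
    intro i j
    rw [Dy_sub]
    exact edge_flux_le (hs' i j) (hs' i (j + 1))
      (sq_ratio_mul_le hδ (le_modGradH a i j) (le_modGradH b i j) (hs i j).1 (hs i j).2
        (abs_modGradH_sub_le a b i j) (abs_Dy_le a i j))
      (sq_ratio_mul_le hδ (le_modGradH a i (j + 1)) (le_modGradH b i (j + 1)) (hs i (j + 1)).1
        (hs i (j + 1)).2 (abs_modGradH_sub_le a b i (j + 1)) (abs_Dy_le' a i j))
  have hsum := Finset.sum_le_sum fun i (_ : i ∈ Finset.univ) =>
    Finset.sum_le_sum fun j (_ : j ∈ Finset.univ) => add_le_add (hx i j) (hy i j)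
  have hGsum : ∑ i, ∑ j, G i j = 4 * (∑ i, ∑ j, (r i j - s i j) ^ 2)
      + 4 / δ ^ 2 * ∑ i, ∑ j, (Dx h (a - b) i j ^ 2 + Dy h (a - b) i j ^ 2) := by
    rw [← sum_cellGrad_sq]
    simp only [hG, ← Finset.mul_sum, Finset.sum_add_distrib, ← Finset.sum_div]
    ring
  have hl : ∑ i, ∑ j, ((Ax (r / W) i j * Dx h a i j - Ax (s / V) i j * Dx h b i j) * Dx h (a - b) i j
        + (Ay (r / W) i j * Dy h a i j - Ay (s / V) i j * Dy h b i j) * Dy h (a - b) i j)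
      = ∑ i, ∑ j, (Ax (r / W) i j * Dx h a i j * Dx h (a - b) i j
          + Ay (r / W) i j * Dy h a i j * Dy h (a - b) i j)
        - ∑ i, ∑ j, (Ax (s / V) i j * Dx h b i j * Dx h (a - b) i j
          + Ay (s / V) i j * Dy h b i j * Dy h (a - b) i j) := by
    simp only [← Finset.sum_sub_distrib]
    refine Finset.sum_congr rfl fun i _ => Finset.sum_congr rfl fun j _ => by ring
  -- Each cell meets four edges, each with weight one quarter, so `G` is counted exactly once.
  have hr : ∑ i, ∑ j, (1 / δ * Dx h (a - b) i j ^ 2 + (G i j + G (i + 1) j) / 4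
        + Dx h (a - b) i j ^ 2 / 2
        + (1 / δ * Dy h (a - b) i j ^ 2 + (G i j + G i (j + 1)) / 4 + Dy h (a - b) i j ^ 2 / 2))
      = 1 / δ * (∑ i, ∑ j, (Dx h (a - b) i j ^ 2 + Dy h (a - b) i j ^ 2))
        + 4 * (∑ i, ∑ j, (r i j - s i j) ^ 2)
        + (4 / δ ^ 2 + 1 / 2) * ∑ i, ∑ j, (Dx h (a - b) i j ^ 2 + Dy h (a - b) i j ^ 2) := by
    have h1 := sum_shift_x' G
    have h2 := sum_shift_y' G
    have e : 1 / δ * (∑ i, ∑ j, (Dx h (a - b) i j ^ 2 + Dy h (a - b) i j ^ 2))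
        + 4 * (∑ i, ∑ j, (r i j - s i j) ^ 2)
        + (4 / δ ^ 2 + 1 / 2) * ∑ i, ∑ j, (Dx h (a - b) i j ^ 2 + Dy h (a - b) i j ^ 2)
        = 1 / δ * (∑ i, ∑ j, (Dx h (a - b) i j ^ 2 + Dy h (a - b) i j ^ 2))
        + ∑ i, ∑ j, G i j
        + 1 / 2 * ∑ i, ∑ j, (Dx h (a - b) i j ^ 2 + Dy h (a - b) i j ^ 2) := by
      rw [hGsum]
      ring
    rw [e]
    simp only [Finset.sum_add_distrib, ← Finset.sum_div, ← Finset.mul_sum, h1, h2]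
    ring
  rw [hl, hr] at hsum
  have := mul_le_mul_of_nonneg_left hsum (sq_nonneg h)
  simp only [Pi.sub_apply]
  linarith

theorem inner2_cube_nonneg (a b : Grid N) (c : ℝ) :
    0 ≤ inner2 h (fun i j => (a i j - c) ^ 3 - (b i j - c) ^ 3) (a - b) := by
  refine mul_nonneg (sq_nonneg h) (Finset.sum_nonneg fun i _ => Finset.sum_nonneg fun j _ => ?_)
  simp only [Pi.sub_apply]
  have e : ((a i j - c) ^ 3 - (b i j - c) ^ 3) * (a i j - b i j)
      = (a i j - b i j) ^ 2 * (((a i j - c) + (b i j - c)) ^ 2 + (a i j - c) ^ 2 + (b i j - c) ^ 2) / 2 := by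
    ring
  rw [e]
  positivity

theorem dEntropy_mono {a b : ℝ} (ha : 0 < a) (hb : b < 1) (hab : a ≤ b) : dEntropy a ≤ dEntropy b := by
  have h1 := Real.log_le_log ha hab
  have h2 : Real.log (1 - b) ≤ Real.log (1 - a) := Real.log_le_log (by linarith) (by linarith)
  simp only [dEntropy]
  linarith

theorem inner2_dEntropy_nonneg {r s : Grid N} (hr : ∀ i j, 0 < r i j ∧ r i j < 1)
    (hs : ∀ i j, 0 < s i j ∧ s i j < 1) :
    0 ≤ inner2 h (fun i j => dEntropy (r i j) - dEntropy (s i j)) (r - s) := by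
  refine mul_nonneg (sq_nonneg h) (Finset.sum_nonneg fun i _ => Finset.sum_nonneg fun j _ => ?_)
  simp only [Pi.sub_apply]
  rcases le_total (r i j) (s i j) with hle | hle
  · exact mul_nonneg_of_nonpos_of_nonpos
      (sub_nonpos.2 (dEntropy_mono (hr i j).1 (hs i j).2 hle)) (sub_nonpos.2 hle)
  · exact mul_nonneg (sub_nonneg.2 (dEntropy_mono (hs i j).1 (hr i j).2 hle)) (sub_nonneg.2 hle)

end Nonlinear

/-! ## Stability of the scheme -/

section Stability

variable {N : ℕ} [NeZero N] {h : ℝ}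

/-- The dissipation `η²‖Δ_h e‖² + ε‖∇_h e‖² + ξ‖∇_h g‖²`. -/
def dissip (P : Params) (h : ℝ) (e g : Grid N) : ℝ :=
  P.η ^ 2 * normSq h (lapH h e) + P.ε * gradSq h e + P.ξ * gradSq h g

theorem dissip_nonneg (P : Params) (e g : Grid N) : 0 ≤ dissip P h e g := by
  have := P.ε_pos
  have := P.ξ_pos
  have := normSq_nonneg (h := h) (lapH h e)
  have := gradSq_nonneg (h := h) e
  have := gradSq_nonneg (h := h) g
  unfold dissip
  positivity

/-- The left potential is fully implicit and the right one is split in time, so the lag of the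
splitting appears as `U₁ - U₀`. Its Laplacian is moved onto the error, at the price of a quarter of
the `η²` dissipation; thus only the `ℓ²` norm of the increment is needed. -/
theorem inner2_muPhiH_sub_ge (P : Params) {U₀ U₁ R₁ f₀ f₁ s₁ : Grid N}
    (hs : ∀ i j, 0 < s₁ i j ∧ s₁ i j < 1) :
    P.ε * gradSq h (U₁ - f₁) + 3 / 4 * (P.η ^ 2 * normSq h (lapH h (U₁ - f₁)))
        - ((4 * P.α / P.δ ^ 2 + P.α / 2 + P.α / P.δ) * gradSq h (U₁ - f₁) + 4 * P.α * normSq h (R₁ - s₁)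
          + 1 / P.ε * normSq h (U₁ - f₁) + P.α / P.δ * gradSq h (U₀ - f₀)
          + 1 / P.ε * normSq h (U₀ - f₀) + (1 / P.ε + (P.α / (P.δ * P.η)) ^ 2) * normSq h (U₁ - U₀))
      ≤ inner2 h (muPhiH P h U₁ U₁ R₁ - muPhiH P h f₀ f₁ s₁) (U₁ - f₁) := by
  obtain ⟨α, β, ε, η, ξ, δ, M, hα, hβ, hε, hη, hξ, hδ, hM⟩ := P
  dsimp only
  set e := U₁ - f₁ with he
  set e₀ := U₀ - f₀ with he₀
  set D := U₁ - U₀ with hD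
  -- In the explicit terms `U₁ - f₀` is split into the time increment `D` and the old error `e₀`.
  have hdec : muPhiH ⟨α, β, ε, η, ξ, δ, M, hα, hβ, hε, hη, hξ, hδ, hM⟩ h U₁ U₁ R₁
        - muPhiH ⟨α, β, ε, η, ξ, δ, M, hα, hβ, hε, hη, hξ, hδ, hM⟩ h f₀ f₁ s₁
      = (1 / ε) • (fun i j => (U₁ i j - 1 / 2) ^ 3 - (f₁ i j - 1 / 2) ^ 3 : Grid N)
        + (-(ε + α + α / δ)) • lapH h e + (η ^ 2) • lapH h (lapH h e)
        + α • (divNonlin h δ U₁ R₁ - divNonlin h δ f₁ s₁)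
        + (-(1 / (4 * ε))) • (D + e₀) + (α / δ) • (lapH h D + lapH h e₀) := by
    simp only [he, he₀, hD, lapH_sub]
    funext i j
    simp only [muPhiH, Pi.add_apply, Pi.sub_apply, Pi.smul_apply, smul_eq_mul]
    ring
  rw [hdec]
  simp only [inner2_add_left, inner2_smul_left]
  rw [inner2_lapH e e, inner2_lapH_comm (lapH h e) e, inner2_lapH_comm D e, inner2_lapH e₀ e,
    ← gradSq_eq]
  have h1 := inner2_cube_nonneg (h := h) U₁ f₁ (1 / 2)
  have h2 := inner2_divNonlin_sub_ge (h := h) hδ U₁ f₁ R₁ s₁ (fun i j => ⟨(hs i j).1.le, (hs i j).2.le⟩)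
  rw [← he] at h1 h2
  have h3 := abs_le.1 (abs_inner2_le_young (h := h) one_pos D e)
  have h4 := abs_le.1 (abs_inner2_le_young (h := h) one_pos e₀ e)
  -- This weight makes the coefficient of `normSq h (lapH h e)` equal to `η² / 4` after
  -- multiplication by `α / δ`.
  have hθ : 0 < 2 * α / (δ * η ^ 2) := by positivity
  have h5 := abs_le.1 (abs_inner2_le_young (h := h) hθ D (lapH h e))
  have h6 := gradIn_le_young (h := h) one_pos e₀ e
  have n1 := normSq_nonneg (h := h) D
  have n2 := normSq_nonneg (h := h) e
  have n3 := normSq_nonneg (h := h) e₀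
  have n4 := gradSq_nonneg (h := h) e
  have n5 := gradSq_nonneg (h := h) e₀
  have n6 := normSq_nonneg (h := h) (R₁ - s₁)
  have h1' := mul_nonneg (show 0 ≤ 1 / ε by positivity) h1
  have h2' := mul_le_mul_of_nonneg_left h2 hα.le
  have hαδ : 0 ≤ α / δ := by positivity
  have h5' := mul_le_mul_of_nonneg_left h5.1 hαδ
  have h6' := mul_le_mul_of_nonneg_left h6 hαδ
  have e5 : α / δ * -(2 * α / (δ * η ^ 2) / 2 * normSq h D
      + 1 / (2 * (2 * α / (δ * η ^ 2))) * normSq h (lapH h e))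
      = -((α / (δ * η)) ^ 2 * normSq h D + 1 / 4 * (η ^ 2 * normSq h (lapH h e))) := by
    field_simp
    ring
  rw [e5] at h5'
  have hε4 : 0 ≤ 1 / (4 * ε) := by positivity
  have h3' := mul_le_mul_of_nonneg_left h3.2 hε4
  have h4' := mul_le_mul_of_nonneg_left h4.2 hε4
  have e3 : 1 / (4 * ε) = 1 / ε / 4 := by field_simp
  have hε1 : 0 ≤ 1 / ε := by positivity
  have m1 := mul_nonneg hε1 n1
  have m2 := mul_nonneg hε1 n2
  have m3 := mul_nonneg hε1 n3
  have m4 := mul_nonneg hα.le n4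
  have m5 := mul_nonneg hαδ n5
  have m6 := mul_nonneg hαδ n4
  have hn : inner2 h (lapH h e) (lapH h e) = normSq h (lapH h e) := rfl
  rw [hn]
  have e7 : α * (1 / δ * gradSq h e + 4 * normSq h (R₁ - s₁) + (4 / δ ^ 2 + 1 / 2) * gradSq h e)
      = α / δ * gradSq h e + 4 * α * normSq h (R₁ - s₁) + (4 * α / δ ^ 2 + α / 2) * gradSq h e := by
    ring
  rw [mul_neg, e7] at h2'
  rw [e3] at *
  norm_num at h3' h4' h6'
  ring_nf at h1' h2' h3' h4' h5' h6' m1 m2 m3 m4 m5 m6 ⊢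
  linarith

/-- The entropy is monotone and the term with `√2 α` has the good sign. The regularised modulus is
1-Lipschitz in the gradient, which gives the only coupling to the error in `φ`. -/
theorem inner2_muRhoH_sub_ge (P : Params) {R₀ U₁ R₁ s₀ f₁ s₁ : Grid N}
    (hR : ∀ i j, 0 < R₁ i j ∧ R₁ i j < 1) (hs : ∀ i j, 0 < s₁ i j ∧ s₁ i j < 1) :
    P.ξ * gradSq h (R₁ - s₁)
        - (P.α * gradSq h (U₁ - f₁) + 2 * P.α * normSq h (R₁ - s₁) + P.α * normSq h (R₀ - s₀)
          + P.α * normSq h (R₁ - R₀))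
      ≤ inner2 h (muRhoH P h R₁ U₁ R₁ - muRhoH P h s₀ f₁ s₁) (R₁ - s₁) := by
  set g := R₁ - s₁ with hg
  set g₀ := R₀ - s₀ with hg₀
  set D := R₁ - R₀ with hD
  set r := Real.sqrt 2 with hr
  have hdec : muRhoH P h R₁ U₁ R₁ - muRhoH P h s₀ f₁ s₁
      = (-P.ξ) • lapH h g + P.β • (fun i j => dEntropy (R₁ i j) - dEntropy (s₁ i j) : Grid N)
        + (r * P.α) • g + (-P.α) • (modGradH h P.δ U₁ - modGradH h P.δ f₁)
        + (-(P.α * (r - 1))) • (D + g₀) := by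
    simp only [hg, hg₀, hD, lapH_sub]
    funext i j
    simp only [muRhoH, Pi.add_apply, Pi.sub_apply, Pi.smul_apply, smul_eq_mul]
    ring
  rw [hdec]
  simp only [inner2_add_left, inner2_smul_left]
  rw [inner2_lapH, ← gradSq_eq]
  have h1 := mul_nonneg P.β_pos.le (inner2_dEntropy_nonneg (h := h) hR hs)
  have h2 := inner2_le_young (h := h) one_pos (modGradH h P.δ U₁ - modGradH h P.δ f₁) g
  have h3 := normSq_modGradH_sub_le (h := h) (δ := P.δ) U₁ f₁
  have h4 := inner2_le_young (h := h) one_pos D g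
  have h5 := inner2_le_young (h := h) one_pos g₀ g
  have hr1 : 1 ≤ r := Real.one_le_sqrt.2 one_le_two
  have hr2 : r ≤ 2 := by rw [hr, Real.sqrt_le_left (by norm_num)]; norm_num
  have n1 := normSq_nonneg (h := h) D
  have n2 := normSq_nonneg (h := h) g
  have n3 := normSq_nonneg (h := h) g₀
  have n4 := gradSq_nonneg (h := h) (U₁ - f₁)
  have hα := P.α_pos
  have hg2 : inner2 h g g = normSq h g := rfl
  rw [hg2, ← hg] at *
  norm_num at h2 h4 h5
  have k1 : inner2 h (modGradH h P.δ U₁ - modGradH h P.δ f₁) g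
      ≤ gradSq h (U₁ - f₁) + normSq h g := by linarith
  have k2 : inner2 h D g + inner2 h g₀ g ≤ normSq h D + normSq h g₀ + normSq h g := by linarith
  have k3 := mul_le_mul_of_nonneg_left k1 hα.le
  have hαr : 0 ≤ P.α * (r - 1) := mul_nonneg hα.le (by linarith)
  have k4 := mul_le_mul_of_nonneg_left k2 hαr
  have k5 : P.α * (r - 1) * (normSq h D + normSq h g₀ + normSq h g)
      ≤ P.α * (normSq h D + normSq h g₀ + normSq h g) :=
    mul_le_mul_of_nonneg_right (by nlinarith) (by linarith)
  have k6 : 0 ≤ r * P.α * normSq h g := by positivity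
  linarith

/-- Absorption: lower-order terms are dominated by the dissipation and the `H^{-1}` norms. -/
theorem lower_order_le (P : Params) {K : ℝ} (hK : 0 ≤ K) : ∃ C : ℝ, 0 ≤ C ∧
    ∀ (N : ℕ) [NeZero N] (h : ℝ), h ≠ 0 → ∀ e g : Grid N, mean e = 0 → mean g = 0 →
      K * (gradSq h e + normSq h e + normSq h g)
        ≤ 1 / 8 * dissip P h e g + C * (negSq h e + negSq h g) := by
  -- `2 (K + 1) θ = η² / 8` and `(K + 1) κ = ξ / 8` produce the stated fraction of the dissipation;
  -- `K + 1` replaces `K` to allow `K = 0`.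
  obtain ⟨θ, hθ⟩ : ∃ θ : ℝ, θ = P.η ^ 2 / (16 * (K + 1)) := ⟨_, rfl⟩
  obtain ⟨κ, hκ⟩ : ∃ κ : ℝ, κ = P.ξ / (8 * (K + 1)) := ⟨_, rfl⟩
  have hη := P.η_pos
  have hξ := P.ξ_pos
  have hθ0 : 0 < θ := by rw [hθ]; positivity
  have hκ0 : 0 < κ := by rw [hκ]; positivity
  refine ⟨(K + 1) * (2 / θ ^ 2 + 1 + 1 / κ), by positivity, fun N _ h hh e g he hg => ?_⟩
  have h1 := gradSq_le_negSq hh he hθ0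
  have h2 := normSq_le_negSq hh he one_pos
  have h3 := normSq_le_negSq hh hg hκ0
  have n1 := negSq_nonneg (h := h) e
  have n2 := negSq_nonneg (h := h) g
  have n3 := normSq_nonneg (h := h) (lapH h e)
  have n4 := gradSq_nonneg (h := h) e
  have n5 := gradSq_nonneg (h := h) g
  have n6 := normSq_nonneg (h := h) e
  have n7 := normSq_nonneg (h := h) g
  have h4 : gradSq h e + normSq h e + normSq h g ≤ 2 * θ * normSq h (lapH h e) + κ * gradSq h g
      + (2 / θ ^ 2 + 1 + 1 / κ) * (negSq h e + negSq h g) := by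
    have a1 : 0 ≤ 1 / κ * negSq h e := by positivity
    have a2 : 0 ≤ (2 / θ ^ 2 + 1) * negSq h g := by positivity
    have a4 : (2 / θ ^ 2 + 1 + 1 / κ) * (negSq h e + negSq h g) = 2 * (1 / θ ^ 2 * negSq h e)
        + negSq h e + 1 / κ * negSq h g + 1 / κ * negSq h e + (2 / θ ^ 2 + 1) * negSq h g := by
      ring
    rw [a4, one_mul, div_one, one_mul] at *
    clear hθ hκ
    generalize 1 / θ ^ 2 * negSq h e = z1 at *
    generalize 1 / κ * negSq h e = z2 at *
    generalize 1 / κ * negSq h g = z3 at *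
    generalize (2 / θ ^ 2 + 1) * negSq h g = z4 at *
    generalize κ * gradSq h g = z5 at *
    rw [mul_assoc]
    generalize θ * normSq h (lapH h e) = z6 at *
    linarith
  have h5 : K * (gradSq h e + normSq h e + normSq h g)
      ≤ (K + 1) * (gradSq h e + normSq h e + normSq h g) :=
    mul_le_mul_of_nonneg_right (by linarith) (by linarith)
  have h6 := mul_le_mul_of_nonneg_left h4 (show 0 ≤ K + 1 by linarith)
  have h7 : (K + 1) * (2 * θ * normSq h (lapH h e) + κ * gradSq h g
      + (2 / θ ^ 2 + 1 + 1 / κ) * (negSq h e + negSq h g))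
      = 1 / 8 * (P.η ^ 2 * normSq h (lapH h e) + P.ξ * gradSq h g)
        + (K + 1) * (2 / θ ^ 2 + 1 + 1 / κ) * (negSq h e + negSq h g) := by
    have b1 : (K + 1) * θ = P.η ^ 2 / 16 := by rw [hθ]; field_simp
    have b2 : (K + 1) * κ = P.ξ / 8 := by rw [hκ]; field_simp
    linear_combination 2 * normSq h (lapH h e) * b1 + gradSq h g * b2
  have h8 : 0 ≤ P.ε * gradSq h e := mul_nonneg P.ε_pos.le n4
  unfold dissip
  linarith

/-- Test the error equation with `(-Δ_h)⁻¹ e₁`: self-adjointness turns `Δ_h w` into `-w` tested with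
`e₁`, and the residual is controlled by Poincaré for the test function. -/
theorem negSq_sub_le_of_step (hh : h ≠ 0) (hN : 0 < h * N) {dt M : ℝ} (hdt : 0 < dt)
    {e₀ e₁ w τ : Grid N} (he : mean e₁ = 0)
    (hstep : ∀ i j, (e₁ i j - e₀ i j) / dt = M * lapH h w i j + τ i j) :
    negSq h e₁ - negSq h e₀
      ≤ 2 * dt * (-(M * inner2 h w e₁)) + dt * ((h * N) ^ 2 * normSq h τ + negSq h e₁) := by
  have h0 := invLap_spec hh e₁
  have h1 := negSq_sub_le hh e₁ e₀
  have h2 : e₁ - e₀ = dt • (M • lapH h w + τ) := by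
    funext i j
    have := hstep i j
    rw [div_eq_iff hdt.ne'] at this
    simp only [Pi.sub_apply, Pi.smul_apply, Pi.add_apply, smul_eq_mul, this]
    ring
  have h3 : lapH h (invLap h e₁) = -e₁ := by
    funext i j
    have := h0.2 i j
    rw [he] at this
    simp only [Pi.neg_apply]
    linarith
  have h4 := inner2_le_young (h := h) (θ := (h * N) ^ 2) (by positivity) τ (invLap h e₁)
  have h5 := normSq_le_gradSq hh h0.1
  have h6 : 1 / (2 * (h * N) ^ 2) * normSq h (invLap h e₁)
      ≤ 1 / (2 * (h * N) ^ 2) * ((h * N) ^ 2 * negSq h e₁) :=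
    mul_le_mul_of_nonneg_left h5 (by positivity)
  have h7 : 1 / (2 * (h * N) ^ 2) * ((h * N) ^ 2 * negSq h e₁) = negSq h e₁ / 2 := by
    have := hN.ne'
    generalize h * (N : ℝ) = H at *
    field_simp
  rw [h2, inner2_smul_left, inner2_add_left, inner2_smul_left, inner2_lapH_comm, h3,
    inner2_comm w, neg_inner2, inner2_comm e₁] at h1
  have h8 : inner2 h τ (invLap h e₁) ≤ (h * N) ^ 2 * normSq h τ / 2 + negSq h e₁ / 2 := by linarith
  have h9 := mul_le_mul_of_nonneg_left h8 hdt.le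
  linarith

/-- The energy inequality for one time step. The reference pair `(U, R)` solves the scheme up to
the residuals `τ`, `σ`. -/
theorem step_energy (P : Params) {L : ℝ} (hL : 0 < L) : ∃ C₀ C₁ : ℝ, 0 < C₀ ∧ 0 < C₁ ∧
    ∀ (N : ℕ) [NeZero N] (h dt : ℝ), h * N = L → 0 < dt →
    ∀ (U₀ U₁ R₀ R₁ f₀ f₁ s₀ s₁ τ σ : Grid N),
      (∀ i j, 0 < R₁ i j ∧ R₁ i j < 1) → (∀ i j, 0 < s₁ i j ∧ s₁ i j < 1) →
      mean U₀ = mean f₀ → mean U₁ = mean f₁ → mean R₀ = mean s₀ → mean R₁ = mean s₁ →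
      (∀ i j, (U₁ i j - U₀ i j) / dt = P.M * lapH h (muPhiH P h U₁ U₁ R₁) i j + τ i j) →
      (∀ i j, (R₁ i j - R₀ i j) / dt = P.M * lapH h (muRhoH P h R₁ U₁ R₁) i j + σ i j) →
      (∀ i j, (f₁ i j - f₀ i j) / dt = P.M * lapH h (muPhiH P h f₀ f₁ s₁) i j) →
      (∀ i j, (s₁ i j - s₀ i j) / dt = P.M * lapH h (muRhoH P h s₀ f₁ s₁) i j) →
      negSq h (U₁ - f₁) + negSq h (R₁ - s₁) + P.M * dt * dissip P h (U₁ - f₁) (R₁ - s₁)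
        ≤ negSq h (U₀ - f₀) + negSq h (R₀ - s₀)
          + C₀ * dt * (negSq h (U₁ - f₁) + negSq h (R₁ - s₁) + (negSq h (U₀ - f₀) + negSq h (R₀ - s₀)))
          + 1 / 2 * (P.M * dt * dissip P h (U₀ - f₀) (R₀ - s₀))
          + C₁ * dt * (normSq h τ + normSq h σ + normSq h (U₁ - U₀) + normSq h (R₁ - R₀)) := by
  have hα := P.α_pos
  have hε := P.ε_pos
  have hδ := P.δ_pos
  have hη := P.η_pos
  have hM := P.M_pos
  -- `K` dominates every coefficient of a lower-order error term in the two potential estimates, and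
  -- `Q` those of the time increments.
  set K : ℝ := 4 * P.α / P.δ ^ 2 + 6 * P.α + P.α / P.δ + 1 / P.ε with hK
  have hK0 : 0 ≤ K := by positivity
  set Q : ℝ := 1 / P.ε + (P.α / (P.δ * P.η)) ^ 2 + P.α with hQ
  have hQ0 : 0 ≤ Q := by positivity
  obtain ⟨C, hC, hlow⟩ := lower_order_le P hK0
  refine ⟨2 * P.M * C + 1, 2 * P.M * Q + L ^ 2, by positivity, by positivity, ?_⟩
  intro N _ h dt hhN hdt U₀ U₁ R₀ R₁ f₀ f₁ s₀ s₁ τ σ hR hs mU₀ mU₁ mR₀ mR₁ eU eR ef es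
  have hh : h ≠ 0 := by
    rintro rfl
    rw [zero_mul] at hhN
    exact hL.ne hhN
  have hN : 0 < h * N := hhN ▸ hL
  have me₀ : mean (U₀ - f₀) = 0 := by rw [mean_sub, mU₀, sub_self]
  have me₁ : mean (U₁ - f₁) = 0 := by rw [mean_sub, mU₁, sub_self]
  have mg₀ : mean (R₀ - s₀) = 0 := by rw [mean_sub, mR₀, sub_self]
  have mg₁ : mean (R₁ - s₁) = 0 := by rw [mean_sub, mR₁, sub_self]
  have a1 := negSq_sub_le_of_step hh hN (M := P.M) hdt (e₀ := U₀ - f₀) (τ := τ)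
    (w := muPhiH P h U₁ U₁ R₁ - muPhiH P h f₀ f₁ s₁) me₁ (fun i j => by
      rw [lapH_sub]
      simp only [Pi.sub_apply]
      have := eU i j
      have := ef i j
      have e : (U₁ i j - f₁ i j - (U₀ i j - f₀ i j)) / dt
        = (U₁ i j - U₀ i j) / dt - (f₁ i j - f₀ i j) / dt := by ring
      rw [e]
      linarith)
  have a2 := negSq_sub_le_of_step hh hN (M := P.M) hdt (e₀ := R₀ - s₀) (τ := σ)
    (w := muRhoH P h R₁ U₁ R₁ - muRhoH P h s₀ f₁ s₁) mg₁ (fun i j => by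
      rw [lapH_sub]
      simp only [Pi.sub_apply]
      have := eR i j
      have := es i j
      have e : (R₁ i j - s₁ i j - (R₀ i j - s₀ i j)) / dt
        = (R₁ i j - R₀ i j) / dt - (s₁ i j - s₀ i j) / dt := by ring
      rw [e]
      linarith)
  have b1 := inner2_muPhiH_sub_ge (h := h) P (U₀ := U₀) (U₁ := U₁) (R₁ := R₁) (f₀ := f₀) (f₁ := f₁) hs
  have b2 := inner2_muRhoH_sub_ge (h := h) P (R₀ := R₀) (s₀ := s₀) (U₁ := U₁) (f₁ := f₁) hR hs
  have c1 := hlow N h hh _ _ me₁ mg₁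
  have c0 := hlow N h hh _ _ me₀ mg₀
  rw [hhN] at a1 a2
  have n1 := gradSq_nonneg (h := h) (U₁ - f₁)
  have n2 := normSq_nonneg (h := h) (U₁ - f₁)
  have n3 := normSq_nonneg (h := h) (R₁ - s₁)
  have n4 := gradSq_nonneg (h := h) (U₀ - f₀)
  have n5 := normSq_nonneg (h := h) (U₀ - f₀)
  have n6 := normSq_nonneg (h := h) (R₀ - s₀)
  have n7 := normSq_nonneg (h := h) (U₁ - U₀)
  have n8 := normSq_nonneg (h := h) (R₁ - R₀)
  have n9 := normSq_nonneg (h := h) τ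
  have n10 := normSq_nonneg (h := h) σ
  have n11 := negSq_nonneg (h := h) (U₀ - f₀)
  have n12 := negSq_nonneg (h := h) (R₀ - s₀)
  have n13 := negSq_nonneg (h := h) (U₁ - f₁)
  have n14 := negSq_nonneg (h := h) (R₁ - s₁)
  have nl := mul_nonneg (sq_nonneg P.η) (normSq_nonneg (h := h) (lapH h (U₁ - f₁)))
  have nd : 3 / 4 * dissip P h (U₁ - f₁) (R₁ - s₁) ≤ P.ε * gradSq h (U₁ - f₁)
      + 3 / 4 * (P.η ^ 2 * normSq h (lapH h (U₁ - f₁))) + P.ξ * gradSq h (R₁ - s₁) := by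
    have := mul_nonneg hε.le n1
    have := mul_nonneg P.ξ_pos.le (gradSq_nonneg (h := h) (R₁ - s₁))
    unfold dissip
    linarith
  set D₁ := dissip P h (U₁ - f₁) (R₁ - s₁)
  set D₀ := dissip P h (U₀ - f₀) (R₀ - s₀)
  have q1 : 0 ≤ 4 * P.α / P.δ ^ 2 := by positivity
  have q2 : 0 ≤ P.α / P.δ := by positivity
  have q3 : 0 ≤ 1 / P.ε := by positivity
  have q4 : 0 ≤ (P.α / (P.δ * P.η)) ^ 2 := by positivity
  have key : 3 / 4 * D₁ - (K * (gradSq h (U₁ - f₁) + normSq h (U₁ - f₁) + normSq h (R₁ - s₁))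
        + K * (gradSq h (U₀ - f₀) + normSq h (U₀ - f₀) + normSq h (R₀ - s₀))
        + Q * (normSq h (U₁ - U₀) + normSq h (R₁ - R₀)))
      ≤ inner2 h (muPhiH P h U₁ U₁ R₁ - muPhiH P h f₀ f₁ s₁) (U₁ - f₁)
        + inner2 h (muRhoH P h R₁ U₁ R₁ - muRhoH P h s₀ f₁ s₁) (R₁ - s₁) := by
    have r1 : (4 * P.α / P.δ ^ 2 + P.α / 2 + P.α / P.δ + P.α) * gradSq h (U₁ - f₁)
        ≤ K * gradSq h (U₁ - f₁) := mul_le_mul_of_nonneg_right (by linarith) n1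
    have r2 : 1 / P.ε * normSq h (U₁ - f₁) ≤ K * normSq h (U₁ - f₁) :=
      mul_le_mul_of_nonneg_right (by linarith) n2
    have r3 : 6 * P.α * normSq h (R₁ - s₁) ≤ K * normSq h (R₁ - s₁) :=
      mul_le_mul_of_nonneg_right (by linarith) n3
    have r4 : P.α / P.δ * gradSq h (U₀ - f₀) ≤ K * gradSq h (U₀ - f₀) :=
      mul_le_mul_of_nonneg_right (by linarith) n4
    have r5 : 1 / P.ε * normSq h (U₀ - f₀) ≤ K * normSq h (U₀ - f₀) :=
      mul_le_mul_of_nonneg_right (by linarith) n5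
    have r6 : P.α * normSq h (R₀ - s₀) ≤ K * normSq h (R₀ - s₀) :=
      mul_le_mul_of_nonneg_right (by linarith) n6
    have r7 : (1 / P.ε + (P.α / (P.δ * P.η)) ^ 2) * normSq h (U₁ - U₀) ≤ Q * normSq h (U₁ - U₀) :=
      mul_le_mul_of_nonneg_right (by linarith) n7
    have r8 : P.α * normSq h (R₁ - R₀) ≤ Q * normSq h (R₁ - R₀) :=
      mul_le_mul_of_nonneg_right (by linarith) n8
    linarith
  set I₁ := inner2 h (muPhiH P h U₁ U₁ R₁ - muPhiH P h f₀ f₁ s₁) (U₁ - f₁)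
  set I₂ := inner2 h (muRhoH P h R₁ U₁ R₁ - muRhoH P h s₀ f₁ s₁) (R₁ - s₁)
  -- Of `3/4` of the new dissipation one eighth absorbs the new lower-order terms; the old ones cost
  -- one eighth of `D₀`. After the factor `2 M dt` the coefficients are `5/4` and `1/4`, better than
  -- claimed.
  have key2 : 5 / 8 * D₁ - 1 / 8 * D₀ - C * (negSq h (U₁ - f₁) + negSq h (R₁ - s₁))
      - C * (negSq h (U₀ - f₀) + negSq h (R₀ - s₀)) - Q * (normSq h (U₁ - U₀) + normSq h (R₁ - R₀))
      ≤ I₁ + I₂ := by linarith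
  have key3 := mul_le_mul_of_nonneg_left key2 (show 0 ≤ 2 * dt * P.M by positivity)
  have d1 : 0 ≤ dt * P.M * D₁ := mul_nonneg (by positivity) (dissip_nonneg P _ _)
  have d0 : 0 ≤ dt * P.M * D₀ := mul_nonneg (by positivity) (dissip_nonneg P _ _)
  have z1 : 0 ≤ dt * (negSq h (U₀ - f₀) + negSq h (R₀ - s₀)) := mul_nonneg hdt.le (by linarith)
  have z2 : 0 ≤ L ^ 2 * dt * (normSq h (U₁ - U₀) + normSq h (R₁ - R₀)) :=
    mul_nonneg (by positivity) (by linarith)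
  have z3 : 0 ≤ 2 * P.M * Q * dt * (normSq h τ + normSq h σ) := mul_nonneg (by positivity) (by linarith)
  linarith

/-- The old dissipation on the right of the step inequality carries the factor `1/2`: half of each
new dissipation is kept to pay for the next step, the other half is accumulated in the sum. -/
theorem discrete_gronwall {C₀ κ dt : ℝ} (hC₀ : 0 ≤ C₀) (hdt : 0 ≤ dt) (hsmall : C₀ * dt ≤ 1 / 2)
    {X D r : ℕ → ℝ} (hX : ∀ n, 0 ≤ X n) (hD : ∀ n, 0 ≤ D n) (hr : ∀ n, 0 ≤ r n) (hκ : 0 ≤ κ) {n : ℕ}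
    (hstep : ∀ k < n, X (k + 1) + κ * D (k + 1)
      ≤ X k + C₀ * dt * (X (k + 1) + X k) + 1 / 2 * (κ * D k) + r k) :
    X n + κ * ∑ k ∈ Finset.range (n + 1), D k
      ≤ 2 * (Real.exp (4 * C₀ * (n * dt)) * (X 0 + κ * D 0 + ∑ k ∈ Finset.range n, r k)) := by
  have hc : 0 ≤ C₀ * dt := mul_nonneg hC₀ hdt
  have main : ∀ m ≤ n, (1 - C₀ * dt) * X m + κ * D m / 2 + κ / 2 * ∑ k ∈ Finset.range (m + 1), D k
      ≤ (1 + 4 * (C₀ * dt)) ^ m * (X 0 + κ * D 0 + ∑ k ∈ Finset.range m, r k) := by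
    intro m
    induction m with
    | zero =>
      intro _
      simp only [zero_add, Finset.range_one, Finset.sum_singleton, Finset.range_zero,
        Finset.sum_empty, add_zero, pow_zero, one_mul]
      nlinarith [hX 0]
    | succ m ih =>
      intro hm
      have h1 := ih (by omega)
      have h2 := hstep m (by omega)
      rw [Finset.sum_range_succ _ (m + 1), Finset.sum_range_succ r m]
      set S := ∑ k ∈ Finset.range (m + 1), D k
      set Rr := ∑ k ∈ Finset.range m, r k
      have hS : 0 ≤ S := Finset.sum_nonneg fun k _ => hD k
      have hRr : 0 ≤ Rr := Finset.sum_nonneg fun k _ => hr k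
      set A := (1 - C₀ * dt) * X m + κ * D m / 2 + κ / 2 * S with hA
      have hp : 1 ≤ (1 + 4 * (C₀ * dt)) ^ (m + 1) := one_le_pow₀ (by linarith)
      have e1 : (1 + C₀ * dt) * X m ≤ (1 + 4 * (C₀ * dt)) * ((1 - C₀ * dt) * X m) := by
        -- This holds precisely because `C₀ dt ≤ 1/2`; it is the origin of the `4` in the exponent.
        have : (1 + C₀ * dt) ≤ (1 + 4 * (C₀ * dt)) * (1 - C₀ * dt) := by nlinarith
        nlinarith [mul_le_mul_of_nonneg_right this (hX m)]
      have e2 : κ * D m / 2 + κ / 2 * S ≤ (1 + 4 * (C₀ * dt)) * (κ * D m / 2 + κ / 2 * S) := by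
        have : 0 ≤ κ * D m / 2 + κ / 2 * S := by have := hD m; positivity
        nlinarith
      have e3 : (1 + C₀ * dt) * X m + κ * D m / 2 + κ / 2 * S ≤ (1 + 4 * (C₀ * dt)) * A := by
        rw [hA]
        linarith
      have e4 : (1 + 4 * (C₀ * dt)) * A ≤ (1 + 4 * (C₀ * dt)) ^ (m + 1) * (X 0 + κ * D 0 + Rr) := by
        rw [pow_succ', mul_assoc]
        exact mul_le_mul_of_nonneg_left h1 (by linarith)
      have e5 : r m ≤ (1 + 4 * (C₀ * dt)) ^ (m + 1) * r m := le_mul_of_one_le_left (hr m) hp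
      linarith
  have h1 := main n le_rfl
  have h2 : (1 + 4 * (C₀ * dt)) ^ n ≤ Real.exp (4 * C₀ * (n * dt)) := by
    have := Real.add_one_le_exp (4 * (C₀ * dt))
    calc _ ≤ Real.exp (4 * (C₀ * dt)) ^ n := pow_le_pow_left₀ (by linarith) (by linarith) n
      _ = _ := by rw [← Real.exp_nat_mul]; congr 1; ring
  have h0 : 0 ≤ X 0 + κ * D 0 + ∑ k ∈ Finset.range n, r k := by
    have := hX 0
    have := mul_nonneg hκ (hD 0)
    have := Finset.sum_nonneg fun k (_ : k ∈ Finset.range n) => hr k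
    linarith
  have h3 := mul_le_mul_of_nonneg_right h2 h0
  have h4 := mul_nonneg hκ (hD n)
  have h5 : 1 / 2 * X n ≤ (1 - C₀ * dt) * X n := mul_le_mul_of_nonneg_right (by linarith) (hX n)
  linarith

end Stability

/-! ## Uniformly smooth families of functions of `(h, x, y)` -/

section UniformSmooth

variable {ι : Type*}

/-- `u i`, `i : ι`, are `C^k` functions of `(h, x, y)` whose derivatives of order at most `k` are
bounded uniformly in `i`. -/
def UnifC : ℕ → (ι → ℝ × ℝ × ℝ → ℝ) → Prop
  | 0, u => (∀ i, Continuous (u i)) ∧ ∃ B : ℝ, ∀ i p, |u i p| ≤ B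
  | k + 1, u => (∀ i, ContDiff ℝ 1 (u i)) ∧ (∃ B : ℝ, ∀ i p, |u i p| ≤ B) ∧
      ∀ v, UnifC k fun i p => fderiv ℝ (u i) p v

namespace UnifC

variable {k : ℕ} {u w : ι → ℝ × ℝ × ℝ → ℝ}

theorem continuous (hu : UnifC k u) (i : ι) : Continuous (u i) := by
  cases k with
  | zero => exact hu.1 i
  | succ k => exact (hu.1 i).continuous

theorem bdd (hu : UnifC k u) : ∃ B : ℝ, ∀ i p, |u i p| ≤ B := by
  cases k with
  | zero => exact hu.2
  | succ k => exact hu.2.1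

theorem of_succ : ∀ {k : ℕ} {u : ι → ℝ × ℝ × ℝ → ℝ}, UnifC (k + 1) u → UnifC k u := by
  intro k
  induction k with
  | zero => exact fun hu => ⟨hu.continuous, hu.bdd⟩
  | succ k ih => exact fun hu => ⟨hu.1, hu.bdd, fun v => ih (hu.2.2 v)⟩

theorem mono {m : ℕ} (hu : UnifC k u) (hm : m ≤ k) : UnifC m u := by
  induction k, hm using Nat.le_induction with
  | base => exact hu
  | succ k _ ih => exact ih hu.of_succ

theorem const : ∀ (k : ℕ) (c : ι → ℝ) (B : ℝ), (∀ i, |c i| ≤ B) → UnifC k fun i _ => c i := by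
  intro k
  induction k with
  | zero => exact fun c B hB => ⟨fun i => continuous_const, B, fun i _ => hB i⟩
  | succ k ih =>
    refine fun c B hB => ⟨fun i => contDiff_const, ⟨B, fun i _ => hB i⟩, fun v => ?_⟩
    simpa using ih (fun _ => 0) 0 (fun _ => by simp)

theorem differentiable (hu : UnifC (k + 1) u) (i : ι) : Differentiable ℝ (u i) :=
  (hu.1 i).differentiable one_ne_zero

theorem add : ∀ {k : ℕ} {u w : ι → ℝ × ℝ × ℝ → ℝ}, UnifC k u → UnifC k w →
    UnifC k fun i p => u i p + w i p := by
  have hB : ∀ {u w : ι → ℝ × ℝ × ℝ → ℝ}, (∃ B : ℝ, ∀ i p, |u i p| ≤ B) →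
      (∃ B : ℝ, ∀ i p, |w i p| ≤ B) → ∃ B : ℝ, ∀ i p, |u i p + w i p| ≤ B :=
    fun ⟨B, hB⟩ ⟨B', hB'⟩ => ⟨B + B', fun i p => (abs_add_le _ _).trans (add_le_add (hB i p) (hB' i p))⟩
  intro k
  induction k with
  | zero => exact fun hu hw => ⟨fun i => (hu.1 i).add (hw.1 i), hB hu.2 hw.2⟩
  | succ k ih =>
    refine fun {u w} hu hw => ⟨fun i => (hu.1 i).add (hw.1 i), hB hu.bdd hw.bdd, fun v => ?_⟩
    have e : (fun i p => fderiv ℝ (fun p => u i p + w i p) p v)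
        = fun i p => fderiv ℝ (u i) p v + fderiv ℝ (w i) p v := by
      funext i p
      rw [fderiv_fun_add (hu.differentiable i p) (hw.differentiable i p)]
      rfl
    rw [e]
    exact ih (hu.2.2 v) (hw.2.2 v)

theorem mul : ∀ {k : ℕ} {u w : ι → ℝ × ℝ × ℝ → ℝ}, UnifC k u → UnifC k w →
    UnifC k fun i p => u i p * w i p := by
  have hB : ∀ {u w : ι → ℝ × ℝ × ℝ → ℝ}, (∃ B : ℝ, ∀ i p, |u i p| ≤ B) →
      (∃ B : ℝ, ∀ i p, |w i p| ≤ B) → ∃ B : ℝ, ∀ i p, |u i p * w i p| ≤ B :=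
    fun ⟨B, hB⟩ ⟨B', hB'⟩ => ⟨B * B', fun i p => by
      rw [abs_mul]
      exact mul_le_mul (hB i p) (hB' i p) (abs_nonneg _) ((abs_nonneg _).trans (hB i p))⟩
  intro k
  induction k with
  | zero => exact fun hu hw => ⟨fun i => (hu.1 i).mul (hw.1 i), hB hu.2 hw.2⟩
  | succ k ih =>
    refine fun {u w} hu hw => ⟨fun i => (hu.1 i).mul (hw.1 i), hB hu.bdd hw.bdd, fun v => ?_⟩
    have e : (fun i p => fderiv ℝ (fun p => u i p * w i p) p v)
        = fun i p => u i p * fderiv ℝ (w i) p v + w i p * fderiv ℝ (u i) p v := by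
      funext i p
      rw [fderiv_fun_mul (hu.differentiable i p) (hw.differentiable i p)]
      rfl
    rw [e]
    exact (ih hu.of_succ (hw.2.2 v)).add (ih hw.of_succ (hu.2.2 v))

theorem const_mul (c : ℝ) (hu : UnifC k u) : UnifC k fun i p => c * u i p :=
  (const k (fun _ => c) |c| fun _ => le_rfl).mul hu

theorem sub (hu : UnifC k u) (hw : UnifC k w) : UnifC k fun i p => u i p - w i p := by
  simpa [sub_eq_add_neg] using hu.add (hw.const_mul (-1))

theorem comp_linear (A : ℝ × ℝ × ℝ →L[ℝ] ℝ × ℝ × ℝ) : ∀ {k : ℕ} {u : ι → ℝ × ℝ × ℝ → ℝ},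
    UnifC k u → UnifC k fun i p => u i (A p) := by
  intro k
  induction k with
  | zero => exact fun hu => ⟨fun i => (hu.1 i).comp A.continuous, hu.2.imp fun B hB i p => hB i _⟩
  | succ k ih =>
    refine fun {u} hu => ⟨fun i => (hu.1 i).comp A.contDiff, hu.bdd.imp fun B hB i p => hB i _,
      fun v => ?_⟩
    have e : (fun i p => fderiv ℝ (fun p => u i (A p)) p v)
        = fun i p => fderiv ℝ (u i) (A p) (A v) := by
      funext i p
      have := ((hu.differentiable i (A p)).hasFDerivAt.comp p A.hasFDerivAt).fderiv
      change fderiv ℝ (u i ∘ A) p v = _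
      rw [this]
      rfl
    rw [e]
    exact ih (hu.2.2 (A v))

theorem inv {c : ℝ} (hc : 0 < c) : ∀ {k : ℕ} {u : ι → ℝ × ℝ × ℝ → ℝ}, (∀ i p, c ≤ u i p) →
    UnifC k u → UnifC k fun i p => (u i p)⁻¹ := by
  intro k
  have hB : ∀ {u : ι → ℝ × ℝ × ℝ → ℝ}, (∀ i p, c ≤ u i p) → ∃ B : ℝ, ∀ i p, |(u i p)⁻¹| ≤ B :=
    fun hu => ⟨c⁻¹, fun i p => by
      rw [abs_of_pos (inv_pos.2 (hc.trans_le (hu i p)))]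
      exact inv_anti₀ hc (hu i p)⟩
  have h0 : ∀ {u : ι → ℝ × ℝ × ℝ → ℝ}, (∀ i p, c ≤ u i p) → ∀ i p, u i p ≠ 0 :=
    fun hu i p => (hc.trans_le (hu i p)).ne'
  induction k with
  | zero => exact fun {u} hcu hu => ⟨fun i => (hu.1 i).inv₀ (h0 hcu i), hB hcu⟩
  | succ k ih =>
    refine fun {u} hcu hu => ⟨fun i => (hu.1 i).inv (h0 hcu i), hB hcu, fun v => ?_⟩
    have e : (fun i p => fderiv ℝ (fun p => (u i p)⁻¹) p v)
        = fun i p => -1 * ((u i p)⁻¹ * (u i p)⁻¹ * fderiv ℝ (u i) p v) := by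
      funext i p
      have := ((hasDerivAt_inv (h0 hcu i p)).comp_hasFDerivAt p (hu.differentiable i p).hasFDerivAt).fderiv
      change fderiv ℝ (Inv.inv ∘ u i) p v = _
      rw [this]
      simp only [smul_apply, smul_eq_mul]
      field_simp
    rw [e]
    have h1 := ih hcu hu.of_succ
    exact ((h1.mul h1).mul (hu.2.2 v)).const_mul (-1)

theorem div {c : ℝ} (hc : 0 < c) (hw : ∀ i p, c ≤ w i p) (hu : UnifC k u) (hw' : UnifC k w) :
    UnifC k fun i p => u i p / w i p := by
  simpa [div_eq_mul_inv] using hu.mul (hw'.inv hc hw)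

theorem sqrt {c : ℝ} (hc : 0 < c) : ∀ {k : ℕ} {u : ι → ℝ × ℝ × ℝ → ℝ}, (∀ i p, c ≤ u i p) →
    UnifC k u → UnifC k fun i p => Real.sqrt (u i p) := by
  intro k
  have hB : ∀ {u : ι → ℝ × ℝ × ℝ → ℝ}, (∃ B : ℝ, ∀ i p, |u i p| ≤ B) →
      ∃ B : ℝ, ∀ i p, |Real.sqrt (u i p)| ≤ B :=
    fun ⟨B, hB⟩ => ⟨Real.sqrt B, fun i p => by
      rw [abs_of_nonneg (Real.sqrt_nonneg _)]
      exact Real.sqrt_le_sqrt ((le_abs_self _).trans (hB i p))⟩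
  have h0 : ∀ {u : ι → ℝ × ℝ × ℝ → ℝ}, (∀ i p, c ≤ u i p) → ∀ i p, u i p ≠ 0 :=
    fun hu i p => (hc.trans_le (hu i p)).ne'
  induction k with
  | zero => exact fun {u} hcu hu => ⟨fun i => (hu.1 i).sqrt, hB hu.2⟩
  | succ k ih =>
    refine fun {u} hcu hu => ⟨fun i => (hu.1 i).sqrt (h0 hcu i), hB hu.bdd, fun v => ?_⟩
    have e : (fun i p => fderiv ℝ (fun p => Real.sqrt (u i p)) p v)
        = fun i p => 1 / 2 * (fderiv ℝ (u i) p v / Real.sqrt (u i p)) := by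
      funext i p
      rw [((hu.differentiable i p).hasFDerivAt.sqrt (h0 hcu i p)).fderiv]
      simp only [smul_apply, smul_eq_mul]
      ring
    rw [e]
    exact (div (Real.sqrt_pos.2 hc) (fun i p => Real.sqrt_le_sqrt (hcu i p)) (hu.2.2 v)
      (ih hcu hu.of_succ)).const_mul _

theorem log {c : ℝ} (hc : 0 < c) : ∀ {k : ℕ} {u : ι → ℝ × ℝ × ℝ → ℝ}, (∀ i p, c ≤ u i p) →
    UnifC k u → UnifC k fun i p => Real.log (u i p) := by
  intro k
  have hB : ∀ {u : ι → ℝ × ℝ × ℝ → ℝ}, (∀ i p, c ≤ u i p) → (∃ B : ℝ, ∀ i p, |u i p| ≤ B) →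
      ∃ B : ℝ, ∀ i p, |Real.log (u i p)| ≤ B :=
    fun hu ⟨B, hB⟩ => ⟨max |Real.log c| |Real.log B|, fun i p => abs_le_max_abs_abs
      (Real.log_le_log hc (hu i p))
      (Real.log_le_log (hc.trans_le (hu i p)) ((le_abs_self _).trans (hB i p)))⟩
  have h0 : ∀ {u : ι → ℝ × ℝ × ℝ → ℝ}, (∀ i p, c ≤ u i p) → ∀ i p, u i p ≠ 0 :=
    fun hu i p => (hc.trans_le (hu i p)).ne'
  cases k with
  | zero => exact fun {u} hcu hu => ⟨fun i => (hu.1 i).log (h0 hcu i), hB hcu hu.2⟩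
  | succ k =>
    refine fun {u} hcu hu => ⟨fun i => (hu.1 i).log (h0 hcu i), hB hcu hu.bdd, fun v => ?_⟩
    have e : (fun i p => fderiv ℝ (fun p => Real.log (u i p)) p v)
        = fun i p => fderiv ℝ (u i) p v / u i p := by
      funext i p
      rw [((hu.differentiable i p).hasFDerivAt.log (h0 hcu i p)).fderiv]
      simp only [smul_apply, smul_eq_mul]
      ring
    rw [e]
    exact div hc hcu (hu.2.2 v) hu.of_succ

/-- The linear map `(h, z) ↦ (h, z) + s h a`. -/
def shear (s : ℝ) (a : ℝ × ℝ × ℝ) : ℝ × ℝ × ℝ →L[ℝ] ℝ × ℝ × ℝ :=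
  ContinuousLinearMap.id ℝ _ + s • (ContinuousLinearMap.fst ℝ ℝ (ℝ × ℝ)).smulRight a

theorem shear_apply (s : ℝ) (a p : ℝ × ℝ × ℝ) : shear s a p = p + (s * p.1) • a := by
  simp [shear, mul_smul]

theorem continuous_shear (a : ℝ × ℝ × ℝ) : Continuous fun s => shear s a := by
  unfold shear
  fun_prop

theorem continuous_shear_apply (a : ℝ × ℝ × ℝ) :
    Continuous fun q : (ℝ × ℝ × ℝ) × ℝ => shear q.2 a q.1 := by
  simp only [shear_apply]
  fun_prop

theorem hasFDerivAt_integral {f : ℝ × ℝ × ℝ → ℝ} (hf : ContDiff ℝ 1 f) (n : ℕ) (a p : ℝ × ℝ × ℝ) :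
    HasFDerivAt (fun p => ∫ s in (-1 / 2 : ℝ)..1 / 2, s ^ n * f (shear s a p))
      (∫ s in (-1 / 2 : ℝ)..1 / 2, s ^ n • (fderiv ℝ f (shear s a p)).comp (shear s a)) p := by
  have hc : Continuous fun q : (ℝ × ℝ × ℝ) × ℝ =>
      q.2 ^ n • (fderiv ℝ f (shear q.2 a q.1)).comp (shear q.2 a) := by
    have h1 : Continuous fun q : (ℝ × ℝ × ℝ) × ℝ => fderiv ℝ f (shear q.2 a q.1) :=
      (hf.continuous_fderiv one_ne_zero).comp (continuous_shear_apply a)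
    have h2 : Continuous fun q : (ℝ × ℝ × ℝ) × ℝ => shear q.2 a :=
      (continuous_shear a).comp continuous_snd
    exact (continuous_snd.pow n).smul (h1.clm_comp h2)
  have hF : ∀ x : ℝ × ℝ × ℝ, Continuous fun s : ℝ => s ^ n * f (shear s a x) := fun x =>
    (continuous_pow n).mul (hf.continuous.comp ((continuous_shear_apply a).comp
      (continuous_const.prodMk continuous_id)))
  have hF' : Continuous fun s : ℝ => s ^ n • (fderiv ℝ f (shear s a p)).comp (shear s a) :=
    hc.comp (continuous_const.prodMk continuous_id)
  obtain ⟨C, hC⟩ := ((isCompact_closedBall p (1 : ℝ)).prod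
    (isCompact_Icc (a := (-1 / 2 : ℝ)) (b := 1 / 2))).exists_bound_of_continuousOn hc.continuousOn
  refine intervalIntegral.hasFDerivAt_integral_of_dominated_of_fderiv_le (bound := fun _ => C)
    (F := fun p s => s ^ n * f (shear s a p))
    (F' := fun p s => s ^ n • (fderiv ℝ f (shear s a p)).comp (shear s a))
    (Metric.closedBall_mem_nhds p one_pos)
    (Filter.Eventually.of_forall fun x => (hF x).aestronglyMeasurable)
    ((hF p).intervalIntegrable _ _) hF'.aestronglyMeasurable
    (Filter.Eventually.of_forall fun s hs x hx => ?_) intervalIntegrable_const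
    (Filter.Eventually.of_forall fun s _ x _ => ?_)
  · rw [Set.uIoc_of_le (by norm_num)] at hs
    exact hC (x, s) ⟨hx, hs.1.le, hs.2⟩
  · have h1 := (hf.differentiable one_ne_zero (shear s a x)).hasFDerivAt.comp x (shear s a).hasFDerivAt
    exact h1.const_mul (s ^ n)

/-- The weight `s ^ n` is needed for the induction: differentiating in `h` hits the shear and brings
out a further factor `s`. -/
theorem integral : ∀ {k : ℕ} {u : ι → ℝ × ℝ × ℝ → ℝ} (n : ℕ) (a : ℝ × ℝ × ℝ), UnifC k u →
    UnifC k fun i p => ∫ s in (-1 / 2 : ℝ)..1 / 2, s ^ n * u i (shear s a p) := by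
  have hF : ∀ {f : ℝ × ℝ × ℝ → ℝ} (n : ℕ) (a : ℝ × ℝ × ℝ), Continuous f →
      Continuous fun q : (ℝ × ℝ × ℝ) × ℝ => q.2 ^ n * f (shear q.2 a q.1) := fun n a hf =>
    (continuous_snd.pow n).mul (hf.comp (continuous_shear_apply a))
  have hB : ∀ {u : ι → ℝ × ℝ × ℝ → ℝ} (n : ℕ) (a : ℝ × ℝ × ℝ), (∃ B : ℝ, ∀ i p, |u i p| ≤ B) →
      ∃ B : ℝ, ∀ i p, |∫ s in (-1 / 2 : ℝ)..1 / 2, s ^ n * u i (shear s a p)| ≤ B := by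
    rintro u n a ⟨B, hB⟩
    refine ⟨B * |1 / 2 - (-1 / 2 : ℝ)|, fun i p => ?_⟩
    rw [← Real.norm_eq_abs]
    refine intervalIntegral.norm_integral_le_of_norm_le_const fun s hs => ?_
    rw [Set.uIoc_of_le (by norm_num)] at hs
    rw [norm_mul, norm_pow, Real.norm_eq_abs, Real.norm_eq_abs]
    have h1 : |s| ≤ 1 := abs_le.2 ⟨by linarith [hs.1], by linarith [hs.2]⟩
    have h2 : |s| ^ n ≤ 1 := pow_le_one₀ (abs_nonneg s) h1
    calc _ ≤ 1 * |u i (shear s a p)| := mul_le_mul_of_nonneg_right h2 (abs_nonneg _)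
      _ ≤ B := by rw [one_mul]; exact hB _ _
  intro k
  induction k with
  | zero =>
    exact fun n a hu => ⟨fun i => intervalIntegral.continuous_parametric_intervalIntegral_of_continuous'
      (hF n a (hu.1 i)) _ _, hB n a hu.2⟩
  | succ k ih =>
    intro u n a hu
    have hd : ∀ i p v, fderiv ℝ (fun p => ∫ s in (-1 / 2 : ℝ)..1 / 2, s ^ n * u i (shear s a p)) p v
        = (∫ s in (-1 / 2 : ℝ)..1 / 2, s ^ n * fderiv ℝ (u i) (shear s a p) v)
          + v.1 * ∫ s in (-1 / 2 : ℝ)..1 / 2, s ^ (n + 1) * fderiv ℝ (u i) (shear s a p) a := by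
      intro i p v
      have hc : Continuous fun s => fderiv ℝ (u i) (shear s a p) :=
        ((hu.1 i).continuous_fderiv one_ne_zero).comp ((continuous_shear_apply a).comp
          (continuous_const.prodMk continuous_id))
      have hcv : ∀ v, Continuous fun s => fderiv ℝ (u i) (shear s a p) v := fun v =>
        hc.clm_apply continuous_const
      rw [(hasFDerivAt_integral (hu.1 i) n a p).fderiv,
        ContinuousLinearMap.intervalIntegral_apply, ← intervalIntegral.integral_const_mul,
        ← intervalIntegral.integral_add]
      · refine intervalIntegral.integral_congr fun s _ => ?_
        simp only [smul_apply, ContinuousLinearMap.comp_apply, smul_eq_mul]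
        rw [shear_apply s a v, map_add, map_smul, smul_eq_mul]
        ring
      · exact ((continuous_pow n).mul (hcv v)).intervalIntegrable _ _
      · exact (continuous_const.mul ((continuous_pow (n + 1)).mul (hcv a))).intervalIntegrable _ _
      · exact ((continuous_pow n).smul (hc.clm_comp (continuous_shear a))).intervalIntegrable _ _
    have hU : ∀ v, UnifC k fun i p =>
        fderiv ℝ (fun p => ∫ s in (-1 / 2 : ℝ)..1 / 2, s ^ n * u i (shear s a p)) p v := by
      intro v
      simp only [hd]
      exact (ih n a (hu.2.2 v)).add ((ih (n + 1) a (hu.2.2 a)).const_mul v.1)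
    refine ⟨fun i => ?_, hB n a hu.bdd, hU⟩
    refine contDiff_one_iff_fderiv.2
      ⟨fun p => (hasFDerivAt_integral (hu.1 i) n a p).differentiableAt, ?_⟩
    exact continuous_clm_apply.2 fun v => (hU v).continuous i

end UnifC

end UniformSmooth

/-! ## Centred differences and averages as operators on smooth families -/

section Centred

variable {ι : Type*}

open UnifC

/-- The direction `x`. -/
def ex : ℝ × ℝ × ℝ := (0, 1, 0)

/-- The direction `y`. -/
def ey : ℝ × ℝ × ℝ := (0, 0, 1)

/-- The centred difference quotient `(u (h, z + h a / 2) - u (h, z - h a / 2)) / h`, extended to `h = 0`. -/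
def cD (a : ℝ × ℝ × ℝ) (u : ι → ℝ × ℝ × ℝ → ℝ) : ι → ℝ × ℝ × ℝ → ℝ :=
  fun i p => ∫ s in (-1 / 2 : ℝ)..1 / 2, fderiv ℝ (u i) (shear s a p) a

/-- The centred average `(u (h, z + h a / 2) + u (h, z - h a / 2)) / 2`. -/
def cA (a : ℝ × ℝ × ℝ) (u : ι → ℝ × ℝ × ℝ → ℝ) : ι → ℝ × ℝ × ℝ → ℝ :=
  fun i p => 1 / 2 * (u i (shear (1 / 2) a p) + u i (shear (-1 / 2) a p))

/-- Uniformly `C^k` families that are even in `h` and `L`-periodic in `x` and `y`. -/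
structure Reg (L : ℝ) (k : ℕ) (u : ι → ℝ × ℝ × ℝ → ℝ) : Prop where
  unif : UnifC k u
  even : ∀ i h z, u i (-h, z) = u i (h, z)
  perx : ∀ i p, u i (p + L • ex) = u i p
  pery : ∀ i p, u i (p + L • ey) = u i p

namespace Reg

variable {L : ℝ} {k : ℕ} {u w : ι → ℝ × ℝ × ℝ → ℝ}

theorem mono {m : ℕ} (hu : Reg L k u) (hm : m ≤ k) : Reg L m u :=
  ⟨hu.unif.mono hm, hu.even, hu.perx, hu.pery⟩

theorem const (k : ℕ) (c : ℝ) : Reg L k fun (_ : ι) _ => c :=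
  ⟨UnifC.const k (fun _ => c) |c| fun _ => le_rfl, fun _ _ _ => rfl, fun _ _ => rfl, fun _ _ => rfl⟩

theorem add (hu : Reg L k u) (hw : Reg L k w) : Reg L k fun i p => u i p + w i p :=
  ⟨hu.unif.add hw.unif, fun i h z => by rw [hu.even, hw.even], fun i p => by rw [hu.perx, hw.perx],
    fun i p => by rw [hu.pery, hw.pery]⟩

theorem sub (hu : Reg L k u) (hw : Reg L k w) : Reg L k fun i p => u i p - w i p :=
  ⟨hu.unif.sub hw.unif, fun i h z => by rw [hu.even, hw.even], fun i p => by rw [hu.perx, hw.perx],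
    fun i p => by rw [hu.pery, hw.pery]⟩

theorem mul (hu : Reg L k u) (hw : Reg L k w) : Reg L k fun i p => u i p * w i p :=
  ⟨hu.unif.mul hw.unif, fun i h z => by rw [hu.even, hw.even], fun i p => by rw [hu.perx, hw.perx],
    fun i p => by rw [hu.pery, hw.pery]⟩

theorem const_mul (c : ℝ) (hu : Reg L k u) : Reg L k fun i p => c * u i p :=
  (const k c).mul hu

theorem div {c : ℝ} (hc : 0 < c) (hcw : ∀ i p, c ≤ w i p) (hu : Reg L k u) (hw : Reg L k w) :
    Reg L k fun i p => u i p / w i p :=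
  ⟨UnifC.div hc hcw hu.unif hw.unif, fun i h z => by rw [hu.even, hw.even],
    fun i p => by rw [hu.perx, hw.perx], fun i p => by rw [hu.pery, hw.pery]⟩

theorem sqrt {c : ℝ} (hc : 0 < c) (hcu : ∀ i p, c ≤ u i p) (hu : Reg L k u) :
    Reg L k fun i p => Real.sqrt (u i p) :=
  ⟨hu.unif.sqrt hc hcu, fun i h z => by rw [hu.even], fun i p => by rw [hu.perx],
    fun i p => by rw [hu.pery]⟩

theorem log {c : ℝ} (hc : 0 < c) (hcu : ∀ i p, c ≤ u i p) (hu : Reg L k u) :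
    Reg L k fun i p => Real.log (u i p) :=
  ⟨hu.unif.log hc hcu, fun i h z => by rw [hu.even], fun i p => by rw [hu.perx],
    fun i p => by rw [hu.pery]⟩

theorem shear_neg_h (s : ℝ) {a : ℝ × ℝ × ℝ} (ha : a.1 = 0) (h : ℝ) (z : ℝ × ℝ) :
    shear s a (-h, z) = (-(shear (-s) a (h, z)).1, (shear (-s) a (h, z)).2) := by
  simp only [shear_apply]
  ext <;> simp [ha]

theorem shear_add (s : ℝ) {a b : ℝ × ℝ × ℝ} (hb : b.1 = 0) (p : ℝ × ℝ × ℝ) :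
    shear s a (p + b) = shear s a p + b := by
  simp only [shear_apply, Prod.fst_add, hb, add_zero]
  abel

theorem cA_reg {a : ℝ × ℝ × ℝ} (ha : a.1 = 0) (hu : Reg L k u) : Reg L k (cA a u) := by
  refine ⟨((hu.unif.comp_linear _).add (hu.unif.comp_linear _)).const_mul _, fun i h z => ?_,
    fun i p => ?_, fun i p => ?_⟩
  · simp only [cA, shear_neg_h _ ha, hu.even]
    rw [neg_div, neg_neg, add_comm]
  · simp only [cA, shear_add (b := L • ex) _ (by simp [ex]), hu.perx]
  · simp only [cA, shear_add (b := L • ey) _ (by simp [ey]), hu.pery]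

theorem fderiv_add {b : ℝ × ℝ × ℝ} {f : ℝ × ℝ × ℝ → ℝ} (hf : ∀ p, f (p + b) = f p) (p : ℝ × ℝ × ℝ) :
    fderiv ℝ f (p + b) = fderiv ℝ f p := by
  rw [← fderiv_comp_add_right]
  simp only [hf]

theorem fderiv_even {f : ℝ × ℝ × ℝ → ℝ} (hd : Differentiable ℝ f)
    (hf : ∀ h z, f (-h, z) = f (h, z)) {a : ℝ × ℝ × ℝ} (ha : a.1 = 0) (h : ℝ) (z : ℝ × ℝ) :
    fderiv ℝ f (-h, z) a = fderiv ℝ f (h, z) a := by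
  let R : ℝ × ℝ × ℝ →L[ℝ] ℝ × ℝ × ℝ :=
    (-ContinuousLinearMap.fst ℝ ℝ (ℝ × ℝ)).prod (ContinuousLinearMap.snd ℝ ℝ (ℝ × ℝ))
  have hR : ∀ p, R p = (-p.1, p.2) := fun p => rfl
  have e : f ∘ R = f := by
    funext p
    exact hf p.1 p.2
  have h1 := ((hd (R (h, z))).hasFDerivAt.comp (h, z) R.hasFDerivAt).fderiv
  rw [e] at h1
  rw [h1, ContinuousLinearMap.comp_apply, hR, hR, ha, neg_zero, ← ha]

/-- Evenness is where centring matters: changing the sign of `h` replaces `s` by `-s`, and the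
interval of integration is symmetric. The integral form shows smoothness across `h = 0`, with the
loss of one derivative. -/
theorem cD_reg {a : ℝ × ℝ × ℝ} (ha : a.1 = 0) (hu : Reg L (k + 1) u) : Reg L k (cD a u) := by
  refine ⟨?_, fun i h z => ?_, fun i p => ?_, fun i p => ?_⟩
  · have := (hu.unif.2.2 a).integral 0 a
    simp only [pow_zero, one_mul] at this
    exact this
  · simp only [cD, shear_neg_h _ ha, fderiv_even (hu.unif.differentiable i) (hu.even i) ha]
    have := intervalIntegral.integral_comp_neg (a := (-1 / 2 : ℝ)) (b := 1 / 2)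
      (fun s => fderiv ℝ (u i) (shear s a (h, z)) a)
    simp only [Prod.mk.eta] at this ⊢
    rw [this]
    norm_num
  · simp only [cD, shear_add (b := L • ex) _ (by simp [ex]), fderiv_add (hu.perx i)]
  · simp only [cD, shear_add (b := L • ey) _ (by simp [ey]), fderiv_add (hu.pery i)]

/-- The fundamental theorem of calculus along the segment traced by the shear. -/
theorem mul_cD (hu : Reg L (k + 1) u) (a : ℝ × ℝ × ℝ) (i : ι) (p : ℝ × ℝ × ℝ) :
    p.1 * cD a u i p = u i (shear (1 / 2) a p) - u i (shear (-1 / 2) a p) := by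
  have h1 : ∀ s ∈ Set.uIcc (-1 / 2 : ℝ) (1 / 2), HasDerivAt (fun s => u i (shear s a p))
      (p.1 * fderiv ℝ (u i) (shear s a p) a) s := by
    intro s _
    have hs : HasDerivAt (fun s => shear s a p) (p.1 • a) s := by
      simp only [shear_apply]
      simpa using (((hasDerivAt_id s).mul_const p.1).smul_const a).const_add p
    have := ((hu.unif.differentiable i) (shear s a p)).hasFDerivAt.comp_hasDerivAt s hs
    rw [map_smul, smul_eq_mul] at this
    exact this
  have hc : Continuous fun s => p.1 * fderiv ℝ (u i) (shear s a p) a :=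
    continuous_const.mul (((hu.unif.2.2 a).continuous i).comp ((continuous_shear_apply a).comp
      (continuous_const.prodMk continuous_id)))
  have := intervalIntegral.integral_eq_sub_of_hasDerivAt h1 (hc.intervalIntegrable _ _)
  rw [intervalIntegral.integral_const_mul] at this
  exact this

/-- An even family is a second order perturbation of its value at `h = 0`. -/
theorem abs_sub_le (hu : Reg L 2 u) : ∃ C : ℝ, 0 ≤ C ∧ ∀ i h z, |u i (h, z) - u i (0, z)| ≤ C * h ^ 2 := by
  let e : ℝ × ℝ × ℝ := (1, 0, 0)
  obtain ⟨B, hB⟩ := ((hu.unif.2.2 e).2.2 e).bdd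
  by_cases hι : Nonempty ι
  swap
  · exact ⟨0, le_rfl, fun i => (hι ⟨i⟩).elim⟩
  have hB0 : 0 ≤ B := (abs_nonneg _).trans (hB hι.some 0)
  refine ⟨B, hB0, fun i h z => ?_⟩
  set g : ℝ → ℝ := fun t => fderiv ℝ (u i) (t, z) e with hg
  have hline : ∀ t : ℝ, HasDerivAt (fun t : ℝ => ((t, z) : ℝ × ℝ × ℝ)) e t := fun t =>
    (hasDerivAt_id t).prodMk (hasDerivAt_const t z)
  have h1 : ∀ t, HasDerivAt (fun t => u i (t, z)) (g t) t := fun t =>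
    ((hu.unif.differentiable i) (t, z)).hasFDerivAt.comp_hasDerivAt t (hline t)
  have h2 : ∀ t, HasDerivAt g (fderiv ℝ (fun p => fderiv ℝ (u i) p e) (t, z) e) t := fun t =>
    HasFDerivAt.comp_hasDerivAt (f := fun t : ℝ => ((t, z) : ℝ × ℝ × ℝ)) t
      (((hu.unif.2.2 e).differentiable i) (t, z)).hasFDerivAt (hline t)
  -- The `h`-derivative of an even function vanishes at `0`; two applications of the mean value
  -- inequality then give `B h²`.
  have h0 : g 0 = 0 := by
    have h3 : HasDerivAt (fun t => u i (-t, z)) (-g 0) 0 := by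
      have h4 : HasDerivAt (fun t => u i (t, z)) (g 0) (-0) := by simpa using h1 0
      have h5 := h4.comp (0 : ℝ) (hasDerivAt_neg (0 : ℝ))
      rw [mul_neg_one] at h5
      exact h5
    simp only [hu.even] at h3
    have := h3.unique (h1 0)
    linarith
  have hgb : ∀ t, |g t| ≤ B * |t| := by
    intro t
    have := Convex.norm_image_sub_le_of_norm_hasDerivWithin_le (s := Set.univ) (C := B)
      (fun t _ => (h2 t).hasDerivWithinAt) (fun t _ => hB i (t, z)) convex_univ
      (Set.mem_univ 0) (Set.mem_univ t)
    simpa [h0] using this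
  have := Convex.norm_image_sub_le_of_norm_hasDerivWithin_le (s := Set.uIcc 0 h) (C := B * |h|)
    (f := fun t => u i (t, z)) (fun t _ => (h1 t).hasDerivWithinAt) (fun t ht => (hgb t).trans
      (mul_le_mul_of_nonneg_left (by
        have := Set.abs_sub_left_of_mem_uIcc ht
        simpa using this) hB0)) (convex_uIcc 0 h) Set.left_mem_uIcc Set.right_mem_uIcc
  simp only [Real.norm_eq_abs, sub_zero] at this
  rwa [mul_assoc, abs_mul_abs_self, ← sq] at this

end Reg

/-- The restriction of `u i` to `h = 0`. -/
def slice (u : ι → ℝ × ℝ × ℝ → ℝ) (i : ι) : ℝ × ℝ → ℝ := fun z => u i (0, z)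

/-- At `h = 0` every shear is the identity. The slice lemmas identify each centred operator there
with its continuous counterpart. -/
theorem slice_cA (a : ℝ × ℝ × ℝ) (u : ι → ℝ × ℝ × ℝ → ℝ) (i : ι) : slice (cA a u) i = slice u i := by
  funext z
  simp only [slice, cA, shear_apply, mul_zero, zero_smul, add_zero]
  ring

theorem cD_zero (a : ℝ × ℝ × ℝ) (u : ι → ℝ × ℝ × ℝ → ℝ) (i : ι) (z : ℝ × ℝ) :
    cD a u i (0, z) = fderiv ℝ (u i) (0, z) a := by
  simp only [cD, shear_apply, mul_zero, zero_smul, add_zero, intervalIntegral.integral_const]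
  norm_num

theorem slice_cD_x {L : ℝ} {k : ℕ} {u : ι → ℝ × ℝ × ℝ → ℝ} (hu : Reg L (k + 1) u) (i : ι) :
    slice (cD ex u) i = px (slice u i) := by
  funext z
  have hl : HasDerivAt (fun s : ℝ => ((0, s, z.2) : ℝ × ℝ × ℝ)) ex z.1 :=
    (hasDerivAt_const _ _).prodMk ((hasDerivAt_id _).prodMk (hasDerivAt_const _ _))
  have := ((hu.unif.differentiable i) (0, z.1, z.2)).hasFDerivAt.comp_hasDerivAt z.1 hl
  exact (cD_zero ex u i z).trans this.deriv.symm

theorem slice_cD_y {L : ℝ} {k : ℕ} {u : ι → ℝ × ℝ × ℝ → ℝ} (hu : Reg L (k + 1) u) (i : ι) :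
    slice (cD ey u) i = py (slice u i) := by
  funext z
  have hl : HasDerivAt (fun s : ℝ => ((0, z.1, s) : ℝ × ℝ × ℝ)) ey z.2 :=
    (hasDerivAt_const _ _).prodMk ((hasDerivAt_const _ _).prodMk (hasDerivAt_id _))
  have := ((hu.unif.differentiable i) (0, z.1, z.2)).hasFDerivAt.comp_hasDerivAt z.2 hl
  exact (cD_zero ey u i z).trans this.deriv.symm

/-- The five-point Laplacian. -/
def cLap (u : ι → ℝ × ℝ × ℝ → ℝ) : ι → ℝ × ℝ × ℝ → ℝ :=
  fun i p => cD ex (cD ex u) i p + cD ey (cD ey u) i p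

theorem cLap_reg {L : ℝ} {k : ℕ} {u : ι → ℝ × ℝ × ℝ → ℝ} (hu : Reg L (k + 2) u) : Reg L k (cLap u) :=
  (Reg.cD_reg rfl (Reg.cD_reg rfl hu)).add (Reg.cD_reg rfl (Reg.cD_reg rfl hu))

theorem slice_cLap {L : ℝ} {k : ℕ} {u : ι → ℝ × ℝ × ℝ → ℝ} (hu : Reg L (k + 2) u) (i : ι) :
    slice (cLap u) i = laplace (slice u i) := by
  funext z
  have h1 := congrFun (slice_cD_x (Reg.cD_reg (a := ex) rfl hu) i) z
  have h2 := congrFun (slice_cD_y (Reg.cD_reg (a := ey) rfl hu) i) z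
  rw [slice_cD_x hu] at h1
  rw [slice_cD_y hu] at h2
  exact congrArg₂ (· + ·) h1 h2

/-- The averaged `|∇^δ u|`. -/
def cMod (δ : ℝ) (u : ι → ℝ × ℝ × ℝ → ℝ) : ι → ℝ × ℝ × ℝ → ℝ := fun i p =>
  Real.sqrt (cA ex (fun i p => cD ex u i p * cD ex u i p) i p
    + cA ey (fun i p => cD ey u i p * cD ey u i p) i p + δ ^ 2)

theorem cA_sq_nonneg (a : ℝ × ℝ × ℝ) (u : ι → ℝ × ℝ × ℝ → ℝ) (i : ι) (p : ℝ × ℝ × ℝ) :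
    0 ≤ cA a (fun i p => u i p * u i p) i p :=
  mul_nonneg (by norm_num) (add_nonneg (mul_self_nonneg _) (mul_self_nonneg _))

theorem le_cMod (δ : ℝ) (u : ι → ℝ × ℝ × ℝ → ℝ) (i : ι) (p : ℝ × ℝ × ℝ) : δ ≤ cMod δ u i p := by
  refine Real.le_sqrt_of_sq_le ?_
  have := cA_sq_nonneg ex (cD ex u) i p
  have := cA_sq_nonneg ey (cD ey u) i p
  linarith

theorem cMod_reg {L δ : ℝ} (hδ : 0 < δ) {k : ℕ} {u : ι → ℝ × ℝ × ℝ → ℝ} (hu : Reg L (k + 1) u) :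
    Reg L k (cMod δ u) := by
  have hx := Reg.cD_reg (a := ex) rfl hu
  have hy := Reg.cD_reg (a := ey) rfl hu
  refine Reg.sqrt (c := δ ^ 2) (by positivity) (fun i p => ?_)
    (((Reg.cA_reg rfl (hx.mul hx)).add (Reg.cA_reg rfl (hy.mul hy))).add (Reg.const _ _))
  have := cA_sq_nonneg ex (cD ex u) i p
  have := cA_sq_nonneg ey (cD ey u) i p
  linarith

theorem slice_cMod {L δ : ℝ} {k : ℕ} {u : ι → ℝ × ℝ × ℝ → ℝ} (hu : Reg L (k + 1) u) (i : ι) :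
    slice (cMod δ u) i = modGrad δ (slice u i) := by
  funext z
  have h1 := congrFun (slice_cA ex (fun i p => cD ex u i p * cD ex u i p) i) z
  have h2 := congrFun (slice_cA ey (fun i p => cD ey u i p * cD ey u i p) i) z
  have h3 := congrFun (slice_cD_x hu i) z
  have h4 := congrFun (slice_cD_y hu i) z
  simp only [slice] at h1 h2 h3 h4
  simp only [slice, cMod, modGrad, h1, h2, h3, h4, sq]

/-- The centred version of `∇·(r ∇u / |∇^δ u|)`. -/
def cDiv (δ : ℝ) (u r : ι → ℝ × ℝ × ℝ → ℝ) : ι → ℝ × ℝ × ℝ → ℝ := fun i p =>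
  cD ex (fun i p => cA ex (fun i p => r i p / cMod δ u i p) i p * cD ex u i p) i p
    + cD ey (fun i p => cA ey (fun i p => r i p / cMod δ u i p) i p * cD ey u i p) i p

theorem cFlux_reg {L δ : ℝ} (hδ : 0 < δ) {k : ℕ} {u r : ι → ℝ × ℝ × ℝ → ℝ} (hu : Reg L (k + 1) u)
    (hr : Reg L k r) {a : ℝ × ℝ × ℝ} (ha : a.1 = 0) :
    Reg L k fun i p => cA a (fun i p => r i p / cMod δ u i p) i p * cD a u i p :=
  (Reg.cA_reg ha (Reg.div hδ (le_cMod δ u) hr (cMod_reg hδ hu))).mul (Reg.cD_reg ha hu)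

theorem cDiv_reg {L δ : ℝ} (hδ : 0 < δ) {k : ℕ} {u r : ι → ℝ × ℝ × ℝ → ℝ} (hu : Reg L (k + 2) u)
    (hr : Reg L (k + 1) r) : Reg L k (cDiv δ u r) :=
  (Reg.cD_reg rfl (cFlux_reg hδ hu hr rfl)).add (Reg.cD_reg rfl (cFlux_reg hδ hu hr rfl))

theorem slice_cDiv {L δ : ℝ} (hδ : 0 < δ) {k : ℕ} {u r : ι → ℝ × ℝ × ℝ → ℝ} (hu : Reg L (k + 2) u)
    (hr : Reg L (k + 1) r) (i : ι) :
    slice (cDiv δ u r) i = fun z =>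
      px (fun q => slice r i q * px (slice u i) q / modGrad δ (slice u i) q) z
        + py (fun q => slice r i q * py (slice u i) q / modGrad δ (slice u i) q) z := by
  funext z
  have hx := slice_cD_x (cFlux_reg hδ hu hr (a := ex) rfl) i
  have hy := slice_cD_y (cFlux_reg hδ hu hr (a := ey) rfl) i
  have e1 : slice (fun i p => cA ex (fun i p => r i p / cMod δ u i p) i p * cD ex u i p) i
      = fun q => slice r i q * px (slice u i) q / modGrad δ (slice u i) q := by
    funext q
    have h1 := congrFun (slice_cA ex (fun i p => r i p / cMod δ u i p) i) q
    rw [← slice_cD_x hu, ← slice_cMod hu]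
    simp only [slice] at h1 ⊢
    rw [h1]
    ring
  have e2 : slice (fun i p => cA ey (fun i p => r i p / cMod δ u i p) i p * cD ey u i p) i
      = fun q => slice r i q * py (slice u i) q / modGrad δ (slice u i) q := by
    funext q
    have h1 := congrFun (slice_cA ey (fun i p => r i p / cMod δ u i p) i) q
    rw [← slice_cD_y hu, ← slice_cMod hu]
    simp only [slice] at h1 ⊢
    rw [h1]
    ring
  rw [e1] at hx
  rw [e2] at hy
  exact congrArg₂ (· + ·) (congrFun hx z) (congrFun hy z)

/-- The centred version of `muPhi`. -/
def cMuPhi (P : Params) (u r : ι → ℝ × ℝ × ℝ → ℝ) : ι → ℝ × ℝ × ℝ → ℝ := fun i p =>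
  1 / P.ε * ((u i p - 1 / 2) * ((u i p - 1 / 2) * (u i p - 1 / 2)))
    + -(1 / (4 * P.ε)) * (u i p - 1 / 2) + -(P.ε + P.α) * cLap u i p
    + P.η ^ 2 * cLap (cLap u) i p + P.α * cDiv P.δ u r i p

theorem cMuPhi_reg {L : ℝ} (P : Params) {k : ℕ} {u r : ι → ℝ × ℝ × ℝ → ℝ} (hu : Reg L (k + 4) u)
    (hr : Reg L (k + 1) r) : Reg L k (cMuPhi P u r) := by
  have h0 : Reg L k u := hu.mono (by omega)
  have h2 : Reg L (k + 2) u := hu.mono (by omega)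
  have h1 := h0.sub (Reg.const k (1 / 2))
  exact ((((h1.mul (h1.mul h1)).const_mul _).add (h1.const_mul _)).add ((cLap_reg h2).const_mul _)
    |>.add ((cLap_reg (cLap_reg hu)).const_mul _)).add ((cDiv_reg P.δ_pos h2 hr).const_mul _)

/-- The split double well recombines: `(s - 1/2)³ - (s - 1/2)/4` equals `f'(s)`. -/
theorem slice_cMuPhi {L : ℝ} (P : Params) {k : ℕ} {u r : ι → ℝ × ℝ × ℝ → ℝ} (hu : Reg L (k + 4) u)
    (hr : Reg L (k + 1) r) (i : ι) :
    slice (cMuPhi P u r) i = muPhi P (slice u i) (slice r i) := by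
  funext z
  have h2 : Reg L (k + 2) u := hu.mono (by omega)
  have e1 := slice_cLap h2 i
  have e2 := slice_cLap (cLap_reg hu) i
  have e3 := congrFun (slice_cDiv P.δ_pos h2 hr i) z
  rw [slice_cLap hu] at e2
  have e1 := congrFun e1 z
  have e2 := congrFun e2 z
  simp only [slice] at e1 e2 e3
  simp only [slice, cMuPhi, muPhi, e1, e2, e3, dDoubleWell]
  ring

/-- The centred version of `muRho`. -/
def cMuRho (P : Params) (u r : ι → ℝ × ℝ × ℝ → ℝ) : ι → ℝ × ℝ × ℝ → ℝ := fun i p =>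
  P.α * (r i p - cMod P.δ u i p) + -P.ξ * cLap r i p
    + P.β * (Real.log (r i p) - Real.log (1 - r i p))

theorem cMuRho_reg {L κ : ℝ} (P : Params) {k : ℕ} {u r : ι → ℝ × ℝ × ℝ → ℝ} (hu : Reg L (k + 1) u)
    (hr : Reg L (k + 2) r) (hκ : 0 < κ) (h0 : ∀ i p, κ ≤ r i p) (h1 : ∀ i p, r i p ≤ 1 - κ) :
    Reg L k (cMuRho P u r) := by
  have hr0 : Reg L k r := hr.mono (by omega)
  exact (((hr0.sub (cMod_reg P.δ_pos hu)).const_mul _).add ((cLap_reg hr).const_mul _)).add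
    (((hr0.log hκ h0).sub (((Reg.const k 1).sub hr0).log hκ fun i p => by
      linarith [h1 i p])).const_mul _)

theorem slice_cMuRho {L : ℝ} (P : Params) {k : ℕ} {u r : ι → ℝ × ℝ × ℝ → ℝ} (hu : Reg L (k + 1) u)
    (hr : Reg L (k + 2) r) (i : ι) :
    slice (cMuRho P u r) i = muRho P (slice u i) (slice r i) := by
  funext z
  have e1 := congrFun (slice_cLap hr i) z
  have e2 := congrFun (slice_cMod (δ := P.δ) hu i) z
  simp only [slice] at e1 e2
  simp only [slice, cMuRho, muRho, e1, e2, dEntropy]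
  ring

end Centred

/-! ## The discrete operators as restrictions of the centred operators -/

section GridRestriction

variable {ι : Type*} {L : ℝ} {K k : ℕ} {u r : ι → ℝ × ℝ × ℝ → ℝ}

open UnifC

theorem mesh_pos (hL : 0 < L) (K : ℕ) : 0 < mesh L K :=
  div_pos hL (Nat.cast_pos.2 (Nat.succ_pos _))

theorem mesh_mul (L : ℝ) (K : ℕ) : mesh L K * ((2 * K + 1 : ℕ) : ℝ) = L :=
  div_mul_cancel₀ _ (Nat.cast_ne_zero.2 (Nat.succ_ne_zero _))

/-- Restriction to the points `((i - 1/2 + a) h, (j - 1/2 + b) h)`. -/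
def gr (L : ℝ) (K : ℕ) (f : ℝ × ℝ × ℝ → ℝ) (a b : ℝ) : Grid (2 * K + 1) := fun i j =>
  f (mesh L K, ((i.val : ℝ) - 1 / 2 + a) * mesh L K, ((j.val : ℝ) - 1 / 2 + b) * mesh L K)

/-- At the last index the cyclic successor drops to `0`, a displacement by exactly one period of the
grid, which `L`-periodicity undoes. -/
theorem val_add_one (i : ZMod (2 * K + 1)) :
    (((i + 1).val : ℕ) : ℝ) = (i.val : ℝ) + 1
      ∨ (((i + 1).val : ℕ) : ℝ) = (i.val : ℝ) + 1 - ((2 * K + 1 : ℕ) : ℝ) := by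
  have h1 : (i + 1).val = (i.val + 1) % (2 * K + 1) := by
    rw [ZMod.val_add, ZMod.val_one_eq_one_mod, Nat.add_mod_mod]
  have h2 := ZMod.val_lt i
  rcases Nat.lt_or_ge (i.val + 1) (2 * K + 1) with h3 | h3
  · left
    rw [h1, Nat.mod_eq_of_lt h3]
    push_cast
    ring
  · right
    have h4 : i.val + 1 = 2 * K + 1 := by omega
    have h5 : (i + 1).val = 0 := by rw [h1, h4, Nat.mod_self]
    have h6 : (i.val : ℝ) + 1 = ((2 * K + 1 : ℕ) : ℝ) := by exact_mod_cast h4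
    rw [h5, h6, sub_self, Nat.cast_zero]

theorem gr_add_one_x {f : ℝ × ℝ × ℝ → ℝ} (hf : ∀ p, f (p + L • ex) = f p) (a b : ℝ)
    (i j : ZMod (2 * K + 1)) : gr L K f a b (i + 1) j = gr L K f (a + 1) b i j := by
  have hm := mesh_mul L K
  rcases val_add_one i with h1 | h1
  · simp only [gr, h1]
    congr 3
    ring
  · simp only [gr, h1]
    rw [← hf]
    congr 1
    simp only [ex, Prod.smul_mk, smul_eq_mul, mul_zero, mul_one, Prod.mk_add_mk, add_zero,
      Prod.mk.injEq, true_and, and_true]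
    linear_combination -hm

theorem gr_add_one_y {f : ℝ × ℝ × ℝ → ℝ} (hf : ∀ p, f (p + L • ey) = f p) (a b : ℝ)
    (i j : ZMod (2 * K + 1)) : gr L K f a b i (j + 1) = gr L K f a (b + 1) i j := by
  have hm := mesh_mul L K
  rcases val_add_one j with h1 | h1
  · simp only [gr, h1]
    congr 3
    ring
  · simp only [gr, h1]
    rw [← hf]
    congr 1
    simp only [ey, Prod.smul_mk, smul_eq_mul, mul_zero, mul_one, Prod.mk_add_mk, add_zero,
      Prod.mk.injEq, true_and]
    linear_combination -hm

theorem gr_sub_one_x {f : ℝ × ℝ × ℝ → ℝ} (hf : ∀ p, f (p + L • ex) = f p) (a b : ℝ)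
    (i j : ZMod (2 * K + 1)) : gr L K f a b (i - 1) j = gr L K f (a - 1) b i j := by
  have := gr_add_one_x hf (a - 1) b (i - 1) j
  rw [sub_add_cancel, sub_add_cancel] at this
  exact this.symm

theorem gr_sub_one_y {f : ℝ × ℝ × ℝ → ℝ} (hf : ∀ p, f (p + L • ey) = f p) (a b : ℝ)
    (i j : ZMod (2 * K + 1)) : gr L K f a b i (j - 1) = gr L K f a (b - 1) i j := by
  have := gr_add_one_y hf a (b - 1) i (j - 1)
  rw [sub_add_cancel, sub_add_cancel] at this
  exact this.symm

theorem Reg.cD_eq_x (hL : 0 < L) (hu : Reg L (k + 1) u) (i : ι) (x y : ℝ) :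
    cD ex u i (mesh L K, x, y)
      = (u i (mesh L K, x + mesh L K / 2, y) - u i (mesh L K, x - mesh L K / 2, y)) / mesh L K := by
  rw [eq_div_iff (mesh_pos hL K).ne', mul_comm]
  have := hu.mul_cD ex i (mesh L K, x, y)
  simp only [shear_apply, ex, Prod.smul_mk, smul_eq_mul, mul_zero, mul_one, Prod.mk_add_mk,
    add_zero] at this
  simp only [ex]
  rw [this]
  congr 4 <;> ring

theorem Reg.cD_eq_y (hL : 0 < L) (hu : Reg L (k + 1) u) (i : ι) (x y : ℝ) :
    cD ey u i (mesh L K, x, y)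
      = (u i (mesh L K, x, y + mesh L K / 2) - u i (mesh L K, x, y - mesh L K / 2)) / mesh L K := by
  rw [eq_div_iff (mesh_pos hL K).ne', mul_comm]
  have := hu.mul_cD ey i (mesh L K, x, y)
  simp only [shear_apply, ey, Prod.smul_mk, smul_eq_mul, mul_zero, mul_one, Prod.mk_add_mk,
    add_zero] at this
  simp only [ey]
  rw [this]
  congr 4 <;> ring

theorem Dx_gr (hL : 0 < L) (hu : Reg L (k + 1) u) (i : ι) :
    Dx (mesh L K) (gr L K (u i) 0 0) = gr L K (cD ex u i) (1 / 2) 0 := by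
  funext a b
  rw [Dx, gr_add_one_x (hu.perx i)]
  simp only [gr, hu.cD_eq_x hL]
  congr 6 <;> ring

theorem Dy_gr (hL : 0 < L) (hu : Reg L (k + 1) u) (i : ι) :
    Dy (mesh L K) (gr L K (u i) 0 0) = gr L K (cD ey u i) 0 (1 / 2) := by
  funext a b
  rw [Dy, gr_add_one_y (hu.pery i)]
  simp only [gr, hu.cD_eq_y hL]
  congr 6 <;> ring

theorem dx_gr (hL : 0 < L) (hu : Reg L (k + 1) u) (i : ι) :
    dx (mesh L K) (gr L K (u i) (1 / 2) 0) = gr L K (cD ex u i) 0 0 := by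
  funext a b
  rw [dx, gr_sub_one_x (hu.perx i)]
  simp only [gr, hu.cD_eq_x hL]
  congr 6 <;> ring

theorem dy_gr (hL : 0 < L) (hu : Reg L (k + 1) u) (i : ι) :
    dy (mesh L K) (gr L K (u i) 0 (1 / 2)) = gr L K (cD ey u i) 0 0 := by
  funext a b
  rw [dy, gr_sub_one_y (hu.pery i)]
  simp only [gr, hu.cD_eq_y hL]
  congr 6 <;> ring

theorem cA_eq_x (u : ι → ℝ × ℝ × ℝ → ℝ) (i : ι) (h x y : ℝ) :
    cA ex u i (h, x, y) = (u i (h, x + h / 2, y) + u i (h, x - h / 2, y)) / 2 := by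
  simp only [cA, shear_apply, ex, Prod.smul_mk, smul_eq_mul, mul_zero, mul_one, Prod.mk_add_mk,
    add_zero]
  rw [one_div_mul_eq_div]
  congr 5 <;> ring

theorem cA_eq_y (u : ι → ℝ × ℝ × ℝ → ℝ) (i : ι) (h x y : ℝ) :
    cA ey u i (h, x, y) = (u i (h, x, y + h / 2) + u i (h, x, y - h / 2)) / 2 := by
  simp only [cA, shear_apply, ey, Prod.smul_mk, smul_eq_mul, mul_zero, mul_one, Prod.mk_add_mk,
    add_zero]
  rw [one_div_mul_eq_div]
  congr 5 <;> ring

theorem Ax_gr (hu : Reg L k u) (i : ι) : Ax (gr L K (u i) 0 0) = gr L K (cA ex u i) (1 / 2) 0 := by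
  funext a b
  rw [Ax, gr_add_one_x (hu.perx i)]
  simp only [gr, cA_eq_x]
  congr 6 <;> ring

theorem Ay_gr (hu : Reg L k u) (i : ι) : Ay (gr L K (u i) 0 0) = gr L K (cA ey u i) 0 (1 / 2) := by
  funext a b
  rw [Ay, gr_add_one_y (hu.pery i)]
  simp only [gr, cA_eq_y]
  congr 6 <;> ring

theorem lapH_gr (hL : 0 < L) (hu : Reg L (k + 2) u) (i : ι) :
    lapH (mesh L K) (gr L K (u i) 0 0) = gr L K (cLap u i) 0 0 := by
  rw [lapH, Dx_gr hL hu, Dy_gr hL hu, dx_gr hL (Reg.cD_reg rfl hu), dy_gr hL (Reg.cD_reg rfl hu)]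
  rfl

theorem modGradH_gr (hL : 0 < L) {δ : ℝ} (hu : Reg L (k + 1) u) (i : ι) :
    modGradH (mesh L K) δ (gr L K (u i) 0 0) = gr L K (cMod δ u i) 0 0 := by
  funext a b
  have h1 := (Reg.cD_reg (a := ex) rfl hu).perx i
  have h2 := (Reg.cD_reg (a := ey) rfl hu).pery i
  rw [modGradH, Dx_gr hL hu, Dy_gr hL hu, gr_sub_one_x h1, gr_sub_one_y h2]
  simp only [gr, cMod, cA_eq_x, cA_eq_y]
  congr 1
  ring_nf

theorem divNonlin_gr (hL : 0 < L) {δ : ℝ} (hδ : 0 < δ) (hu : Reg L (k + 2) u) (hr : Reg L (k + 1) r)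
    (i : ι) : divNonlin (mesh L K) δ (gr L K (u i) 0 0) (gr L K (r i) 0 0)
      = gr L K (cDiv δ u r i) 0 0 := by
  have hq := Reg.div hδ (le_cMod δ u) hr (cMod_reg hδ hu)
  have e : gr L K (r i) 0 0 / gr L K (cMod δ u i) 0 0
      = gr L K ((fun i p => r i p / cMod δ u i p : ι → ℝ × ℝ × ℝ → ℝ) i) 0 0 := rfl
  have hx := dx_gr (K := K) hL (cFlux_reg hδ hu hr (a := ex) rfl) i
  have hy := dy_gr (K := K) hL (cFlux_reg hδ hu hr (a := ey) rfl) i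
  rw [divNonlin, modGradH_gr hL hu, Dx_gr hL hu, Dy_gr hL hu, e, Ax_gr hq, Ay_gr hq]
  exact congrArg₂ (· + ·) hx hy

/-- With equal old and new arguments the stabilising terms `α/δ Δ_h` cancel, so the implicit
discrete potential is the centred version of `muPhi`. -/
theorem muPhiH_gr (P : Params) (hL : 0 < L) (hu : Reg L (k + 4) u) (hr : Reg L (k + 1) r) (i : ι) :
    muPhiH P (mesh L K) (gr L K (u i) 0 0) (gr L K (u i) 0 0) (gr L K (r i) 0 0)
      = gr L K (cMuPhi P u r i) 0 0 := by
  have h2 : Reg L (k + 2) u := hu.mono (by omega)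
  funext a b
  simp only [muPhiH]
  rw [lapH_gr hL h2, lapH_gr hL (cLap_reg hu), divNonlin_gr hL P.δ_pos h2 hr]
  simp only [gr, cMuPhi]
  ring

/-- Here `√2 α` and `α (√2 - 1)` combine to `α`. -/
theorem muRhoH_gr (P : Params) (hL : 0 < L) (hu : Reg L (k + 1) u) (hr : Reg L (k + 2) r) (i : ι) :
    muRhoH P (mesh L K) (gr L K (r i) 0 0) (gr L K (u i) 0 0) (gr L K (r i) 0 0)
      = gr L K (cMuRho P u r i) 0 0 := by
  funext a b
  simp only [muRhoH]
  rw [lapH_gr hL hr, modGradH_gr hL hu]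
  simp only [gr, cMuRho, dEntropy]
  ring

end GridRestriction

/-! ## Consistency in space -/

section Consistency

variable {ι : Type*}

theorem UnifC.of_iteratedFDeriv : ∀ {k : ℕ} {u : ι → ℝ × ℝ × ℝ → ℝ} {B : ℝ},
    (∀ i, ContDiff ℝ k (u i)) → (∀ i, ∀ m ≤ k, ∀ p, ‖iteratedFDeriv ℝ m (u i) p‖ ≤ B) →
    UnifC k u := by
  intro k
  have hb : ∀ {k : ℕ} {u : ι → ℝ × ℝ × ℝ → ℝ} {B : ℝ},
      (∀ i, ∀ m ≤ k, ∀ p, ‖iteratedFDeriv ℝ m (u i) p‖ ≤ B) → ∃ B : ℝ, ∀ i p, |u i p| ≤ B :=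
    fun {k u B} hB => ⟨B, fun i p => by simpa using hB i 0 (Nat.zero_le _) p⟩
  induction k with
  | zero => exact fun hu hB => ⟨fun i => (hu i).continuous, hb hB⟩
  | succ k ih =>
    intro u B hu hB
    refine ⟨fun i => (hu i).of_le (by exact_mod_cast Nat.le_add_left 1 k), hb hB, fun v => ?_⟩
    have hd : ∀ i, ContDiff ℝ k (fderiv ℝ (u i)) := fun i =>
      (hu i).fderiv_right (m := k) (by exact_mod_cast le_rfl)
    refine ih (B := ‖v‖ * B) (fun i => (hd i).clm_apply contDiff_const) fun i m hm p => ?_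
    have h1 := norm_iteratedFDeriv_clm_apply_const (c := v) (x := p) (n := m)
      ((hd i).contDiffAt.of_le (m := m) (by exact_mod_cast hm)) le_rfl
    refine h1.trans (mul_le_mul_of_nonneg_left ?_ (norm_nonneg v))
    rw [norm_iteratedFDeriv_fderiv]
    exact hB i (m + 1) (by omega) p

theorem UnifC.of_plane {k : ℕ} {v : ι → ℝ × ℝ → ℝ} {B : ℝ} (hv : ∀ i, ContDiff ℝ k (v i))
    (hB : ∀ i, ∀ m ≤ k, ∀ p, ‖iteratedFDeriv ℝ m (v i) p‖ ≤ B) :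
    UnifC k fun i p => v i p.2 := by
  let S := ContinuousLinearMap.snd ℝ ℝ (ℝ × ℝ)
  refine UnifC.of_iteratedFDeriv (B := B) (fun i => (hv i).comp contDiff_snd) fun i m hm p => ?_
  have h1 : iteratedFDeriv ℝ m (v i ∘ S) p
      = (iteratedFDeriv ℝ m (v i) (S p)).compContinuousLinearMap fun _ => S :=
    S.iteratedFDeriv_comp_right (hv i) p (by exact_mod_cast hm)
  change ‖iteratedFDeriv ℝ m (v i ∘ S) p‖ ≤ B
  rw [h1]
  refine (ContinuousMultilinearMap.norm_compContinuousLinearMap_le _ _).trans ?_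
  have h2 : ∏ _ : Fin m, ‖S‖ ≤ 1 := by
    rw [Finset.prod_const]
    exact pow_le_one₀ (norm_nonneg _) (ContinuousLinearMap.norm_snd_le ℝ ℝ (ℝ × ℝ))
  calc _ ≤ ‖iteratedFDeriv ℝ m (v i) (S p)‖ * 1 := mul_le_mul_of_nonneg_left h2 (norm_nonneg _)
    _ ≤ B := by rw [mul_one]; exact hB i m hm _

/-- Sine and cosine are treated together because each is the derivative of the other up to sign. -/
theorem UnifC.sin_cos (b : ℝ) (k : ℕ) : UnifC k (fun (_ : ι) p => Real.sin (b * p.1))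
    ∧ UnifC k (fun (_ : ι) p => Real.cos (b * p.1)) := by
  have hl : ∀ p : ℝ × ℝ × ℝ, HasFDerivAt (fun p : ℝ × ℝ × ℝ => b * p.1)
      (b • ContinuousLinearMap.fst ℝ ℝ (ℝ × ℝ)) p := fun p => hasFDerivAt_fst.const_mul b
  have hbs : ∃ B : ℝ, ∀ (_ : ι) (p : ℝ × ℝ × ℝ), |Real.sin (b * p.1)| ≤ B :=
    ⟨1, fun _ _ => Real.abs_sin_le_one _⟩
  have hbc : ∃ B : ℝ, ∀ (_ : ι) (p : ℝ × ℝ × ℝ), |Real.cos (b * p.1)| ≤ B :=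
    ⟨1, fun _ _ => Real.abs_cos_le_one _⟩
  induction k with
  | zero => exact ⟨⟨fun _ => by fun_prop, hbs⟩, ⟨fun _ => by fun_prop, hbc⟩⟩
  | succ k ih =>
    refine ⟨⟨fun _ => by fun_prop, hbs, fun v => ?_⟩, ⟨fun _ => by fun_prop, hbc, fun v => ?_⟩⟩
    · have e : (fun (_ : ι) p => fderiv ℝ (fun p : ℝ × ℝ × ℝ => Real.sin (b * p.1)) p v)
          = fun (_ : ι) p => (b * v.1) * Real.cos (b * p.1) := by
        funext _ p
        rw [(hl p).sin.fderiv]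
        simp
        ring
      rw [e]
      exact ih.2.const_mul _
    · have e : (fun (_ : ι) p => fderiv ℝ (fun p : ℝ × ℝ × ℝ => Real.cos (b * p.1)) p v)
          = fun (_ : ι) p => -(b * v.1) * Real.sin (b * p.1) := by
        funext _ p
        rw [(hl p).cos.fderiv]
        simp
        ring
      rw [e]
      exact ih.1.const_mul _

/-- The function `v`, shifted by the small even function `γ sin² (b h)`. -/
def shifted (b : ℝ) (v : ι → ℝ × ℝ → ℝ) (γ : ι → ℝ) : ι → ℝ × ℝ × ℝ → ℝ := fun i p =>
  v i p.2 + γ i * (Real.sin (b * p.1) * Real.sin (b * p.1))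

/-- `sin² (b h)` stands in for `h²`: it is even and comparable to `h²` for small `h`, but bounded
with all its derivatives on the whole line, as `UnifC` demands. -/
theorem shifted_reg {L κ : ℝ} {k : ℕ} (b : ℝ) {v : ι → ℝ × ℝ → ℝ} {γ : ι → ℝ}
    (hv : UnifC k fun i p => v i p.2) (hx : ∀ i x y, v i (x + L, y) = v i (x, y))
    (hy : ∀ i x y, v i (x, y + L) = v i (x, y)) (hγ : ∀ i, |γ i| ≤ κ) :
    Reg L k (shifted b v γ) := by
  have hs := (UnifC.sin_cos (ι := ι) b k).1
  refine ⟨hv.add ((UnifC.const k γ κ hγ).mul (hs.mul hs)), fun i h z => ?_, fun i p => ?_,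
    fun i p => ?_⟩
  · simp [shifted]
  · obtain ⟨h, x, y⟩ := p
    simp [shifted, ex, hx i x y]
  · obtain ⟨h, x, y⟩ := p
    simp [shifted, ey, hy i x y]

/-- Values at the cell centres. -/
def gridOf (L : ℝ) (K : ℕ) (v : ℝ × ℝ → ℝ) : Grid (2 * K + 1) := fun i j =>
  v (((i.val : ℝ) - 1 / 2) * mesh L K, ((j.val : ℝ) - 1 / 2) * mesh L K)

theorem gr_shifted (L b : ℝ) (K : ℕ) (v : ι → ℝ × ℝ → ℝ) (γ : ι → ℝ) (i : ι) :
    gr L K (shifted b v γ i) 0 0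
      = fun a c => gridOf L K (v i) a c + γ i * Real.sin (b * mesh L K) ^ 2 := by
  funext a c
  simp only [gr, shifted, gridOf, add_zero, sq]

theorem consistency_space (P : Params) {L κ : ℝ} (hL : 0 < L) (hκ : 0 < κ) (b : ℝ)
    {v r : ι → ℝ × ℝ → ℝ} (hv : UnifC 8 fun i p => v i p.2) (hr : UnifC 6 fun i p => r i p.2)
    (hvx : ∀ i x y, v i (x + L, y) = v i (x, y)) (hvy : ∀ i x y, v i (x, y + L) = v i (x, y))
    (hrx : ∀ i x y, r i (x + L, y) = r i (x, y)) (hry : ∀ i x y, r i (x, y + L) = r i (x, y))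
    (h0 : ∀ i z, 2 * κ ≤ r i z) (h1 : ∀ i z, r i z ≤ 1 - 2 * κ) :
    ∃ C : ℝ, 0 ≤ C ∧ ∀ i (c d : ℝ), |c| ≤ κ → |d| ≤ κ → ∀ (K : ℕ) (U R : Grid (2 * K + 1)),
      U = (fun a e => gridOf L K (v i) a e + c * Real.sin (b * mesh L K) ^ 2) →
      R = (fun a e => gridOf L K (r i) a e + d * Real.sin (b * mesh L K) ^ 2) →
      ∀ a e, |gridOf L K (fun z => P.M * laplace (muPhi P (v i) (r i)) z) a e
            - P.M * lapH (mesh L K) (muPhiH P (mesh L K) U U R) a e| ≤ C * mesh L K ^ 2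
        ∧ |gridOf L K (fun z => P.M * laplace (muRho P (v i) (r i)) z) a e
            - P.M * lapH (mesh L K) (muRhoH P (mesh L K) R U R) a e| ≤ C * mesh L K ^ 2 := by
  -- Enlarging the index set by the two shifts makes the constant uniform in them.
  let J := ι × {c : ℝ // |c| ≤ κ} × {c : ℝ // |c| ≤ κ}
  have comp : ∀ {k : ℕ} {w : ι → ℝ × ℝ × ℝ → ℝ}, UnifC k w → UnifC k fun (i : J) => w i.1 := by
    intro k
    induction k with
    | zero => exact fun hw => ⟨fun i => hw.1 i.1, hw.2.imp fun B hB i => hB i.1⟩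
    | succ k ih =>
      exact fun hw => ⟨fun i => hw.1 i.1, hw.bdd.imp fun B hB i => hB i.1, fun v => ih (hw.2.2 v)⟩
  have hU : Reg L 8 (shifted b (fun i : J => v i.1) fun i => i.2.1.1) :=
    shifted_reg b (comp hv) (fun i => hvx i.1) (fun i => hvy i.1) fun i => i.2.1.2
  have hR : Reg L 6 (shifted b (fun i : J => r i.1) fun i => i.2.2.1) :=
    shifted_reg b (comp hr) (fun i => hrx i.1) (fun i => hry i.1) fun i => i.2.2.2
  set u := shifted b (fun i : J => v i.1) fun i => i.2.1.1 with hu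
  set s := shifted b (fun i : J => r i.1) fun i => i.2.2.1 with hs
  have hsin : ∀ (c : ℝ) (x : ℝ), |c| ≤ κ → |c * (Real.sin x * Real.sin x)| ≤ κ := by
    intro c x hc
    rw [abs_mul, ← sq, abs_of_nonneg (sq_nonneg (Real.sin x))]
    nlinarith [abs_nonneg c, Real.sin_sq_le_one x]
  -- The shift uses at most half of the margin `2 κ`, so the logarithms stay uniformly smooth.
  have hs0 : ∀ i p, κ ≤ s i p := fun i p => by
    have h3 := abs_le.1 (hsin i.2.2.1 (b * p.1) i.2.2.2)
    have h4 := h0 i.1 p.2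
    simp only [hs, shifted]
    linarith [h3.1]
  have hs1 : ∀ i p, s i p ≤ 1 - κ := fun i p => by
    have h3 := abs_le.1 (hsin i.2.2.1 (b * p.1) i.2.2.2)
    have h4 := h1 i.1 p.2
    simp only [hs, shifted]
    linarith [h3.2]
  have su : ∀ i, slice u i = v i.1 := fun i => by
    funext z
    simp [slice, hu, shifted]
  have ss : ∀ i, slice s i = r i.1 := fun i => by
    funext z
    simp [slice, hs, shifted]
  -- Four derivatives remain: two for the outer Laplacian and two for the `O(h²)` bound of even
  -- functions.
  have rphi : Reg L 4 (cMuPhi P u s) := cMuPhi_reg P hU (hR.mono (by norm_num))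
  have rrho : Reg L 4 (cMuRho P u s) := cMuRho_reg P (hU.mono (by norm_num)) hR hκ hs0 hs1
  obtain ⟨C₁, hC₁, H₁⟩ := ((cLap_reg rphi).const_mul P.M).abs_sub_le
  obtain ⟨C₂, hC₂, H₂⟩ := ((cLap_reg rrho).const_mul P.M).abs_sub_le
  refine ⟨max C₁ C₂, le_max_of_le_left hC₁, fun i c d hc hd K U R eU eR a e => ?_⟩
  let i' : J := (i, ⟨c, hc⟩, ⟨d, hd⟩)
  have eU' : U = gr L K (u i') 0 0 := by rw [eU, hu, gr_shifted]
  have eR' : R = gr L K (s i') 0 0 := by rw [eR, hs, gr_shifted]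
  have hh : 0 ≤ mesh L K ^ 2 := sq_nonneg _
  have z₁ := slice_cLap rphi i'
  have z₂ := slice_cLap rrho i'
  rw [slice_cMuPhi P hU (hR.mono (by norm_num)), su, ss] at z₁
  rw [slice_cMuRho P (k := 4) (hU.mono (by norm_num)) hR, su, ss] at z₂
  rw [eU', eR', muPhiH_gr P hL (k := 4) hU (hR.mono (by norm_num)),
    muRhoH_gr P hL (k := 4) (hU.mono (by norm_num)) hR, lapH_gr hL rphi, lapH_gr hL rrho]
  set z : ℝ × ℝ := (((a.val : ℝ) - 1 / 2) * mesh L K, ((e.val : ℝ) - 1 / 2) * mesh L K) with hz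
  have w₁ := congrFun z₁ z
  have w₂ := congrFun z₂ z
  have b₁ := H₁ i' (mesh L K) z
  have b₂ := H₂ i' (mesh L K) z
  simp only [slice] at w₁ w₂
  simp only [w₁] at b₁
  simp only [w₂] at b₂
  simp only [gridOf, gr, add_zero]
  rw [abs_sub_comm] at b₁ b₂
  exact ⟨b₁.trans (mul_le_mul_of_nonneg_right (le_max_left _ _) hh),
    b₂.trans (mul_le_mul_of_nonneg_right (le_max_right _ _) hh)⟩

end Consistency

/-! ## Regularity in time -/

section Time

open Set

variable {T : ℝ}

theorem intervalIntegrable_of_Ioo {f : ℝ → ℝ} (hf : IntegrableOn f (Ioo 0 T)) {s t : ℝ} (hs : 0 ≤ s)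
    (hst : s ≤ t) (ht : t ≤ T) : IntervalIntegrable f volume s t := by
  rw [intervalIntegrable_iff_integrableOn_Ioo_of_le hst]
  exact hf.mono_set (Ioo_subset_Ioo hs ht)

theorem setIntegral_Ioo_eq (hT : 0 ≤ T) (f : ℝ → ℝ) : ∫ t in Ioo 0 T, f t = ∫ t in (0 : ℝ)..T, f t := by
  rw [intervalIntegral.integral_of_le hT, integral_Ioc_eq_integral_Ioo]

theorem integrableOn_mul_of_continuous {f θ : ℝ → ℝ} (hf : IntegrableOn f (Ioo 0 T))
    (hθ : Continuous θ) : IntegrableOn (fun t => θ t * f t) (Ioo 0 T) := by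
  obtain ⟨C, hC⟩ := (isCompact_Icc (a := (0 : ℝ)) (b := T)).exists_bound_of_continuousOn
    hθ.continuousOn
  exact Integrable.bdd_mul hf hθ.aestronglyMeasurable
    ((ae_restrict_iff' measurableSet_Ioo).2 (Filter.Eventually.of_forall fun t ht =>
      hC t (Ioo_subset_Icc_self ht)))

/-- A test function on `(0, T)`. -/
def IsTest (T : ℝ) (θ : ℝ → ℝ) : Prop :=
  ContDiff ℝ (⊤ : ℕ∞) θ ∧ HasCompactSupport θ ∧ tsupport θ ⊆ Ioo 0 T

theorem IsTest.eq_zero {θ : ℝ → ℝ} (hθ : IsTest T θ) {t : ℝ} (ht : t ∉ Ioo 0 T) : θ t = 0 :=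
  image_eq_zero_of_notMem_tsupport fun h => ht (hθ.2.2 h)

/-- Integration by parts for absolutely continuous functions; the boundary terms vanish with the
test function. -/
theorem weakDeriv_primitive (hT : 0 < T) {v θ : ℝ → ℝ} (hv : IntegrableOn v (Ioo 0 T))
    (hθ : IsTest T θ) :
    ∫ t in Ioo 0 T, deriv θ t * ∫ s in (0 : ℝ)..t, v s = -∫ t in Ioo 0 T, θ t * v t := by
  have hvi := intervalIntegrable_of_Ioo hv le_rfl hT.le le_rfl
  have hac := hvi.absolutelyContinuousOnInterval_intervalIntegral (c := 0) left_mem_uIcc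
  have hθ1 : ContDiff ℝ 1 θ := hθ.1.of_le (by exact_mod_cast le_top)
  have hθac : AbsolutelyContinuousOnInterval θ 0 T := hθ1.contDiffOn.absolutelyContinuousOnInterval
  have h1 := AbsolutelyContinuousOnInterval.integral_mul_deriv_eq_deriv_mul hθac hac
  rw [hθ.eq_zero (t := 0) (by simp), hθ.eq_zero (t := T) (by simp)] at h1
  have h2 : ∫ x in (0 : ℝ)..T, θ x * deriv (fun x => ∫ s in (0 : ℝ)..x, v s) x
      = ∫ x in (0 : ℝ)..T, θ x * v x := by
    refine intervalIntegral.integral_congr_ae ?_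
    filter_upwards [hvi.ae_hasDerivAt_integral] with x hx hx'
    rw [(hx (uIoc_subset_uIcc hx') 0 left_mem_uIcc).deriv]
  rw [setIntegral_Ioo_eq hT.le, setIntegral_Ioo_eq hT.le, ← h2, h1]
  ring

/-- Integral zero makes the primitive vanish again to the right of the support, so it is itself a
test function. -/
theorem exists_test_primitive (hT : 0 < T) {η : ℝ → ℝ} (hη : IsTest T η)
    (h0 : ∫ t in Ioo 0 T, η t = 0) : ∃ H : ℝ → ℝ, IsTest T H ∧ deriv H = η := by
  have hc : Continuous η := hη.1.continuous
  have hd : ∀ t, HasDerivAt (fun t => ∫ s in (0 : ℝ)..t, η s) (η t) t := fun t =>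
    intervalIntegral.integral_hasDerivAt_right (hc.intervalIntegrable _ _)
      (hc.stronglyMeasurableAtFilter _ _) hc.continuousAt
  have hderiv : deriv (fun t => ∫ s in (0 : ℝ)..t, η s) = η := funext fun t => (hd t).deriv
  obtain ⟨a, b, ha, hb, hab⟩ : ∃ a b, 0 < a ∧ b < T ∧ tsupport η ⊆ Icc a b := by
    rcases (tsupport η).eq_empty_or_nonempty with he | hne
    · exact ⟨T, 0, hT, hT, by rw [he]; exact empty_subset _⟩
    · have hK : IsCompact (tsupport η) := hη.2.1
      exact ⟨sInf (tsupport η), sSup (tsupport η), (hη.2.2 (hK.sInf_mem hne)).1,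
        (hη.2.2 (hK.sSup_mem hne)).2, fun t ht =>
          ⟨csInf_le hK.bddBelow ht, le_csSup hK.bddAbove ht⟩⟩
  have hz : ∀ t, t ∉ Icc a b → η t = 0 := fun t ht =>
    image_eq_zero_of_notMem_tsupport fun h => ht (hab h)
  have hsupp : tsupport (fun t => ∫ s in (0 : ℝ)..t, η s) ⊆ Icc a b := by
    refine closure_minimal (fun t ht => ?_) isClosed_Icc
    by_contra hn
    refine ht ?_
    rw [mem_Icc, not_and_or, not_le, not_le] at hn
    rcases hn with hn | hn
    · refine intervalIntegral.integral_zero_ae (Filter.Eventually.of_forall fun s hs => ?_)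
      refine hz s fun h => ?_
      have := (uIoc_subset_uIcc hs).2
      have h2 : max 0 t < a := max_lt ha hn
      linarith [h.1]
    · have e : ∫ s in (0 : ℝ)..t, η s = (∫ s in (0 : ℝ)..T, η s) + ∫ s in T..t, η s :=
        (intervalIntegral.integral_add_adjacent_intervals (hc.intervalIntegrable _ _)
          (hc.intervalIntegrable _ _)).symm
      have e2 : ∫ s in T..t, η s = 0 := by
        refine intervalIntegral.integral_zero_ae (Filter.Eventually.of_forall fun s hs => ?_)
        refine hz s fun h => ?_
        have := (uIoc_subset_uIcc hs).1
        have h2 : b < min T t := lt_min hb hn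
        linarith [h.2]
      change ∫ s in (0 : ℝ)..t, η s = 0
      rw [e, e2, ← setIntegral_Ioo_eq hT.le, h0, add_zero]
  refine ⟨_, ⟨?_, ?_, ?_⟩, hderiv⟩
  · exact contDiff_infty_iff_deriv.2 ⟨fun t => (hd t).differentiableAt, by rw [hderiv]; exact hη.1⟩
  · exact isCompact_Icc.of_isClosed_subset (isClosed_tsupport _) hsupp
  · exact fun t ht => ⟨ha.trans_le (hsupp ht).1, (hsupp ht).2.trans_lt hb⟩

/-- The lemma of du Bois-Reymond. -/
theorem ae_const_of_weakDeriv_zero (hT : 0 < T) {g : ℝ → ℝ} (hg : IntegrableOn g (Ioo 0 T))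
    (h : ∀ θ, IsTest T θ → ∫ t in Ioo 0 T, deriv θ t * g t = 0) :
    ∃ c, ∀ᵐ t ∂(volume.restrict (Ioo 0 T)), g t = c := by
  obtain ⟨θ₀, hθ₀, hI⟩ : ∃ θ₀, IsTest T θ₀ ∧ ∫ t in Ioo 0 T, θ₀ t = 1 := by
    let f : ContDiffBump (T / 2) := ⟨T / 8, T / 4, by linarith, by linarith⟩
    have hs : tsupport (f.normed volume) ⊆ Ioo 0 T := by
      rw [f.tsupport_normed_eq, Real.closedBall_eq_Icc]
      intro t ht
      have h1 : T / 2 - T / 4 ≤ t := ht.1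
      have h2 : t ≤ T / 2 + T / 4 := ht.2
      exact ⟨by linarith, by linarith⟩
    refine ⟨f.normed volume, ⟨f.contDiff_normed, f.hasCompactSupport_normed, hs⟩, ?_⟩
    rw [setIntegral_eq_integral_of_forall_compl_eq_zero
      fun t ht => image_eq_zero_of_notMem_tsupport fun h => ht (hs h)]
    exact f.integral_normed
  set c := ∫ t in Ioo 0 T, θ₀ t * g t with hc
  refine ⟨c, ?_⟩
  have key : ∀ θ, IsTest T θ → ∫ t in Ioo 0 T, θ t * (g t - c) = 0 := by
    intro θ hθ
    set m := ∫ t in Ioo 0 T, θ t with hm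
    have hi : ∀ {θ : ℝ → ℝ}, IsTest T θ → IntegrableOn θ (Ioo 0 T) := fun hθ =>
      (hθ.1.continuous.integrable_of_hasCompactSupport hθ.2.1).integrableOn
    -- Removing the multiple of `θ₀` with the same integral leaves a derivative of a test function,
    -- to which the hypothesis applies.
    have htest : IsTest T fun t => θ t - m * θ₀ t := by
      refine ⟨hθ.1.sub (contDiff_const.mul hθ₀.1), hθ.2.1.sub hθ₀.2.1.mul_left, ?_⟩
      refine (tsupport_sub _ _).trans (union_subset hθ.2.2 ((closure_mono ?_).trans hθ₀.2.2))
      exact fun t ht => right_ne_zero_of_mul (Function.mem_support.1 ht)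
    obtain ⟨H, hH, hHd⟩ := exists_test_primitive hT htest (by
      rw [integral_sub (hi hθ) ((hi hθ₀).const_mul m), integral_const_mul, hI, ← hm]
      ring)
    have h1 := h H hH
    rw [hHd] at h1
    have i1 := integrableOn_mul_of_continuous hg hθ.1.continuous
    have i2 := integrableOn_mul_of_continuous hg hθ₀.1.continuous
    have e1 : ∀ t, (θ t - m * θ₀ t) * g t = θ t * g t - m * (θ₀ t * g t) := fun t => by ring
    simp only [e1] at h1
    rw [integral_sub i1 (i2.const_mul m), integral_const_mul, ← hc] at h1
    have e2 : ∀ t, θ t * (g t - c) = θ t * g t - c * θ t := fun t => by ring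
    simp only [e2]
    rw [integral_sub i1 ((hi hθ).const_mul c), integral_const_mul, ← hm]
    linarith
  have hgc : IntegrableOn (fun t => g t - c) (Ioo 0 T) :=
    hg.sub (integrableOn_const (by simp))
  have := isOpen_Ioo.ae_eq_zero_of_integral_contDiff_smul_eq_zero hgc.locallyIntegrableOn
    (fun θ h1 h2 h3 => by
      have := key θ ⟨h1, h2, h3⟩
      rw [setIntegral_eq_integral_of_forall_compl_eq_zero fun t ht => by
        rw [IsTest.eq_zero ⟨h1, h2, h3⟩ ht, zero_mul]] at this
      exact this)
  rw [ae_restrict_iff' measurableSet_Ioo]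
  filter_upwards [this] with t ht htT
  linarith [ht htT]

theorem ae_eq_primitive_of_weakDeriv (hT : 0 < T) {u v : ℝ → ℝ} (hu : IntegrableOn u (Ioo 0 T))
    (hv : IntegrableOn v (Ioo 0 T))
    (h : ∀ θ, IsTest T θ → ∫ t in Ioo 0 T, deriv θ t * u t = -∫ t in Ioo 0 T, θ t * v t) :
    ∃ c, ∀ᵐ t ∂(volume.restrict (Ioo 0 T)), u t = c + ∫ s in (0 : ℝ)..t, v s := by
  have hvi := intervalIntegrable_of_Ioo hv le_rfl hT.le le_rfl
  have hVc : ContinuousOn (fun t => ∫ s in (0 : ℝ)..t, v s) (Icc 0 T) := by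
    have := (hvi.absolutelyContinuousOnInterval_intervalIntegral (c := 0) left_mem_uIcc).continuousOn
    rwa [uIcc_of_le hT.le] at this
  have hVi : IntegrableOn (fun t => ∫ s in (0 : ℝ)..t, v s) (Ioo 0 T) :=
    (hVc.integrableOn_Icc).mono_set Ioo_subset_Icc_self
  obtain ⟨c, hc⟩ := ae_const_of_weakDeriv_zero hT (hu.sub hVi) (fun θ hθ => by
    have hdc : Continuous (deriv θ) := hθ.1.continuous_deriv (by exact_mod_cast le_top)
    simp only [Pi.sub_apply, mul_sub]
    rw [integral_sub (integrableOn_mul_of_continuous hu hdc) (integrableOn_mul_of_continuous hVi hdc),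
      h θ hθ, weakDeriv_primitive hT hv hθ, sub_self])
  refine ⟨c, ?_⟩
  filter_upwards [hc] with t ht
  simp only [Pi.sub_apply] at ht
  linarith

end Time

/-! ### Pointwise time derivatives from weak derivatives with values in `C(Torus L, ℝ)` -/

section Time

open Set

variable {T L : ℝ}

theorem memLp_eval [Fact (0 < L)] {v : ℝ → C(Torus L, ℝ)}
    (hv : MemLp v 2 (volume.restrict (Ioo 0 T))) : IntegrableOn v (Ioo 0 T) :=
  hv.integrable (by norm_num)

theorem HasWeakDeriv.eval [Fact (0 < L)] {u v : ℝ → C(Torus L, ℝ)} (h : HasWeakDeriv T u v)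
    (hu : IntegrableOn u (Ioo 0 T)) (hv : IntegrableOn v (Ioo 0 T)) (z : Torus L) {θ : ℝ → ℝ}
    (hθ : IsTest T θ) :
    ∫ t in Ioo 0 T, deriv θ t * u t z = -∫ t in Ioo 0 T, θ t * v t z := by
  let E : C(Torus L, ℝ) →L[ℝ] ℝ := ContinuousMap.evalCLM ℝ z
  have hsm : ∀ {f : ℝ → C(Torus L, ℝ)} {θ : ℝ → ℝ}, IntegrableOn f (Ioo 0 T) → Continuous θ →
      IntegrableOn (fun t => θ t • f t) (Ioo 0 T) := by
    intro f θ hf hθ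
    obtain ⟨C, hC⟩ := (isCompact_Icc (a := (0 : ℝ)) (b := T)).exists_bound_of_continuousOn
      hθ.continuousOn
    exact Integrable.bdd_smul hf C hθ.aestronglyMeasurable
      ((ae_restrict_iff' measurableSet_Ioo).2 (Filter.Eventually.of_forall fun t ht =>
        hC t (Ioo_subset_Icc_self ht)))
  have h1 := congrArg E (h θ hθ.1 hθ.2.1 hθ.2.2)
  have hdc : Continuous (deriv θ) := hθ.1.continuous_deriv (by exact_mod_cast le_top)
  rw [map_neg, ← E.integral_comp_comm (hsm hu hdc), ← E.integral_comp_comm (hsm hv hθ.1.continuous)] at h1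
  exact h1

/-- Functions of class `H²` in time have a pointwise time derivative that is absolutely continuous,
uniformly in space. -/
theorem time_regularity [Fact (0 < L)] (hT : 0 < T) {u : ℝ → C(Torus L, ℝ)}
    (hc : ContinuousOn u (Icc 0 T)) (h2 : MemH2 T u) :
    ∃ (V : Torus L → ℝ → ℝ) (b : ℝ → ℝ) (C : ℝ), MemLp b 2 (volume.restrict (Ioo 0 T)) ∧
      (∀ t, 0 ≤ b t) ∧ 0 ≤ C ∧ ∀ z, ContinuousOn (V z) (Icc 0 T) ∧ (∀ t ∈ Icc 0 T, |V z t| ≤ C) ∧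
        (∀ t ∈ Ioo 0 T, HasDerivAt (fun s => u s z) (V z t) t) ∧
        ∀ s t, 0 ≤ s → s ≤ t → t ≤ T → |V z t - V z s| ≤ ∫ τ in s..t, b τ := by
  obtain ⟨hu, v, w, hv, hw, huv, hvw⟩ := h2
  have iu := memLp_eval hu
  have iv := memLp_eval hv
  have iw := memLp_eval hw
  have hev : ∀ {f : ℝ → C(Torus L, ℝ)}, IntegrableOn f (Ioo 0 T) → ∀ z,
      IntegrableOn (fun t => f t z) (Ioo 0 T) := fun hf z =>
    (ContinuousMap.evalCLM ℝ z : C(Torus L, ℝ) →L[ℝ] ℝ).integrable_comp hf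
  choose c hcv using fun z => ae_eq_primitive_of_weakDeriv hT (hev iv z) (hev iw z)
    (fun θ hθ => hvw.eval iv iw z hθ)
  choose d hdu using fun z => ae_eq_primitive_of_weakDeriv hT (hev iu z) (hev iv z)
    (fun θ hθ => huv.eval iu iv z hθ)
  set V : Torus L → ℝ → ℝ := fun z t => c z + ∫ s in (0 : ℝ)..t, w s z with hV
  have hint : ∀ z {s t : ℝ}, 0 ≤ s → s ≤ t → t ≤ T → IntervalIntegrable (fun τ => w τ z) volume s t :=
    fun z {s t} => intervalIntegrable_of_Ioo (hev iw z)
  have hbint : ∀ {s t : ℝ}, 0 ≤ s → s ≤ t → t ≤ T → IntervalIntegrable (fun τ => ‖w τ‖) volume s t :=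
    fun {s t} => intervalIntegrable_of_Ioo iw.norm
  have hVc : ∀ z, ContinuousOn (V z) (Icc 0 T) := by
    intro z
    have := ((hint z le_rfl hT.le le_rfl).absolutelyContinuousOnInterval_intervalIntegral
      (c := 0) left_mem_uIcc).continuousOn
    rw [uIcc_of_le hT.le] at this
    exact continuousOn_const.add this
  have hVb : ∀ z s t, 0 ≤ s → s ≤ t → t ≤ T → |V z t - V z s| ≤ ∫ τ in s..t, ‖w τ‖ := by
    intro z s t hs hst ht
    have e : V z t - V z s = ∫ τ in s..t, w τ z := by
      simp only [hV]
      have := intervalIntegral.integral_add_adjacent_intervals (hint z le_rfl hs (hst.trans ht))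
        (hint z hs hst ht)
      linarith
    rw [e]
    refine (intervalIntegral.abs_integral_le_integral_abs hst).trans ?_
    refine intervalIntegral.integral_mono_on hst (hint z hs hst ht).abs (hbint hs hst ht)
      fun τ _ => ?_
    exact (w τ).norm_coe_le_norm z
  have huc : ∀ z, ContinuousOn (fun t => u t z) (Icc 0 T) := fun z =>
    (ContinuousMap.evalCLM ℝ z : C(Torus L, ℝ) →L[ℝ] ℝ).continuous.comp_continuousOn hc
  have hueq : ∀ z, EqOn (fun t => u t z) (fun t => d z + ∫ s in (0 : ℝ)..t, V z s) (Ioo 0 T) := by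
    intro z
    -- `v` and its continuous representative `V` agree almost everywhere for each fixed `z`. The
    -- null set may depend on `z`, as only integrals in time are compared.
    have h1 : ∀ t ∈ Ioo 0 T, ∫ s in (0 : ℝ)..t, v s z = ∫ s in (0 : ℝ)..t, V z s := by
      intro t ht
      refine intervalIntegral.integral_congr_ae_restrict ?_
      rw [uIoc_of_le ht.1.le]
      refine ae_restrict_of_ae_restrict_of_subset ?_ (hcv z)
      exact fun s hs => ⟨hs.1, hs.2.trans_lt ht.2⟩
    have hVi : IntervalIntegrable (V z) volume 0 T :=
      ((hVc z).mono (by rw [uIcc_of_le hT.le])).intervalIntegrable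
    have h2 : ContinuousOn (fun t => ∫ s in (0 : ℝ)..t, V z s) (Icc 0 T) := by
      have := (hVi.absolutelyContinuousOnInterval_intervalIntegral (c := 0) left_mem_uIcc).continuousOn
      rwa [uIcc_of_le hT.le] at this
    refine Measure.eqOn_Ioo_of_ae_eq (μ := volume) ?_ ((huc z).mono Ioo_subset_Icc_self)
      (continuousOn_const.add (h2.mono Ioo_subset_Icc_self))
    filter_upwards [hdu z, ae_restrict_mem measurableSet_Ioo] with t ht htT
    rw [ht, h1 t htT]
  have hder : ∀ z, ∀ t ∈ Ioo 0 T, HasDerivAt (fun s => u s z) (V z t) t := by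
    intro z t ht
    have hcont : ContinuousAt (V z) t := (hVc z).continuousAt (Icc_mem_nhds ht.1 ht.2)
    have h1 : HasDerivAt (fun t => ∫ s in (0 : ℝ)..t, V z s) (V z t) t := by
      refine intervalIntegral.integral_hasDerivAt_right
        (((hVc z).mono ?_).intervalIntegrable) ?_ hcont
      · rw [uIcc_of_le ht.1.le]
        exact Icc_subset_Icc le_rfl ht.2.le
      · exact ((hVc z).mono Ioo_subset_Icc_self).stronglyMeasurableAtFilter isOpen_Ioo t ht
    refine (h1.const_add (d z)).congr_of_eventuallyEq ?_
    filter_upwards [isOpen_Ioo.mem_nhds ht] with s hs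
    exact hueq z hs
  obtain ⟨B, hB⟩ := isCompact_Icc.exists_bound_of_continuousOn hc
  have hub : ∀ z, ∀ t ∈ Icc 0 T, |u t z| ≤ B := fun z t ht =>
    ((u t).norm_coe_le_norm z).trans (hB t ht)
  have hB0 : 0 ≤ B := (norm_nonneg _).trans (hB 0 ⟨le_rfl, hT.le⟩)
  have hI0 : 0 ≤ ∫ τ in (0 : ℝ)..T, ‖w τ‖ :=
    intervalIntegral.integral_nonneg hT.le fun _ _ => norm_nonneg _
  refine ⟨V, fun t => ‖w t‖, 2 * B / T + ∫ τ in (0 : ℝ)..T, ‖w τ‖, hw.norm,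
    fun _ => norm_nonneg _, by positivity,
    fun z => ⟨hVc z, fun t ht => ?_, hder z, hVb z⟩⟩
  -- The mean value theorem provides a time at which `V z` is at most `2 B / T`; the bound on its
  -- increments carries this to all times.
  obtain ⟨τ, hτ, hτe⟩ := exists_hasDerivAt_eq_slope (fun s => u s z) (V z) hT (huc z) (hder z)
  have h1 : |V z τ| ≤ 2 * B / T := by
    rw [hτe, sub_zero, abs_div, abs_of_pos hT]
    have a := abs_le.1 (hub z T ⟨hT.le, le_rfl⟩)
    have a' := abs_le.1 (hub z 0 ⟨le_rfl, hT.le⟩)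
    have : |u T z - u 0 z| ≤ 2 * B := abs_le.2 ⟨by linarith, by linarith⟩
    gcongr
  have hsub : ∀ s t, 0 ≤ s → s ≤ t → t ≤ T → ∫ τ in s..t, ‖w τ‖ ≤ ∫ τ in (0 : ℝ)..T, ‖w τ‖ := by
    intro s t hs hst ht
    refine intervalIntegral.integral_mono_interval hs hst ht
      (Filter.Eventually.of_forall fun _ => norm_nonneg _) (hbint le_rfl hT.le le_rfl)
  have h2 : |V z t - V z τ| ≤ ∫ τ in (0 : ℝ)..T, ‖w τ‖ := by
    rcases le_total τ t with hle | hle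
    · exact (hVb z τ t hτ.1.le hle ht.2).trans (hsub _ _ hτ.1.le hle ht.2)
    · rw [abs_sub_comm]
      exact (hVb z t τ ht.1 hle hτ.2.le).trans (hsub _ _ ht.1 hle hτ.2.le)
  have := abs_add_le (V z τ) (V z t - V z τ)
  rw [add_sub_cancel] at this
  linarith

/-- Cauchy–Schwarz, proved as nonnegativity of the variance of `b` about its average `m`. -/
theorem sq_integral_le {b : ℝ → ℝ} {s t : ℝ} (hst : s < t) (hb : IntervalIntegrable b volume s t)
    (hb2 : IntervalIntegrable (fun τ => b τ ^ 2) volume s t) :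
    (∫ τ in s..t, b τ) ^ 2 ≤ (t - s) * ∫ τ in s..t, b τ ^ 2 := by
  set m := (∫ τ in s..t, b τ) / (t - s) with hm
  have hts : 0 < t - s := sub_pos.2 hst
  have h0 : 0 ≤ ∫ τ in s..t, (b τ - m) ^ 2 :=
    intervalIntegral.integral_nonneg hst.le fun _ _ => sq_nonneg _
  have e : ∀ τ, (b τ - m) ^ 2 = b τ ^ 2 - (2 * m * b τ - m ^ 2) := fun τ => by ring
  simp only [e] at h0
  rw [intervalIntegral.integral_sub hb2 ((hb.const_mul _).sub intervalIntegrable_const),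
    intervalIntegral.integral_sub (hb.const_mul _) intervalIntegrable_const,
    intervalIntegral.integral_const_mul, intervalIntegral.integral_const, smul_eq_mul] at h0
  have hI : ∫ τ in s..t, b τ = m * (t - s) := by rw [hm]; field_simp
  rw [hI] at h0 ⊢
  nlinarith

/-- Cauchy–Schwarz on every step gains one factor `dt`. The sum over time steps in the energy
estimate supplies the second, hence first order in time from an `L²` second derivative. -/
theorem sum_integral_sq_le {b : ℝ → ℝ} (hb : MemLp b 2 (volume.restrict (Ioo 0 T))) {dt : ℝ}
    (hdt : 0 < dt) {n : ℕ} (hn : n * dt ≤ T) :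
    ∑ k ∈ Finset.range n, (∫ τ in (k * dt)..((k + 1) * dt), b τ) ^ 2
      ≤ dt * ∫ τ in (0 : ℝ)..T, b τ ^ 2 := by
  have hT : 0 ≤ T := le_trans (by positivity) hn
  have i1 : IntegrableOn b (Ioo 0 T) := hb.integrable (by norm_num)
  have i2 : IntegrableOn (fun τ => b τ ^ 2) (Ioo 0 T) := hb.integrable_sq
  have hk : ∀ k < n, ((k : ℝ) + 1) * dt ≤ T := fun k hk => by
    have : ((k : ℝ) + 1) ≤ n := by exact_mod_cast hk
    exact (mul_le_mul_of_nonneg_right this hdt.le).trans hn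
  have h1 : ∀ k ∈ Finset.range n, (∫ τ in (k * dt)..((k + 1) * dt), b τ) ^ 2
      ≤ dt * ∫ τ in (k * dt)..((k + 1) * dt), b τ ^ 2 := by
    intro k hk'
    have hlt : (k : ℝ) * dt < (k + 1) * dt := by linarith
    have h0 : 0 ≤ (k : ℝ) * dt := by positivity
    have hT' := hk k (Finset.mem_range.1 hk')
    have := sq_integral_le hlt (intervalIntegrable_of_Ioo i1 h0 hlt.le hT')
      (intervalIntegrable_of_Ioo i2 h0 hlt.le hT')
    rwa [show ((k : ℝ) + 1) * dt - k * dt = dt by ring] at this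
  refine (Finset.sum_le_sum h1).trans ?_
  rw [← Finset.mul_sum]
  refine mul_le_mul_of_nonneg_left ?_ hdt.le
  have h2 := intervalIntegral.sum_integral_adjacent_intervals (μ := volume) (f := fun τ => b τ ^ 2)
    (a := fun k : ℕ => (k : ℝ) * dt) (n := n) (fun k hk' => by
      have hT' := hk k hk'
      push_cast
      exact intervalIntegrable_of_Ioo i2 (by positivity) (by linarith) hT')
  push_cast at h2
  rw [h2, zero_mul]
  exact intervalIntegral.integral_mono_interval le_rfl (by positivity) hn
    (Filter.Eventually.of_forall fun _ => sq_nonneg _) (intervalIntegrable_of_Ioo i2 le_rfl hT le_rfl)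

end Time

/-! ## The error of the Fourier projection -/

section Fourier

open Complex

variable {L : ℝ}

/-- Fourier coefficients of a function on the line. -/
def lineCoeff (L : ℝ) (F : ℝ → ℂ) (n : ℤ) : ℂ :=
  (1 / L : ℝ) • ∫ x in (0 : ℝ)..L, fourier (-n) (x : AddCircle L) * F x

theorem norm_fourier_apply (n : ℤ) (x : AddCircle L) : ‖fourier n x‖ = 1 := by
  rw [fourier_apply]
  exact Circle.norm_coe _

/-- Integration by parts over one period; the boundary terms cancel. -/
theorem lineCoeff_deriv {F : ℝ → ℂ} (hF : ContDiff ℝ 1 F) (hper : Function.Periodic F L) (n : ℤ) :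
    lineCoeff L (deriv F) n = (2 * Real.pi * I * n / L) * lineCoeff L F n := by
  have h1 : ∀ x ∈ Set.uIcc 0 L, HasDerivAt (fun y : ℝ => fourier (-n) (y : AddCircle L))
      (-2 * Real.pi * I * n / L * fourier (-n) (x : AddCircle L)) x :=
    fun x _ => hasDerivAt_fourier_neg L n x
  have h2 : ∀ x ∈ Set.uIcc 0 L, HasDerivAt F (deriv F x) x := fun x _ =>
    (hF.differentiable one_ne_zero x).hasDerivAt
  have hc : Continuous fun y : ℝ => (fourier (-n) (y : AddCircle L) : ℂ) :=
    (map_continuous (fourier (-n))).comp (AddCircle.continuous_mk' _)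
  have h3 := intervalIntegral.integral_mul_deriv_eq_deriv_mul h1 h2
    ((continuous_const.mul hc).intervalIntegrable _ _) (hF.continuous_deriv_one.intervalIntegrable _ _)
  have hL0 : F L = F 0 := by simpa using hper 0
  have h4 : ((L : ℝ) : AddCircle L) = ((0 : ℝ) : AddCircle L) := by
    simp
  rw [hL0, h4, sub_self, zero_sub] at h3
  simp only [lineCoeff, h3, mul_assoc (-2 * Real.pi * I * n / L : ℂ)]
  rw [intervalIntegral.integral_const_mul, real_smul, real_smul]
  ring

variable [Fact (0 < L)]

theorem norm_lineCoeff_le {F : ℝ → ℂ} {B : ℝ} (hB : ∀ x, ‖F x‖ ≤ B) (n : ℤ) :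
    ‖lineCoeff L F n‖ ≤ B := by
  have hL : 0 < L := Fact.out
  have h1 : ‖∫ x in (0 : ℝ)..L, fourier (-n) (x : AddCircle L) * F x‖ ≤ B * |L - 0| :=
    intervalIntegral.norm_integral_le_of_norm_le_const fun x _ => by
      rw [norm_mul, norm_fourier_apply, one_mul]
      exact hB x
  rw [sub_zero, abs_of_pos hL] at h1
  rw [lineCoeff, norm_smul, Real.norm_eq_abs, abs_of_pos (by positivity)]
  calc _ ≤ 1 / L * (B * L) := mul_le_mul_of_nonneg_left h1 (by positivity)
    _ = B := by field_simp

theorem norm_lineCoeff_mul_le {m : ℕ} : ∀ {F : ℝ → ℂ}, ContDiff ℝ m F → Function.Periodic F L →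
    ∀ {B : ℝ}, (∀ x, ‖iteratedDeriv m F x‖ ≤ B) → ∀ n : ℤ,
      (2 * Real.pi * |(n : ℝ)| / L) ^ m * ‖lineCoeff L F n‖ ≤ B := by
  have hL : 0 < L := Fact.out
  induction m with
  | zero =>
    intro F _ _ B hB n
    simpa using norm_lineCoeff_le (by simpa using hB) n
  | succ m ih =>
    intro F hF hper B hB n
    have hF1 : ContDiff ℝ 1 F := hF.of_le (by exact_mod_cast Nat.le_add_left 1 m)
    have hF' : ContDiff ℝ m (deriv F) := by
      have : ContDiff ℝ (m + 1) F := by exact_mod_cast hF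
      exact (contDiff_succ_iff_deriv.1 this).2.2
    have hper' : Function.Periodic (deriv F) L := fun x => by
      rw [← deriv_comp_add_const]
      congr 1
      exact funext hper
    have h1 := ih hF' hper' (B := B) (fun x => by rw [← iteratedDeriv_succ']; exact hB x) n
    rw [lineCoeff_deriv hF1 hper, norm_mul] at h1
    have h2 : ‖(2 * Real.pi * I * n / L : ℂ)‖ = 2 * Real.pi * |(n : ℝ)| / L := by
      simp [abs_of_pos Real.pi_pos, abs_of_pos hL]
    rw [h2, ← mul_assoc, ← pow_succ] at h1
    exact h1

/-- `∑ 1 / k²` over the integers. -/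
def zetaTwo : ℝ := ∑' k : ℤ, 1 / (k : ℝ) ^ 2

theorem zetaTwo_nonneg : 0 ≤ zetaTwo := tsum_nonneg fun k => by positivity

/-- Truncation error of the one-dimensional Fourier series. -/
theorem norm_sub_sum_fourier_le {m : ℕ} {g : C(AddCircle L, ℂ)}
    (hg : ContDiff ℝ (m + 2 : ℕ) fun x : ℝ => g x) {B : ℝ}
    (hB : ∀ x, ‖iteratedDeriv (m + 2) (fun x : ℝ => g x) x‖ ≤ B) (K : ℕ) (x : AddCircle L) :
    ‖g x - ∑ k ∈ Finset.Icc (-(K : ℤ)) K, fourierCoeff g k * fourier k x‖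
      ≤ (L / (2 * Real.pi)) ^ (m + 2) * zetaTwo * B / (K + 1) ^ m := by
  have hL : 0 < L := Fact.out
  have hB0 : 0 ≤ B := (norm_nonneg _).trans (hB 0)
  have hper : Function.Periodic (fun x : ℝ => g x) L := fun x => by simp
  have hcoef : ∀ k, fourierCoeff g k = lineCoeff L (fun x : ℝ => g x) k := fun k => by
    rw [fourierCoeff_eq_intervalIntegral _ _ 0, zero_add]
    rfl
  -- Of the `m + 2` powers of decay, two pay for summing the series and `m` remain as the
  -- convergence rate.
  have hdec : ∀ k : ℤ, k ≠ 0 → ‖fourierCoeff g k‖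
      ≤ (L / (2 * Real.pi)) ^ (m + 2) * B * (1 / |(k : ℝ)| ^ (m + 2)) := by
    intro k hk
    have h1 := norm_lineCoeff_mul_le hg hper hB k
    have hk' : 0 < |(k : ℝ)| := abs_pos.2 (Int.cast_ne_zero.2 hk)
    have h2 : 0 < (2 * Real.pi * |(k : ℝ)| / L) ^ (m + 2) := by positivity
    rw [hcoef, ← le_div_iff₀' h2] at *
    refine h1.trans (le_of_eq ?_)
    rw [div_pow, div_pow, mul_pow]
    field_simp
  have habs : ∀ k : ℤ, k ≠ 0 → (1 : ℝ) ≤ |(k : ℝ)| := fun k hk => by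
    exact_mod_cast Int.one_le_abs hk
  have hz : Summable fun k : ℤ => 1 / (k : ℝ) ^ 2 := Real.summable_one_div_int_pow.2 one_lt_two
  have hsum : Summable (fourierCoeff g) := by
    refine Summable.of_norm_bounded_eventually (g := fun k : ℤ =>
      (L / (2 * Real.pi)) ^ (m + 2) * B * (1 / (k : ℝ) ^ 2)) (hz.mul_left _) ?_
    refine (Set.finite_singleton (0 : ℤ)).subset fun k hk => ?_
    by_contra h0
    refine hk ((hdec k h0).trans (mul_le_mul_of_nonneg_left ?_ (by positivity)))
    have := habs k h0
    rw [← sq_abs (k : ℝ)]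
    refine one_div_le_one_div_of_le (by positivity) ?_
    exact pow_le_pow_right₀ this (by omega)
  have hs := has_pointwise_sum_fourier_series_of_summable hsum x
  have hs2 := hs.summable.sum_add_tsum_compl (s := Finset.Icc (-(K : ℤ)) K)
  rw [hs.tsum_eq] at hs2
  simp only [smul_eq_mul] at hs2
  rw [← hs2, add_sub_cancel_left]
  set A := (L / (2 * Real.pi)) ^ (m + 2) * B / (K + 1) ^ m with hA
  have hA0 : 0 ≤ A := by positivity
  have hterm : ∀ k : ↥((Finset.Icc (-(K : ℤ)) K : Finset ℤ) : Set ℤ)ᶜ,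
      ‖fourierCoeff g k * fourier (k : ℤ) x‖ ≤ A * (1 / ((k : ℤ) : ℝ) ^ 2) := by
    rintro ⟨k, hk⟩
    have hkK : (K : ℤ) + 1 ≤ |k| := by
      have hk' : ¬(-(K : ℤ) ≤ k ∧ k ≤ K) := fun h => hk (by simpa using h)
      rcases le_total 0 k with h | h
      · rw [abs_of_nonneg h]
        omega
      · rw [abs_of_nonpos h]
        omega
    have hk0 : k ≠ 0 := by
      rintro rfl
      rw [abs_zero] at hkK
      omega
    have hkK' : (K : ℝ) + 1 ≤ |(k : ℝ)| := by exact_mod_cast hkK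
    have hk1 := habs k hk0
    rw [norm_mul, norm_fourier_apply, mul_one]
    refine (hdec k hk0).trans ?_
    rw [hA, div_mul_eq_mul_div, mul_div_assoc]
    refine mul_le_mul_of_nonneg_left ?_ (by positivity)
    rw [div_div, ← sq_abs (k : ℝ), pow_add, mul_comm]
    refine one_div_le_one_div_of_le (by positivity) ?_
    exact mul_le_mul_of_nonneg_left (pow_le_pow_left₀ (by positivity) hkK' m) (by positivity)
  have hzs : Summable fun k : ↥((Finset.Icc (-(K : ℤ)) K : Finset ℤ) : Set ℤ)ᶜ =>
      A * (1 / ((k : ℤ) : ℝ) ^ 2) := (hz.subtype _).mul_left A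
  refine (tsum_of_norm_bounded hzs.hasSum hterm).trans ?_
  rw [tsum_mul_left]
  have h3 : ∑' k : ↥((Finset.Icc (-(K : ℤ)) K : Finset ℤ) : Set ℤ)ᶜ, 1 / ((k : ℤ) : ℝ) ^ 2 ≤ zetaTwo :=
    hz.tsum_subtype_le _ _ fun k => by positivity
  calc _ ≤ A * zetaTwo := mul_le_mul_of_nonneg_left h3 hA0
    _ = _ := by rw [hA]; ring

theorem coeff_eq (u : C(Torus L, ℝ)) (k l : ℤ) :
    coeff u k l = fourierCoeff (fun x => fourierCoeff (fun y => ((u (x, y) : ℝ) : ℂ)) l) k := by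
  have hc : Continuous fun z : Torus L => fourier (-k) z.1 * fourier (-l) z.2 * ((u z : ℝ) : ℂ) := by
    fun_prop
  have hi : Integrable (fun z : Torus L => fourier (-k) z.1 * fourier (-l) z.2 * ((u z : ℝ) : ℂ))
      ((AddCircle.haarAddCircle (T := L)).prod (AddCircle.haarAddCircle (T := L))) :=
    hc.integrable_of_hasCompactSupport (HasCompactSupport.of_compactSpace _)
  rw [coeff, integral_prod _ hi]
  simp only [fourierCoeff, smul_eq_mul]
  refine integral_congr_ae (Filter.Eventually.of_forall fun x => ?_)
  simp only [mul_assoc]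
  rw [integral_const_mul]

theorem norm_iteratedDeriv_line {f : ℝ × ℝ → ℝ} {n : ℕ} (hf : ContDiff ℝ n f) {B : ℝ}
    (hB : ∀ p, ‖iteratedFDeriv ℝ n f p‖ ≤ B) (A : ℝ →L[ℝ] ℝ × ℝ) (hA : ‖A‖ ≤ 1) (q : ℝ × ℝ) (x : ℝ) :
    ‖iteratedDeriv n (fun x : ℝ => ((f (A x + q) : ℝ) : ℂ)) x‖ ≤ B := by
  have hf1 : ContDiff ℝ n fun p => f (p + q) := hf.comp (contDiff_id.add contDiff_const)
  have hf2 : ContDiff ℝ n ((fun p => f (p + q)) ∘ A) := hf1.comp A.contDiff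
  rw [← norm_iteratedFDeriv_eq_norm_iteratedDeriv]
  have e1 := ofRealLI.norm_iteratedFDeriv_comp_left (f := (fun p => f (p + q)) ∘ A) (x := x)
    hf2.contDiffAt (i := n) le_rfl
  have e2 := A.iteratedFDeriv_comp_right hf1 x (i := n) le_rfl
  change ‖iteratedFDeriv ℝ n (ofRealLI ∘ ((fun p => f (p + q)) ∘ A)) x‖ ≤ B
  rw [e1, e2]
  refine (ContinuousMultilinearMap.norm_compContinuousLinearMap_le _ _).trans ?_
  have h2 : ∏ _ : Fin n, ‖A‖ ≤ 1 := by
    rw [Finset.prod_const]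
    exact pow_le_one₀ (norm_nonneg _) hA
  rw [iteratedFDeriv_comp_add_right]
  calc _ ≤ ‖iteratedFDeriv ℝ n f (A x + q)‖ * 1 := mul_le_mul_of_nonneg_left h2 (norm_nonneg _)
    _ ≤ B := by rw [mul_one]; exact hB _

/-- The projection error in the maximum norm. -/
theorem abs_fourierProj_sub_le {m : ℕ} {u : C(Torus L, ℝ)} (hu : ContDiff ℝ (m + 2 : ℕ) (lift u))
    {B : ℝ} (hB : ∀ p, ‖iteratedFDeriv ℝ (m + 2) (lift u) p‖ ≤ B) (K : ℕ) (z : Torus L) :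
    |fourierProj K u z - u z|
      ≤ 2 * (K + 1) * ((L / (2 * Real.pi)) ^ (m + 2) * zetaTwo * B / (K + 1) ^ m) := by
  obtain ⟨x₀, y₀⟩ := z
  set δ := (L / (2 * Real.pi)) ^ (m + 2) * zetaTwo * B / (K + 1) ^ m with hδ
  set I := Finset.Icc (-(K : ℤ)) K with hI
  -- The double series is truncated one variable at a time, beginning with `y` at frozen `x`.
  have hrow : ∀ x : AddCircle L, ‖((u (x, y₀) : ℝ) : ℂ)
      - ∑ l ∈ I, fourierCoeff (fun y => ((u (x, y) : ℝ) : ℂ)) l * fourier l y₀‖ ≤ δ := by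
    intro x
    induction x using QuotientAddGroup.induction_on with
    | H x =>
      let g : C(AddCircle L, ℂ) := ⟨fun y => ((u ((x : AddCircle L), y) : ℝ) : ℂ), by fun_prop⟩
      have e : (fun y : ℝ => g y) = fun y : ℝ =>
          ((lift u (ContinuousLinearMap.inr ℝ ℝ ℝ y + (x, 0)) : ℝ) : ℂ) := by
        funext y
        simp [g, lift]
      have hg : ContDiff ℝ (m + 2 : ℕ) fun y : ℝ => g y := by
        rw [e]
        exact ofRealCLM.contDiff.comp (hu.comp
          ((ContinuousLinearMap.inr ℝ ℝ ℝ).contDiff.add contDiff_const))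
      exact norm_sub_sum_fourier_le hg (fun y => by
        rw [e]
        exact norm_iteratedDeriv_line hu hB _ (ContinuousLinearMap.norm_inr_le_one ℝ ℝ ℝ) _ y) K y₀
  have hcol : ‖((u (x₀, y₀) : ℝ) : ℂ)
      - ∑ k ∈ I, fourierCoeff (fun x => ((u (x, y₀) : ℝ) : ℂ)) k * fourier k x₀‖ ≤ δ := by
    induction y₀ using QuotientAddGroup.induction_on with
    | H y =>
      let g : C(AddCircle L, ℂ) := ⟨fun x => ((u (x, (y : AddCircle L)) : ℝ) : ℂ), by fun_prop⟩
      have e : (fun x : ℝ => g x) = fun x : ℝ =>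
          ((lift u (ContinuousLinearMap.inl ℝ ℝ ℝ x + (0, y)) : ℝ) : ℂ) := by
        funext x
        simp [g, lift]
      have hg : ContDiff ℝ (m + 2 : ℕ) fun x : ℝ => g x := by
        rw [e]
        exact ofRealCLM.contDiff.comp (hu.comp
          ((ContinuousLinearMap.inl ℝ ℝ ℝ).contDiff.add contDiff_const))
      exact norm_sub_sum_fourier_le hg (fun x => by
        rw [e]
        exact norm_iteratedDeriv_line hu hB _ (ContinuousLinearMap.norm_inl_le_one ℝ ℝ ℝ) _ x) K x₀
  have hδ0 : 0 ≤ δ := (norm_nonneg _).trans hcol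
  -- `S` is the function truncated in `y` only; its `x`-coefficients produce the full projection, by
  -- Fubini.
  set S : AddCircle L → ℂ := fun x =>
    ∑ l ∈ I, fourierCoeff (fun y => ((u (x, y) : ℝ) : ℂ)) l * fourier l y₀ with hS
  have hcont : ∀ l, Continuous fun x => fourierCoeff (fun y => ((u (x, y) : ℝ) : ℂ)) l := by
    intro l
    unfold fourierCoeff
    have hcc : Continuous fun q : AddCircle L × AddCircle L =>
        fourier (-l) q.2 • ((u (q.1, q.2) : ℝ) : ℂ) := by fun_prop
    simpa using continuous_parametric_integral_of_continuous (μ := AddCircle.haarAddCircle)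
      (f := fun x y => fourier (-l) y • ((u (x, y) : ℝ) : ℂ)) (s := Set.univ) hcc isCompact_univ
  have hSc : Continuous S := continuous_finsetSum _ fun l _ => (hcont l).mul continuous_const
  have hint : ∀ {f : AddCircle L → ℂ}, Continuous f → Integrable f AddCircle.haarAddCircle :=
    fun hf => hf.integrable_of_hasCompactSupport (HasCompactSupport.of_compactSpace _)
  have hsum : ∑ k ∈ I, ∑ l ∈ I, coeff u k l * (fourier k x₀ * fourier l y₀)
      = ∑ k ∈ I, fourierCoeff S k * fourier k x₀ := by
    refine Finset.sum_congr rfl fun k _ => ?_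
    have e1 : fourierCoeff S k = ∑ l ∈ I, coeff u k l * fourier l y₀ := by
      simp only [coeff_eq, fourierCoeff, hS, smul_eq_mul, Finset.mul_sum]
      rw [integral_finsetSum _ fun l _ => hint ?_]
      · refine Finset.sum_congr rfl fun l _ => ?_
        rw [← integral_mul_const]
        refine integral_congr_ae (Filter.Eventually.of_forall fun x => ?_)
        simp only [mul_assoc]
      · exact (map_continuous (fourier (-k))).mul ((hcont l).mul continuous_const)
    rw [e1, Finset.sum_mul]
    exact Finset.sum_congr rfl fun l _ => by ring
  -- Only a uniform bound `δ` on `S - u` is used, so no smoothness of `S` is needed. The `2 K + 1`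
  -- coefficients then cost one power of `K`, a loss that the available regularity affords.
  have hdiff : ∀ k, ‖fourierCoeff S k - fourierCoeff (fun x => ((u (x, y₀) : ℝ) : ℂ)) k‖ ≤ δ := by
    intro k
    have hc1 : Continuous fun x : AddCircle L => fourier (-k) x • S x :=
      (map_continuous (fourier (-k))).smul hSc
    have hc2 : Continuous fun x : AddCircle L => fourier (-k) x • ((u (x, y₀) : ℝ) : ℂ) := by
      fun_prop
    rw [fourierCoeff, fourierCoeff, ← integral_sub (hint hc1) (hint hc2)]
    refine (norm_integral_le_of_norm_le_const (C := δ) (Filter.Eventually.of_forall fun x => ?_)).trans ?_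
    · rw [← smul_sub, norm_smul, norm_fourier_apply, one_mul, norm_sub_rev]
      exact hrow x
    · simp
  have hcard : (I.card : ℝ) = 2 * K + 1 := by
    have : I.card = 2 * K + 1 := by
      rw [hI, Int.card_Icc]
      omega
    rw [this]
    push_cast
    ring
  have hfin : ‖∑ k ∈ I, fourierCoeff S k * fourier k x₀ - ((u (x₀, y₀) : ℝ) : ℂ)‖
      ≤ (2 * K + 1) * δ + δ := by
    have e : ∑ k ∈ I, fourierCoeff S k * fourier k x₀ - ((u (x₀, y₀) : ℝ) : ℂ)
        = ∑ k ∈ I, (fourierCoeff S k - fourierCoeff (fun x => ((u (x, y₀) : ℝ) : ℂ)) k) * fourier k x₀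
          - (((u (x₀, y₀) : ℝ) : ℂ)
            - ∑ k ∈ I, fourierCoeff (fun x => ((u (x, y₀) : ℝ) : ℂ)) k * fourier k x₀) := by
      simp only [sub_mul, Finset.sum_sub_distrib]
      ring
    rw [e]
    refine (norm_sub_le _ _).trans (add_le_add ?_ hcol)
    refine (norm_sum_le_of_le I (n := fun _ => δ) fun k _ => ?_).trans ?_
    · rw [norm_mul, norm_fourier_apply, mul_one]
      exact hdiff k
    · rw [Finset.sum_const, nsmul_eq_mul, hcard]
  have hre : fourierProj K u (x₀, y₀) - u (x₀, y₀)
      = (∑ k ∈ I, fourierCoeff S k * fourier k x₀ - ((u (x₀, y₀) : ℝ) : ℂ)).re := by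
    rw [fourierProj, hsum, sub_re, ofReal_re]
  rw [hre]
  refine (abs_re_le_norm _).trans (hfin.trans (le_of_eq ?_))
  ring

end Fourier

/-! ## Comparison of the numerical solution with a reference sequence -/

section Comparison

variable {N : ℕ} {h : ℝ}

/-- The residual of the first equation for `(U₀, U₁, R₁)`. -/
def resPhi (P : Params) (h dt : ℝ) (U₀ U₁ R₁ : Grid N) : Grid N := fun i j =>
  (U₁ i j - U₀ i j) / dt - P.M * lapH h (muPhiH P h U₁ U₁ R₁) i j

/-- The residual of the second equation for `(R₀, R₁, U₁)`. -/
def resRho (P : Params) (h dt : ℝ) (R₀ R₁ U₁ : Grid N) : Grid N := fun i j =>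
  (R₁ i j - R₀ i j) / dt - P.M * lapH h (muRhoH P h R₁ U₁ R₁) i j

theorem lapH_const (c : ℝ) : lapH h (fun _ _ => c : Grid N) = 0 := by
  funext i j
  simp [lapH, dx, dy, Dx, Dy]

theorem lapH_sub_const (u : Grid N) (c : ℝ) : lapH h (u - fun _ _ => c) = lapH h u := by
  rw [lapH_sub, lapH_const, sub_zero]

theorem abs_lapH_le (hh : 0 < h) {u : Grid N} {b : ℝ} (hb : ∀ i j, |u i j| ≤ b) (i j : ZMod N) :
    |lapH h u i j| ≤ 8 * b / h ^ 2 := by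
  have e : lapH h u i j
      = (u (i + 1) j + u (i - 1) j + u i (j + 1) + u i (j - 1) - 4 * u i j) / h ^ 2 := by
    simp only [lapH, Pi.add_apply, dx, dy, Dx, Dy, sub_add_cancel]
    field_simp
    ring
  rw [e, abs_div, abs_of_pos (by positivity : (0 : ℝ) < h ^ 2)]
  gcongr
  have h1 := abs_le.1 (hb (i + 1) j)
  have h2 := abs_le.1 (hb (i - 1) j)
  have h3 := abs_le.1 (hb i (j + 1))
  have h4 := abs_le.1 (hb i (j - 1))
  have h5 := abs_le.1 (hb i j)
  exact abs_le.2 ⟨by linarith, by linarith⟩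

variable [NeZero N]

theorem gradSq_sub_const (u : Grid N) (c : ℝ) : gradSq h (u - fun _ _ => c) = gradSq h u := by
  have e1 : Dx h (u - fun _ _ => c) = Dx h u := by funext i j; simp [Dx]
  have e2 : Dy h (u - fun _ _ => c) = Dy h u := by funext i j; simp [Dy]
  rw [gradSq, gradSq, e1, e2]

theorem gradSq_le_of_abs_le (hh : 0 < h) {u : Grid N} {b : ℝ} (hb : ∀ i j, |u i j| ≤ b) :
    gradSq h u ≤ (h * N) ^ 2 * (8 * b ^ 2 / h ^ 2) := by
  rw [gradSq_eq_sum]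
  have hsq : ∀ x y : ℝ, |x| ≤ b → |y| ≤ b → ((x - y) / h) ^ 2 ≤ 4 * b ^ 2 / h ^ 2 := by
    intro x y hx hy
    rw [div_pow]
    gcongr
    have h1 := abs_le.1 hx
    have h2 := abs_le.1 hy
    nlinarith
  have h1 : ∑ i, ∑ j, (Dx h u i j ^ 2 + Dy h u i j ^ 2)
      ≤ ∑ _i : ZMod N, ∑ _j : ZMod N, 8 * b ^ 2 / h ^ 2 := by
    refine Finset.sum_le_sum fun i _ => Finset.sum_le_sum fun j _ => ?_
    have a1 : Dx h u i j ^ 2 ≤ _ := hsq _ _ (hb (i + 1) j) (hb i j)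
    have a2 : Dy h u i j ^ 2 ≤ _ := hsq _ _ (hb i (j + 1)) (hb i j)
    refine (add_le_add a1 a2).trans (le_of_eq ?_)
    ring
  rw [sum_const_grid] at h1
  calc _ ≤ h ^ 2 * ((N : ℝ) ^ 2 * (8 * b ^ 2 / h ^ 2)) := mul_le_mul_of_nonneg_left h1 (sq_nonneg h)
    _ = _ := by ring

theorem dissip_sub_const (P : Params) (e g : Grid N) (c d : ℝ) :
    dissip P h (e - fun _ _ => c) (g - fun _ _ => d) = dissip P h e g := by
  simp only [dissip, lapH_sub_const, gradSq_sub_const]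

theorem dissip_add_le (P : Params) (e g e' g' : Grid N) :
    dissip P h (e + e') (g + g') ≤ 2 * dissip P h e g + 2 * dissip P h e' g' := by
  have h1 := mul_le_mul_of_nonneg_left (normSq_add_le (h := h) (lapH h e) (lapH h e'))
    (sq_nonneg P.η)
  have h2 := mul_le_mul_of_nonneg_left (gradSq_add_le (h := h) e e') P.ε_pos.le
  have h3 := mul_le_mul_of_nonneg_left (gradSq_add_le (h := h) g g') P.ξ_pos.le
  simp only [dissip, lapH_add]
  linarith

theorem dissip_neg (P : Params) (e g : Grid N) : dissip P h (-e) (-g) = dissip P h e g := by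
  have h1 : lapH h (-e) = -lapH h e := by
    funext i j
    simp only [lapH, dx, dy, Dx, Dy, Pi.add_apply, Pi.neg_apply]
    ring
  have h2 : ∀ u : Grid N, gradSq h (-u) = gradSq h u := by
    intro u
    simp only [gradSq_eq_sum, Dx, Dy, Pi.neg_apply]
    congr 1
    refine Finset.sum_congr rfl fun i _ => Finset.sum_congr rfl fun j _ => ?_
    ring
  simp only [dissip, h1, h2, normSq_neg]

theorem negSq_neg (hh : h ≠ 0) (u : Grid N) : negSq h (-u) = negSq h u := by
  have h1 : invLap h (-u) = (-1 : ℝ) • invLap h u := by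
    have hu := invLap_spec hh u
    refine invLap_unique hh (by rw [mean_smul, hu.1, mul_zero]) fun i j => ?_
    have h2 := hu.2 i j
    have h3 : mean (-u) = -mean u := by
      have := mean_smul (-1) u
      simpa using this
    have h4 : lapH h ((-1 : ℝ) • invLap h u) i j = -lapH h (invLap h u) i j := by
      simp only [lapH, dx, dy, Dx, Dy, Pi.add_apply, Pi.smul_apply, smul_eq_mul]
      ring
    rw [h4, h3, Pi.neg_apply, Pi.neg_apply]
    linarith
  rw [negSq, negSq, h1]
  simp only [gradSq_eq_sum, Dx, Dy, Pi.smul_apply, smul_eq_mul]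
  congr 1
  refine Finset.sum_congr rfl fun i _ => Finset.sum_congr rfl fun j _ => ?_
  ring

theorem dissip_le_of_abs_le (P : Params) (hh : 0 < h) {e g : Grid N} {b b' : ℝ}
    (hb : ∀ i j, |e i j| ≤ b) (hb' : ∀ i j, |g i j| ≤ b') :
    dissip P h e g ≤ (h * N) ^ 2 * (P.η ^ 2 * (8 * b / h ^ 2) ^ 2 + P.ε * (8 * b ^ 2 / h ^ 2)
      + P.ξ * (8 * b' ^ 2 / h ^ 2)) := by
  have h1 := mul_le_mul_of_nonneg_left (normSq_le_of_abs_le (h := h) (abs_lapH_le hh hb))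
    (sq_nonneg P.η)
  have h2 := mul_le_mul_of_nonneg_left (gradSq_le_of_abs_le hh hb) P.ε_pos.le
  have h3 := mul_le_mul_of_nonneg_left (gradSq_le_of_abs_le hh hb') P.ξ_pos.le
  rw [dissip]
  linarith

/-- If `(U, R)` solves the scheme up to small residuals and is close to `(p, w)`, then the numerical
solution `(f, s)` that starts from `(p 0, w 0)` is close to `(p, w)`. -/
theorem comparison (P : Params) {L : ℝ} (hL : 0 < L) : ∃ C₀ : ℝ, 0 < C₀ ∧ ∀ T : ℝ, 0 ≤ T →
    ∃ A : ℝ, 0 ≤ A ∧ ∀ (N : ℕ) [NeZero N] (h dt q : ℝ), h * N = L → 0 < dt → C₀ * dt ≤ 1 / 2 →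
    0 ≤ q → ∀ (n : ℕ) (U R f s p w : ℕ → Grid N), n * dt ≤ T →
      (∀ k ≤ n, mean (U k) = mean (f k)) → (∀ k ≤ n, mean (R k) = mean (s k)) →
      (∀ k < n, ∀ i j, 0 < R (k + 1) i j ∧ R (k + 1) i j < 1) →
      (∀ k < n, ∀ i j, 0 < s (k + 1) i j ∧ s (k + 1) i j < 1) →
      (∀ k < n, ∀ i j, (f (k + 1) i j - f k i j) / dt
        = P.M * lapH h (muPhiH P h (f k) (f (k + 1)) (s (k + 1))) i j) →
      (∀ k < n, ∀ i j, (s (k + 1) i j - s k i j) / dt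
        = P.M * lapH h (muRhoH P h (s k) (f (k + 1)) (s (k + 1))) i j) →
      f 0 = p 0 → s 0 = w 0 →
      dt * ∑ k ∈ Finset.range n, (normSq h (resPhi P h dt (U k) (U (k + 1)) (R (k + 1)))
        + normSq h (resRho P h dt (R k) (R (k + 1)) (U (k + 1)))
        + normSq h (U (k + 1) - U k) + normSq h (R (k + 1) - R k)) ≤ q →
      (∀ k ≤ n, negSq h (p k - U k) + negSq h (w k - R k) ≤ q) →
      (∀ k ≤ n, dissip P h (p k - U k) (w k - R k) ≤ q) →
      negSq h (p n - f n) + negSq h (w n - s n)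
        + P.M * dt * ∑ k ∈ Finset.range (n + 1), dissip P h (p k - f k) (w k - s k) ≤ A * q := by
  obtain ⟨C₀, C₁, hC₀, hC₁, H⟩ := step_energy P hL
  have hM := P.M_pos
  refine ⟨C₀, hC₀, fun T hT => ?_⟩
  set E := Real.exp (4 * C₀ * T) with hE
  have hE0 : 0 < E := Real.exp_pos _
  refine ⟨2 + 2 * (P.M * (T + 1 / (2 * C₀)))
      + 2 * (2 * (E * (1 + P.M * (1 / (2 * C₀)) + C₁))), by positivity, ?_⟩
  intro N _ h dt q hN hdt hsm hq n U R f s p w hn hmU hmR hR hs hf hsr f0 s0 hres hneg hdis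
  have hh : h ≠ 0 := by
    rintro rfl
    rw [zero_mul] at hN
    exact hL.ne hN
  -- This bounds `dt D₀`, and also `dt (n + 1)`, since the sum has one term more than there are
  -- steps up to `T`.
  have hdt0 : dt ≤ 1 / (2 * C₀) := by
    rw [le_div_iff₀ (by positivity)]
    linarith
  have hκ : 0 ≤ P.M * dt := by positivity
  set X : ℕ → ℝ := fun k => negSq h (U k - f k) + negSq h (R k - s k) with hX
  set D : ℕ → ℝ := fun k => dissip P h (U k - f k) (R k - s k) with hD
  set r : ℕ → ℝ := fun k => C₁ * dt * (normSq h (resPhi P h dt (U k) (U (k + 1)) (R (k + 1)))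
        + normSq h (resRho P h dt (R k) (R (k + 1)) (U (k + 1)))
        + normSq h (U (k + 1) - U k) + normSq h (R (k + 1) - R k)) with hr
  have hX0 : ∀ k, 0 ≤ X k := fun k => add_nonneg (negSq_nonneg _) (negSq_nonneg _)
  have hD0 : ∀ k, 0 ≤ D k := fun k => dissip_nonneg P _ _
  have hr0 : ∀ k, 0 ≤ r k := fun k => mul_nonneg (by positivity) (add_nonneg (add_nonneg
    (add_nonneg (normSq_nonneg _) (normSq_nonneg _)) (normSq_nonneg _)) (normSq_nonneg _))
  have hg := discrete_gronwall hC₀.le hdt.le hsm hX0 hD0 hr0 hκ (n := n) fun k hk =>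
    H N h dt hN hdt (U k) (U (k + 1)) (R k) (R (k + 1)) (f k) (f (k + 1)) (s k) (s (k + 1)) _ _
      (hR k hk) (hs k hk) (hmU k hk.le) (hmU (k + 1) hk) (hmR k hk.le) (hmR (k + 1) hk)
      (fun i j => by simp only [resPhi]; ring) (fun i j => by simp only [resRho]; ring)
      (hf k hk) (hsr k hk)
  have hXi : X 0 ≤ q := by
    have := hneg 0 (Nat.zero_le n)
    rw [← f0, ← s0, ← negSq_neg hh, ← negSq_neg hh (s 0 - R 0), neg_sub, neg_sub] at this
    exact this
  have hDi : D 0 ≤ q := by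
    have := hdis 0 (Nat.zero_le n)
    rw [← f0, ← s0, ← dissip_neg, neg_sub, neg_sub] at this
    exact this
  have hri : ∑ k ∈ Finset.range n, r k ≤ C₁ * q := by
    rw [hr, ← Finset.mul_sum, mul_assoc]
    exact mul_le_mul_of_nonneg_left hres hC₁.le
  have hexp : Real.exp (4 * C₀ * (n * dt)) ≤ E :=
    Real.exp_le_exp.2 (mul_le_mul_of_nonneg_left hn (by positivity))
  have hB : X n + P.M * dt * ∑ k ∈ Finset.range (n + 1), D k
      ≤ 2 * (E * (1 + P.M * (1 / (2 * C₀)) + C₁)) * q := by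
    refine hg.trans ?_
    have h1 : X 0 + P.M * dt * D 0 + ∑ k ∈ Finset.range n, r k
        ≤ (1 + P.M * (1 / (2 * C₀)) + C₁) * q := by
      have : P.M * dt * D 0 ≤ P.M * (1 / (2 * C₀)) * q := by
        gcongr
        exact hD0 0
      linarith
    have h2 : 0 ≤ X 0 + P.M * dt * D 0 + ∑ k ∈ Finset.range n, r k :=
      add_nonneg (add_nonneg (hX0 0) (mul_nonneg hκ (hD0 0))) (Finset.sum_nonneg fun k _ => hr0 k)
    have := mul_le_mul hexp h1 h2 hE0.le
    linarith
  have hsplit : ∀ a b c : Grid N, a - c = (a - b) + (b - c) := fun a b c => (sub_add_sub_cancel a b c).symm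
  have h1 : negSq h (p n - f n) + negSq h (w n - s n) ≤ 2 * q + 2 * X n := by
    have a1 := negSq_add_le hh (p n - U n) (U n - f n)
    have a2 := negSq_add_le hh (w n - R n) (R n - s n)
    rw [← hsplit] at a1 a2
    have a3 := hneg n le_rfl
    simp only [hX]
    linarith
  have h2 : ∑ k ∈ Finset.range (n + 1), dissip P h (p k - f k) (w k - s k)
      ≤ 2 * ((n + 1) * q) + 2 * ∑ k ∈ Finset.range (n + 1), D k := by
    have : ∀ k ∈ Finset.range (n + 1), dissip P h (p k - f k) (w k - s k) ≤ 2 * q + 2 * D k := by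
      intro k hk
      have a1 := dissip_add_le P (h := h) (p k - U k) (w k - R k) (U k - f k) (R k - s k)
      rw [← hsplit, ← hsplit] at a1
      have a3 := hdis k (Nat.lt_succ_iff.1 (Finset.mem_range.1 hk))
      simp only [hD]
      linarith
    refine (Finset.sum_le_sum this).trans (le_of_eq ?_)
    rw [Finset.sum_add_distrib, Finset.mul_sum, Finset.sum_const, Finset.card_range, nsmul_eq_mul]
    push_cast
    ring
  have h3 : P.M * dt * ((n + 1) * q) ≤ P.M * (T + 1 / (2 * C₀)) * q := by
    have : dt * (n + 1) ≤ T + 1 / (2 * C₀) := by linarith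
    calc _ = P.M * (dt * (n + 1)) * q := by ring
      _ ≤ _ := by gcongr
  have h4 := mul_le_mul_of_nonneg_left h2 hκ
  linarith

end Comparison

/-! ## Estimates that hold at every time -/

section AllTimes

open Set

variable {T L : ℝ}

/-- `max F C` is continuous and equals `C` almost everywhere, hence everywhere. This carries the
spatial estimates from almost every time to the actual time levels. -/
theorem le_of_ae_le_Ioo (hT : 0 < T) {F : ℝ → ℝ} {C : ℝ} (hF : ContinuousOn F (Icc 0 T))
    (h : ∀ᵐ t ∂(volume.restrict (Ioo 0 T)), F t ≤ C) : ∀ t ∈ Icc 0 T, F t ≤ C := by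
  have h1 : (fun t => max (F t) C) =ᵐ[volume.restrict (Icc 0 T)] fun _ => C := by
    rw [← Measure.restrict_congr_set Ioo_ae_eq_Icc]
    filter_upwards [h] with t ht
    exact max_eq_right ht
  have h2 := Measure.eqOn_Icc_of_ae_eq volume hT.ne h1 (hF.sup continuousOn_const) continuousOn_const
  intro t ht
  have := h2 ht
  exact max_eq_right_iff.1 this

/-! ### Continuity in time of the discrete operators -/

section Nonlinear

variable {N : ℕ} {h : ℝ} {S : Set ℝ} {U R : ℝ → Grid N}

theorem continuousOn_lapH (hU : ∀ i j, ContinuousOn (fun t => U t i j) S) (i j : ZMod N) :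
    ContinuousOn (fun t => lapH h (U t) i j) S := by
  simp only [lapH, dx, dy, Dx, Dy, Pi.add_apply]
  fun_prop

theorem continuousOn_modGradH (δ : ℝ) (hU : ∀ i j, ContinuousOn (fun t => U t i j) S)
    (i j : ZMod N) : ContinuousOn (fun t => modGradH h δ (U t) i j) S := by
  simp only [modGradH, Dx, Dy]
  fun_prop

theorem continuousOn_divNonlin {δ : ℝ} (hδ : 0 < δ) (hU : ∀ i j, ContinuousOn (fun t => U t i j) S)
    (hR : ∀ i j, ContinuousOn (fun t => R t i j) S) (i j : ZMod N) :
    ContinuousOn (fun t => divNonlin h δ (U t) (R t) i j) S := by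
  have hq : ∀ i j, ContinuousOn (fun t => R t i j / modGradH h δ (U t) i j) S := fun i j =>
    (hR i j).div (continuousOn_modGradH δ hU i j) fun t _ => by
      rw [modGradH]
      positivity
  have key : ∀ Q : ℝ → Grid N, (∀ i j, ContinuousOn (fun t => Q t i j) S) →
      ContinuousOn (fun t => (dx h (Ax (Q t) * Dx h (U t)) + dy h (Ay (Q t) * Dy h (U t))) i j) S := by
    intro Q hQ
    simp only [dx, dy, Dx, Dy, Ax, Ay, Pi.add_apply, Pi.mul_apply]
    fun_prop
  exact key (fun t => R t / modGradH h δ (U t)) hq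

theorem continuousOn_muPhiH (P : Params) (hU : ∀ i j, ContinuousOn (fun t => U t i j) S)
    (hR : ∀ i j, ContinuousOn (fun t => R t i j) S) (i j : ZMod N) :
    ContinuousOn (fun t => muPhiH P h (U t) (U t) (R t) i j) S := by
  have h1 := continuousOn_lapH (h := h) hU
  have h2 := continuousOn_lapH (h := h) h1
  have h3 := continuousOn_divNonlin (h := h) P.δ_pos hU hR
  exact ((((((((hU i j).sub continuousOn_const).pow 3).div_const _).sub
    ((h1 i j).const_mul _)).add ((h2 i j).const_mul _)).add ((h3 i j).const_mul _)).sub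
    (((hU i j).sub continuousOn_const).div_const _)).add ((h1 i j).const_mul _)

theorem continuousOn_muRhoH (P : Params) (hU : ∀ i j, ContinuousOn (fun t => U t i j) S)
    (hR : ∀ i j, ContinuousOn (fun t => R t i j) S)
    (h01 : ∀ t ∈ S, ∀ i j, 0 < R t i j ∧ R t i j < 1) (i j : ZMod N) :
    ContinuousOn (fun t => muRhoH P h (R t) (U t) (R t) i j) S := by
  have h1 := continuousOn_lapH (h := h) hR
  have h3 := continuousOn_modGradH (h := h) P.δ hU
  have h4 : ContinuousOn (fun t => dEntropy (R t i j)) S := by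
    simp only [dEntropy]
    exact ((hR i j).log fun t ht => (h01 t ht i j).1.ne').sub
      ((continuousOn_const.sub (hR i j)).log fun t ht => (sub_pos.2 (h01 t ht i j).2).ne')
  simp only [muRhoH]
  fun_prop

end Nonlinear

/-- The centre of the cell `(i, j)`. -/
def node (L : ℝ) (K : ℕ) (i j : ZMod (2 * K + 1)) : Torus L :=
  ((((i.val : ℝ) - 1 / 2) * mesh L K : ℝ), (((j.val : ℝ) - 1 / 2) * mesh L K : ℝ))

theorem continuousOn_eval {u : ℝ → C(Torus L, ℝ)} {S : Set ℝ} (hu : ContinuousOn u S) (z : Torus L) :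
    ContinuousOn (fun t => u t z) S :=
  (ContinuousMap.evalCLM ℝ z : C(Torus L, ℝ) →L[ℝ] ℝ).continuous.comp_continuousOn hu

variable [Fact (0 < L)]

/-- This makes the projection continuous from the maximum norm, so that the projection error is
continuous in time. -/
theorem norm_coeff_sub_le (u v : C(Torus L, ℝ)) (k l : ℤ) : ‖coeff u k l - coeff v k l‖ ≤ ‖u - v‖ := by
  have hint : ∀ w : C(Torus L, ℝ), Integrable (fun z : Torus L =>
      (fourier (-k) z.1 * fourier (-l) z.2 * ((w z : ℝ) : ℂ)))
      ((AddCircle.haarAddCircle (T := L)).prod (AddCircle.haarAddCircle (T := L))) := fun w =>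
    (by fun_prop : Continuous _).integrable_of_hasCompactSupport (HasCompactSupport.of_compactSpace _)
  rw [coeff, coeff, ← integral_sub (hint u) (hint v)]
  refine (norm_integral_le_of_norm_le_const (C := ‖u - v‖)
    (Filter.Eventually.of_forall fun z => ?_)).trans (by simp)
  rw [← mul_sub, norm_mul, norm_mul, norm_fourier_apply, norm_fourier_apply, one_mul, one_mul,
    ← Complex.ofReal_sub, Complex.norm_real]
  exact (u - v).norm_coe_le_norm z

theorem continuous_coeff (k l : ℤ) : Continuous fun u : C(Torus L, ℝ) => coeff u k l :=
  (LipschitzWith.of_dist_le_mul (K := 1) fun u v => by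
    rw [dist_eq_norm, dist_eq_norm, NNReal.coe_one, one_mul]
    exact norm_coeff_sub_le u v k l).continuous

theorem continuous_fourierProj (K : ℕ) (z : Torus L) :
    Continuous fun u : C(Torus L, ℝ) => fourierProj K u z := by
  have := continuous_coeff (L := L)
  unfold fourierProj
  fun_prop

theorem mesh_le (K : ℕ) : mesh L K ≤ L := by
  have hL : 0 < L := Fact.out
  refine div_le_self hL.le ?_
  push_cast
  linarith [(Nat.cast_nonneg K : (0 : ℝ) ≤ K)]

/-- Three derivatives are lost in all: two for summability and one for the two-variable truncation.
Moreover `1 / (K + 1)` is at most a multiple of `h`. -/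
theorem proj_error (hT : 0 < T) {m : ℕ} {u : ℝ → C(Torus L, ℝ)} (hu : RegularClass (m + 3) T u) :
    ∃ C : ℝ, 0 ≤ C ∧ ∀ t ∈ Icc 0 T, ∀ K i j,
      |proj K (u t) i j - u t (node L K i j)| ≤ C * mesh L K ^ m := by
  have hL : 0 < L := Fact.out
  obtain ⟨B, hB⟩ := hu.linfty
  set A := 2 * ((L / (2 * Real.pi)) ^ (m + 3) * zetaTwo * |B|) * (2 / L) ^ m with hA
  have hA0 : 0 ≤ A := by
    have := zetaTwo_nonneg
    positivity
  refine ⟨A, hA0, fun t ht K i j => ?_⟩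
  have hcont : ContinuousOn (fun t => |proj K (u t) i j - u t (node L K i j)|) (Icc 0 T) := by
    refine ContinuousOn.abs (ContinuousOn.sub ?_ (continuousOn_eval hu.cont _))
    exact (continuous_fourierProj K (node L K i j)).comp_continuousOn hu.cont
  refine le_of_ae_le_Ioo hT hcont ?_ t ht
  filter_upwards [hB] with s hs
  have h1 := abs_fourierProj_sub_le (m := m + 1) hs.1 (B := |B|)
    (fun p => (hs.2 _ le_rfl p).trans (le_abs_self B)) K (node L K i j)
  refine h1.trans ?_
  have hK : (0 : ℝ) < K + 1 := by positivity
  have h2 : 1 / (K + 1 : ℝ) ≤ 2 / L * mesh L K := by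
    rw [mesh, div_mul_div_cancel₀ hL.ne', div_le_div_iff₀ hK (by positivity)]
    push_cast
    linarith
  have h3 : 1 / (K + 1 : ℝ) ^ m ≤ (2 / L) ^ m * mesh L K ^ m := by
    rw [← mul_pow, ← one_div_pow]
    exact pow_le_pow_left₀ (by positivity) h2 m
  have e : 2 * ((K : ℝ) + 1) * ((L / (2 * Real.pi)) ^ (m + 1 + 2) * zetaTwo * |B| / (K + 1) ^ (m + 1))
      = 2 * ((L / (2 * Real.pi)) ^ (m + 3) * zetaTwo * |B|) * (1 / (K + 1 : ℝ) ^ m) := by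
    rw [pow_succ (K + 1 : ℝ) m]
    field_simp
  rw [e, hA, mul_assoc (2 * _)]
  refine mul_le_mul_of_nonneg_left h3 ?_
  have := zetaTwo_nonneg
  positivity

/-- `Ψ` is jointly continuous on a compact set, so pointwise bounds strictly inside `(0, 1)` become
uniform. -/
theorem exists_margin {Ψ : ℝ → C(Torus L, ℝ)} (hΨ : ContinuousOn Ψ (Icc 0 T))
    (hpos : ∀ t ∈ Icc 0 T, ∀ z, 0 < Ψ t z ∧ Ψ t z < 1) :
    ∃ κ : ℝ, 0 < κ ∧ ∀ t ∈ Icc 0 T, ∀ z, 2 * κ ≤ Ψ t z ∧ Ψ t z ≤ 1 - 2 * κ := by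
  have hc : ContinuousOn (fun q : ℝ × Torus L => Ψ q.1 q.2) (Icc 0 T ×ˢ univ) :=
    (hΨ.comp continuousOn_fst fun q hq => hq.1).eval continuousOn_snd
  have hc2 : ContinuousOn (fun q : ℝ × Torus L => min (Ψ q.1 q.2) (1 - Ψ q.1 q.2))
      (Icc 0 T ×ˢ univ) := hc.inf (continuousOn_const.sub hc)
  obtain ⟨ε, hε, h⟩ := (isCompact_Icc.prod isCompact_univ).exists_forall_le' hc2
    (a := 0) fun q hq => lt_min (hpos q.1 hq.1 q.2).1 (sub_pos.2 (hpos q.1 hq.1 q.2).2)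
  refine ⟨ε / 2, by positivity, fun t ht z => ?_⟩
  have := h (t, z) ⟨ht, mem_univ _⟩
  have h1 := this.trans (min_le_left _ _)
  have h2 := this.trans (min_le_right _ _)
  simp only at h1 h2
  constructor <;> linarith

/-- The exact solution, shifted by `c sin² (b h)` and `d sin² (b h)`, solves the implicit
semi-discrete system up to `O(h²)`. -/
theorem consistency (P : Params) (hT : 0 < T) {Φ Ψ : ℝ → C(Torus L, ℝ)} (hΦ : RegularClass 8 T Φ)
    (hΨ : RegularClass 6 T Ψ) (hsol : IsExactSolution P T Φ Ψ) {V W : Torus L → ℝ → ℝ}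
    (hVc : ∀ z, ContinuousOn (V z) (Icc 0 T)) (hWc : ∀ z, ContinuousOn (W z) (Icc 0 T))
    (hV : ∀ z, ∀ t ∈ Ioo 0 T, HasDerivAt (fun s => Φ s z) (V z t) t)
    (hW : ∀ z, ∀ t ∈ Ioo 0 T, HasDerivAt (fun s => Ψ s z) (W z t) t) {κ : ℝ} (hκ : 0 < κ)
    (hm : ∀ t ∈ Icc 0 T, ∀ z, 2 * κ ≤ Ψ t z ∧ Ψ t z ≤ 1 - 2 * κ) (b : ℝ) :
    ∃ C : ℝ, 0 ≤ C ∧ ∀ t ∈ Icc 0 T, ∀ (c d : ℝ), |c| ≤ κ → |d| ≤ κ → ∀ (K : ℕ) (U R : Grid (2 * K + 1)),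
      U = (fun a e => Φ t (node L K a e) + c * Real.sin (b * mesh L K) ^ 2) →
      R = (fun a e => Ψ t (node L K a e) + d * Real.sin (b * mesh L K) ^ 2) →
      ∀ a e, |V (node L K a e) t - P.M * lapH (mesh L K) (muPhiH P (mesh L K) U U R) a e|
          ≤ C * mesh L K ^ 2
        ∧ |W (node L K a e) t - P.M * lapH (mesh L K) (muRhoH P (mesh L K) R U R) a e|
          ≤ C * mesh L K ^ 2 := by
  have hL : 0 < L := Fact.out
  obtain ⟨B, hB⟩ := hΦ.linfty
  obtain ⟨B', hB'⟩ := hΨ.linfty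
  -- The family is indexed by the good times, at which the spatial derivatives obey the essential
  -- bounds; one constant then serves almost every time.
  let ι := {t : ℝ // t ∈ Ioo 0 T
    ∧ (ContDiff ℝ 8 (lift (Φ t)) ∧ ∀ m ≤ 8, ∀ p, ‖iteratedFDeriv ℝ m (lift (Φ t)) p‖ ≤ B)
    ∧ (ContDiff ℝ 6 (lift (Ψ t)) ∧ ∀ m ≤ 6, ∀ p, ‖iteratedFDeriv ℝ m (lift (Ψ t)) p‖ ≤ B')}
  have hper : ∀ x : ℝ, ((x + L : ℝ) : AddCircle L) = x := fun x => AddCircle.coe_add_period L x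
  obtain ⟨C, hC, H⟩ := consistency_space (ι := ι) P hL hκ b
    (v := fun i => lift (Φ i.1)) (r := fun i => lift (Ψ i.1))
    (UnifC.of_plane (fun i => i.2.2.1.1) fun i => i.2.2.1.2)
    (UnifC.of_plane (fun i => i.2.2.2.1) fun i => i.2.2.2.2)
    (fun i x y => by simp only [lift, hper]) (fun i x y => by simp only [lift, hper])
    (fun i x y => by simp only [lift, hper]) (fun i x y => by simp only [lift, hper])
    (fun i z => (hm i.1 (Ioo_subset_Icc_self i.2.1) _).1)
    (fun i z => (hm i.1 (Ioo_subset_Icc_self i.2.1) _).2)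
  refine ⟨C, hC, fun t ht c d hc hd K U R hU hR a e => ?_⟩
  subst hU hR
  set Ut : ℝ → Grid (2 * K + 1) := fun t a e =>
    Φ t (node L K a e) + c * Real.sin (b * mesh L K) ^ 2 with hUt
  set Rt : ℝ → Grid (2 * K + 1) := fun t a e =>
    Ψ t (node L K a e) + d * Real.sin (b * mesh L K) ^ 2 with hRt
  have cU : ∀ a e, ContinuousOn (fun t => Ut t a e) (Icc 0 T) := fun a e =>
    (continuousOn_eval hΦ.cont _).add continuousOn_const
  have cR : ∀ a e, ContinuousOn (fun t => Rt t a e) (Icc 0 T) := fun a e =>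
    (continuousOn_eval hΨ.cont _).add continuousOn_const
  have h01 : ∀ t ∈ Icc 0 T, ∀ a e, 0 < Rt t a e ∧ Rt t a e < 1 := by
    intro t ht a e
    have h1 := hm t ht (node L K a e)
    have h2 : |d * Real.sin (b * mesh L K) ^ 2| ≤ κ := by
      rw [abs_mul, abs_of_nonneg (sq_nonneg (Real.sin _))]
      calc _ ≤ κ * 1 := mul_le_mul hd (Real.sin_sq_le_one _) (sq_nonneg _) hκ.le
        _ = κ := mul_one κ
    have h3 := abs_le.1 h2
    constructor <;> simp only [hRt] <;> linarith
  -- At almost every time the pointwise derivative from the time regularity is the right-hand side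
  -- of the system, by uniqueness of derivatives.
  have good : ∀ᵐ s ∂(volume.restrict (Ioo 0 T)),
      |V (node L K a e) s - P.M * lapH (mesh L K) (muPhiH P (mesh L K) (Ut s) (Ut s) (Rt s)) a e|
          ≤ C * mesh L K ^ 2
        ∧ |W (node L K a e) s - P.M * lapH (mesh L K) (muRhoH P (mesh L K) (Rt s) (Ut s) (Rt s)) a e|
          ≤ C * mesh L K ^ 2 := by
    filter_upwards [hB, hB', hsol.phi_eq, hsol.rho_eq, ae_restrict_mem measurableSet_Ioo]
      with s h1 h2 h3 h4 hs
    have e1 := (hV (node L K a e) s hs).unique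
      (h3 (((a.val : ℝ) - 1 / 2) * mesh L K, ((e.val : ℝ) - 1 / 2) * mesh L K))
    have e2 := (hW (node L K a e) s hs).unique
      (h4 (((a.val : ℝ) - 1 / 2) * mesh L K, ((e.val : ℝ) - 1 / 2) * mesh L K))
    rw [e1, e2]
    exact H ⟨s, hs, h1, h2⟩ c d hc hd K (Ut s) (Rt s) rfl rfl a e
  constructor
  · refine le_of_ae_le_Ioo hT ?_ (good.mono fun s hs => hs.1) t ht
    exact ((hVc _).sub (continuousOn_const.mul
      (continuousOn_lapH (continuousOn_muPhiH P cU cR) a e))).abs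
  · refine le_of_ae_le_Ioo hT ?_ (good.mono fun s hs => hs.2) t ht
    exact ((hWc _).sub (continuousOn_const.mul
      (continuousOn_lapH (continuousOn_muRhoH P cU cR h01) a e))).abs

end AllTimes

/-! ## The exact solution on the grid -/

section OnGrid

open Set

variable {T L : ℝ}

theorem abs_mean_le {N : ℕ} [NeZero N] {u : Grid N} {b : ℝ} (hb : ∀ i j, |u i j| ≤ b) :
    |mean u| ≤ b := by
  have hN : (0 : ℝ) < (N : ℝ) ^ 2 := pow_pos (Nat.cast_pos.2 (NeZero.pos N)) 2
  rw [mean, abs_div, abs_of_pos hN, div_le_iff₀ hN]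
  calc _ ≤ ∑ i, |∑ j, u i j| := Finset.abs_sum_le_sum_abs _ _
    _ ≤ ∑ _i : ZMod N, ∑ _j : ZMod N, b := Finset.sum_le_sum fun i _ =>
        (Finset.abs_sum_le_sum_abs _ _).trans (Finset.sum_le_sum fun j _ => hb i j)
    _ = _ := by rw [sum_const_grid]; ring

/-- The grid values of `u t`. -/
def onGrid (K : ℕ) (u : Torus L → ℝ) : Grid (2 * K + 1) := fun i j => u (node L K i j)

/-- The grid values of `u t`, shifted by a constant so that their mean is `a`. -/
def recentred (K : ℕ) (a : ℝ) (u : Torus L → ℝ) : Grid (2 * K + 1) :=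
  onGrid K u + fun _ _ => a - mean (onGrid K u)

theorem mean_recentred (K : ℕ) (a : ℝ) (u : Torus L → ℝ) : mean (recentred K a u) = a := by
  rw [recentred, mean_add, mean_const, add_sub_cancel]

variable {u : ℝ → C(Torus L, ℝ)} {V : Torus L → ℝ → ℝ}

theorem exists_slope (hu : ContinuousOn u (Icc 0 T))
    (hV : ∀ z, ∀ t ∈ Ioo 0 T, HasDerivAt (fun s => u s z) (V z t) t) {s t : ℝ} (hs : 0 ≤ s)
    (hst : s < t) (ht : t ≤ T) (z : Torus L) :
    ∃ τ ∈ Ioo s t, V z τ = (u t z - u s z) / (t - s) :=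
  exists_hasDerivAt_eq_slope (fun s => u s z) (V z) hst
    ((continuousOn_eval hu z).mono (Icc_subset_Icc hs ht))
    fun τ hτ => hV z τ ⟨hs.trans_lt hτ.1, hτ.2.trans_le ht⟩

theorem abs_sub_le_mul {C : ℝ} (hu : ContinuousOn u (Icc 0 T))
    (hV : ∀ z, ∀ t ∈ Ioo 0 T, HasDerivAt (fun s => u s z) (V z t) t)
    (hC : ∀ z, ∀ t ∈ Icc 0 T, |V z t| ≤ C) {s t : ℝ} (hs : 0 ≤ s) (hst : s < t) (ht : t ≤ T)
    (z : Torus L) : |u t z - u s z| ≤ C * (t - s) := by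
  obtain ⟨τ, hτ, e⟩ := exists_slope hu hV hs hst ht z
  have h1 := hC z τ ⟨hs.trans hτ.1.le, hτ.2.le.trans ht⟩
  have h2 : 0 < t - s := sub_pos.2 hst
  rwa [e, abs_div, abs_of_pos h2, div_le_iff₀ h2] at h1

/-- By the mean value theorem the quotient is `V` at an intermediate time, and the increments of `V`
are controlled by the integral of `b`. -/
theorem abs_slope_sub_le {b : ℝ → ℝ} (hu : ContinuousOn u (Icc 0 T))
    (hV : ∀ z, ∀ t ∈ Ioo 0 T, HasDerivAt (fun s => u s z) (V z t) t)
    (hb : IntegrableOn b (Ioo 0 T)) (hb0 : ∀ t, 0 ≤ b t)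
    (hVb : ∀ z s t, 0 ≤ s → s ≤ t → t ≤ T → |V z t - V z s| ≤ ∫ τ in s..t, b τ)
    {s t : ℝ} (hs : 0 ≤ s) (hst : s < t) (ht : t ≤ T) (z : Torus L) :
    |(u t z - u s z) / (t - s) - V z t| ≤ ∫ τ in s..t, b τ := by
  obtain ⟨τ, hτ, e⟩ := exists_slope hu hV hs hst ht z
  rw [← e, abs_sub_comm]
  refine (hVb z τ t (hs.trans hτ.1.le) hτ.2.le ht).trans ?_
  exact intervalIntegral.integral_mono_interval hτ.1.le hτ.2.le le_rfl
    (Filter.Eventually.of_forall hb0) (intervalIntegrable_of_Ioo hb hs hst.le ht)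

/-- The mean value theorem is applied to the grid mean itself, whose derivative is the grid mean of
`V`. -/
theorem abs_mean_sub_le {K : ℕ} {ε : ℝ} (hu : ContinuousOn u (Icc 0 T))
    (hV : ∀ z, ∀ t ∈ Ioo 0 T, HasDerivAt (fun s => u s z) (V z t) t)
    (hε : ∀ t ∈ Icc 0 T, |mean (onGrid K fun z => V z t)| ≤ ε) {s t : ℝ} (hs : 0 ≤ s)
    (hst : s ≤ t) (ht : t ≤ T) :
    |mean (onGrid K (u t)) - mean (onGrid K (u s))| ≤ ε * (t - s) := by
  rcases hst.eq_or_lt with rfl | hst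
  · simp
  have hcont : ContinuousOn (fun t => mean (onGrid K (u t))) (Icc 0 T) := by
    have h1 : ∀ i j, ContinuousOn (fun t => onGrid K (u t) i j) (Icc 0 T) :=
      fun i j => continuousOn_eval hu _
    unfold mean
    fun_prop
  have hder : ∀ t ∈ Ioo 0 T,
      HasDerivAt (fun t => mean (onGrid K (u t))) (mean (onGrid K fun z => V z t)) t := by
    intro t ht
    unfold mean
    exact (HasDerivAt.fun_sum fun i _ => HasDerivAt.fun_sum fun j _ => hV _ t ht).div_const _
  obtain ⟨τ, hτ, e⟩ := exists_hasDerivAt_eq_slope (fun t => mean (onGrid K (u t)))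
    (fun t => mean (onGrid K fun z => V z t)) hst (hcont.mono (Icc_subset_Icc hs ht))
    fun τ hτ => hder τ ⟨hs.trans_lt hτ.1, hτ.2.trans_le ht⟩
  have h1 := hε τ ⟨hs.trans hτ.1.le, hτ.2.le.trans ht⟩
  have h2 : 0 < t - s := sub_pos.2 hst
  rwa [e, abs_div, abs_of_pos h2, div_le_iff₀ h2] at h1

theorem abs_shift_le {K : ℕ} {ε ε' a : ℝ} (hu : ContinuousOn u (Icc 0 T))
    (hV : ∀ z, ∀ t ∈ Ioo 0 T, HasDerivAt (fun s => u s z) (V z t) t) (hε0 : 0 ≤ ε)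
    (hε : ∀ t ∈ Icc 0 T, |mean (onGrid K fun z => V z t)| ≤ ε)
    (ha : |a - mean (onGrid K (u 0))| ≤ ε') {t : ℝ} (ht : t ∈ Icc 0 T) :
    |a - mean (onGrid K (u t))| ≤ ε' + ε * T := by
  have h1 := abs_mean_sub_le hu hV hε le_rfl ht.1 ht.2
  rw [sub_zero] at h1
  have h2 : ε * t ≤ ε * T := mul_le_mul_of_nonneg_left ht.2 hε0
  have h3 := abs_le.1 h1
  have h4 := abs_le.1 ha
  exact abs_le.2 ⟨by linarith, by linarith⟩

theorem abs_recentred_sub_le {K : ℕ} {C a : ℝ} (hu : ContinuousOn u (Icc 0 T))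
    (hV : ∀ z, ∀ t ∈ Ioo 0 T, HasDerivAt (fun s => u s z) (V z t) t)
    (hC : ∀ z, ∀ t ∈ Icc 0 T, |V z t| ≤ C) {s t : ℝ} (hs : 0 ≤ s) (hst : s < t) (ht : t ≤ T)
    (i j : ZMod (2 * K + 1)) :
    |(recentred K a (u t) - recentred K a (u s)) i j| ≤ 2 * (C * (t - s)) := by
  have h1 := fun z => abs_sub_le_mul hu hV hC hs hst ht z
  have h2 : |mean (onGrid K (u t) - onGrid K (u s))| ≤ C * (t - s) :=
    abs_mean_le fun i j => h1 (node L K i j)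
  rw [mean_sub] at h2
  have h3 := h1 (node L K i j)
  have h4 := abs_le.1 h2
  have h5 := abs_le.1 h3
  have e : (recentred K a (u t) - recentred K a (u s)) i j = (u t (node L K i j) - u s (node L K i j))
      - (mean (onGrid K (u t)) - mean (onGrid K (u s))) := by
    simp only [recentred, onGrid, Pi.sub_apply, Pi.add_apply]
    ring
  rw [e]
  exact abs_le.2 ⟨by linarith, by linarith⟩

theorem abs_recentred_slope_le {K : ℕ} {a ε : ℝ} {b : ℝ → ℝ} (hu : ContinuousOn u (Icc 0 T))
    (hV : ∀ z, ∀ t ∈ Ioo 0 T, HasDerivAt (fun s => u s z) (V z t) t)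
    (hb : IntegrableOn b (Ioo 0 T)) (hb0 : ∀ t, 0 ≤ b t)
    (hVb : ∀ z s t, 0 ≤ s → s ≤ t → t ≤ T → |V z t - V z s| ≤ ∫ τ in s..t, b τ)
    (hε : ∀ t ∈ Icc 0 T, |mean (onGrid K fun z => V z t)| ≤ ε)
    {s t : ℝ} (hs : 0 ≤ s) (hst : s < t) (ht : t ≤ T) (i j : ZMod (2 * K + 1)) :
    |(recentred K a (u t) i j - recentred K a (u s) i j) / (t - s) - V (node L K i j) t|
      ≤ (∫ τ in s..t, b τ) + ε := by
  have h2 : 0 < t - s := sub_pos.2 hst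
  have h1 := abs_slope_sub_le hu hV hb hb0 hVb hs hst ht (node L K i j)
  have h3 : |(mean (onGrid K (u t)) - mean (onGrid K (u s))) / (t - s)| ≤ ε := by
    rw [abs_div, abs_of_pos h2, div_le_iff₀ h2]
    exact abs_mean_sub_le hu hV hε hs hst.le ht
  have h4 := abs_le.1 h1
  have h5 := abs_le.1 h3
  have e : (recentred K a (u t) i j - recentred K a (u s) i j) / (t - s) - V (node L K i j) t
      = ((u t (node L K i j) - u s (node L K i j)) / (t - s) - V (node L K i j) t)
        - (mean (onGrid K (u t)) - mean (onGrid K (u s))) / (t - s) := by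
    simp only [recentred, onGrid, Pi.add_apply]
    ring
  rw [e]
  exact abs_le.2 ⟨by linarith, by linarith⟩

theorem normSq_le_of_abs_le_add {N : ℕ} [NeZero N] {h a b : ℝ} {u : Grid N}
    (hu : ∀ i j, |u i j| ≤ a + b) : normSq h u ≤ (h * N) ^ 2 * (2 * a ^ 2 + 2 * b ^ 2) := by
  refine (normSq_le_of_abs_le hu).trans (mul_le_mul_of_nonneg_left ?_ (sq_nonneg _))
  nlinarith [sq_nonneg (a - b)]

/-- Jordan's inequality gives `sin (π h / (2 h₀)) ≥ h / h₀` for `h ≤ h₀`, and `Γ h₀² = κ`. An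
`O(h²)` shift thus becomes a bounded multiple of the admissible profile. -/
theorem abs_div_sin_sq_le {h h₀ κ Γ c : ℝ} (hκ : 0 < κ) (hΓ : 0 < Γ) (hh₀ : h₀ ^ 2 = κ / Γ)
    (h0 : 0 < h) (hh : h ≤ h₀) (hc : |c| ≤ Γ * h ^ 2) :
    ∃ c' : ℝ, |c'| ≤ κ ∧ c = c' * Real.sin (Real.pi / (2 * h₀) * h) ^ 2 := by
  have hh0 : 0 < h₀ := h0.trans_le hh
  have h1 : 2 / Real.pi * (Real.pi / (2 * h₀) * h) ≤ Real.sin (Real.pi / (2 * h₀) * h) := by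
    have hpi := Real.pi_pos
    refine Real.mul_le_sin (by positivity) ?_
    calc _ ≤ Real.pi / (2 * h₀) * h₀ := by gcongr
      _ = Real.pi / 2 := by field_simp
  have e : 2 / Real.pi * (Real.pi / (2 * h₀) * h) = h / h₀ := by
    have := Real.pi_ne_zero
    field_simp
  rw [e] at h1
  set s := Real.sin (Real.pi / (2 * h₀) * h) with hs
  have hs0 : 0 < s := lt_of_lt_of_le (by positivity) h1
  have h2 : h ^ 2 * Γ / κ ≤ s ^ 2 := by
    have : (h / h₀) ^ 2 ≤ s ^ 2 := pow_le_pow_left₀ (by positivity) h1 2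
    rw [div_pow, hh₀] at this
    rwa [show h ^ 2 / (κ / Γ) = h ^ 2 * Γ / κ by field_simp] at this
  refine ⟨c / s ^ 2, ?_, by field_simp⟩
  rw [abs_div, abs_of_pos (by positivity : 0 < s ^ 2), div_le_iff₀ (by positivity)]
  rw [div_le_iff₀ hκ] at h2
  linarith

end OnGrid

/-! ## Reference sequences -/

/-- `(U, R)` satisfies the hypotheses of `comparison` with respect to `(p, w)` and `q`. -/
structure IsReference {N : ℕ} [NeZero N] (P : Params) (h dt q : ℝ) (n : ℕ) (U R p w : ℕ → Grid N) :
    Prop where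
  mean_phi : ∀ k ≤ n, mean (U k) = mean (p 0)
  mean_rho : ∀ k ≤ n, mean (R k) = mean (w 0)
  pos : ∀ k < n, ∀ i j, 0 < R (k + 1) i j ∧ R (k + 1) i j < 1
  residual : dt * ∑ k ∈ Finset.range n, (normSq h (resPhi P h dt (U k) (U (k + 1)) (R (k + 1)))
        + normSq h (resRho P h dt (R k) (R (k + 1)) (U (k + 1)))
        + normSq h (U (k + 1) - U k) + normSq h (R (k + 1) - R k)) ≤ q
  neg : ∀ k ≤ n, negSq h (p k - U k) + negSq h (w k - R k) ≤ q
  dis : ∀ k ≤ n, dissip P h (p k - U k) (w k - R k) ≤ q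

theorem IsReference.mono {N : ℕ} [NeZero N] {P : Params} {h dt q q' : ℝ} {n : ℕ}
    {U R p w : ℕ → Grid N} (H : IsReference P h dt q n U R p w) (hq : q ≤ q') :
    IsReference P h dt q' n U R p w :=
  ⟨H.mean_phi, H.mean_rho, H.pos, H.residual.trans hq, fun k hk => (H.neg k hk).trans hq,
    fun k hk => (H.dis k hk).trans hq⟩

theorem negSq_le_of_abs_le {N : ℕ} [NeZero N] {h b L : ℝ} (hL : 0 < L) (hN : h * N = L)
    {u : Grid N} (hu : ∀ i j, |u i j| ≤ b) : negSq h u ≤ L ^ 4 * b ^ 2 := by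
  have hh : h ≠ 0 := by
    rintro rfl
    rw [zero_mul] at hN
    exact hL.ne hN
  have h1 := negSq_le_normSq hh (by rw [hN]; exact hL) u
  have h2 := normSq_le_of_abs_le (h := h) hu
  rw [hN] at h1 h2
  refine h1.trans ((mul_le_mul_of_nonneg_left h2 (sq_nonneg L)).trans (le_of_eq ?_))
  ring

theorem lapH_muPhiH_const {N : ℕ} (P : Params) (h a c : ℝ) :
    lapH h (muPhiH P h (fun _ _ => a : Grid N) (fun _ _ => a) fun _ _ => c) = 0 := by
  have e : muPhiH P h (fun _ _ => a : Grid N) (fun _ _ => a) (fun _ _ => c)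
      = fun _ _ => (a - 1 / 2) ^ 3 / P.ε - (a - 1 / 2) / (4 * P.ε) := by
    funext i j
    have hD : Dx h (fun _ _ => a : Grid N) = 0 ∧ Dy h (fun _ _ => a : Grid N) = 0 := by
      constructor <;> funext i j <;> simp [Dx, Dy]
    have h0 : lapH h (0 : Grid N) = 0 := lapH_const 0
    simp only [muPhiH, divNonlin, lapH_const, h0, hD, mul_zero, Pi.add_apply, Pi.zero_apply]
    simp [dx, dy]
  rw [e, lapH_const]

theorem lapH_muRhoH_const {N : ℕ} (P : Params) (h a c : ℝ) :
    lapH h (muRhoH P h (fun _ _ => c : Grid N) (fun _ _ => a) fun _ _ => c) = 0 := by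
  have e : muRhoH P h (fun _ _ => c : Grid N) (fun _ _ => a) (fun _ _ => c)
      = fun _ _ => P.β * dEntropy c + Real.sqrt 2 * P.α * c - P.α * Real.sqrt (P.δ ^ 2)
        - P.α * (Real.sqrt 2 - 1) * c := by
    funext i j
    simp [muRhoH, modGradH, lapH_const, Dx, Dy]
  rw [e, lapH_const]

section Reference

open Set

variable {T L : ℝ}

/-- A discrete Laplacian has mean zero, so consistency alone forces the grid mass of the exact
solution to be nearly conserved. -/
theorem abs_mean_le_of_lapH {N : ℕ} [NeZero N] {h m b : ℝ} {v w : Grid N}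
    (H : ∀ i j, |v i j - m * lapH h w i j| ≤ b) : |mean v| ≤ b := by
  have h1 : |mean (v - m • lapH h w)| ≤ b := abs_mean_le H
  rwa [mean_sub, mean_smul, mean_lapH, mul_zero, sub_zero] at h1

theorem mul_sum_le_of_le {n : ℕ} {dt a c I J q : ℝ} {f x y : ℕ → ℝ} (ha : 0 ≤ a) (hc : 0 ≤ c)
    (hI : 0 ≤ I) (hJ : 0 ≤ J) (hdt : 0 < dt) (hn : n * dt ≤ T) (hq : dt ^ 2 ≤ q)
    (hf : ∀ k ∈ Finset.range n, f k ≤ a * (x k ^ 2 + y k ^ 2) + c * q)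
    (hx : ∑ k ∈ Finset.range n, x k ^ 2 ≤ dt * I) (hy : ∑ k ∈ Finset.range n, y k ^ 2 ≤ dt * J) :
    dt * ∑ k ∈ Finset.range n, f k ≤ (a * (I + J) + T * c) * q := by
  have hq0 : 0 ≤ q := (sq_nonneg dt).trans hq
  have hsum := Finset.sum_le_sum hf
  rw [Finset.sum_add_distrib, ← Finset.mul_sum, Finset.sum_add_distrib, Finset.sum_const,
    Finset.card_range, nsmul_eq_mul] at hsum
  have h1 : a * (∑ k ∈ Finset.range n, x k ^ 2 + ∑ k ∈ Finset.range n, y k ^ 2)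
      ≤ a * (dt * I + dt * J) := mul_le_mul_of_nonneg_left (add_le_add hx hy) ha
  calc _ ≤ dt * (a * (dt * I + dt * J) + n * (c * q)) :=
        mul_le_mul_of_nonneg_left (hsum.trans (add_le_add h1 le_rfl)) hdt.le
    _ = a * (I + J) * dt ^ 2 + n * dt * c * q := by ring
    _ ≤ a * (I + J) * q + T * c * q := by gcongr
    _ = _ := by ring

variable [Fact (0 < L)]

set_option maxHeartbeats 1000000 in
/-- On fine grids, the recentred exact solution is a reference sequence. -/
theorem exists_reference_fine (P : Params) (hT : 0 < T) {Φ Ψ : ℝ → C(Torus L, ℝ)}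
    (hΦ : RegularClass 8 T Φ) (hΨ : RegularClass 6 T Ψ) (hsol : IsExactSolution P T Φ Ψ) :
    ∃ h₀ Q : ℝ, 0 < h₀ ∧ 0 ≤ Q ∧ ∀ (K : ℕ) (dt : ℝ) (n : ℕ), mesh L K ≤ h₀ → 0 < dt → n * dt ≤ T →
      ∃ U R : ℕ → Grid (2 * K + 1), IsReference P (mesh L K) dt (Q * (dt + mesh L K ^ 2) ^ 2) n U R
        (fun k => proj K (Φ (k * dt))) fun k => proj K (Ψ (k * dt)) := by
  have hL : 0 < L := Fact.out
  obtain ⟨V, bφ, Cφ, mφ, nφ, Cφ0, FV⟩ := time_regularity hT hΦ.cont hΦ.h2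
  obtain ⟨W, bρ, Cρ, mρ, nρ, Cρ0, FW⟩ := time_regularity hT hΨ.cont hΨ.h2
  have dV := fun z => (FV z).2.2.1
  have dW := fun z => (FW z).2.2.1
  obtain ⟨κ, hκ, hm⟩ := exists_margin hΨ.cont hsol.pos
  -- The frequency `0` means no shift. This first use of consistency only measures the drift of the
  -- grid mean, which must be known before the shift can be estimated.
  obtain ⟨C₁, hC₁, H₁⟩ := consistency P hT hΦ hΨ hsol (fun z => (FV z).1) (fun z => (FW z).1) dV dW hκ hm 0
  obtain ⟨A, hA, HA⟩ := proj_error (m := 5) hT hΦ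
  obtain ⟨B, hB, HB⟩ := proj_error (m := 3) hT hΨ
  -- `Γ h²` bounds the recentring constants: the projection errors `A h⁵` and `B h³` at time `0`,
  -- plus the drift `C₁ h² T`. The `1` keeps `Γ` positive, and `h₀` is chosen so that `Γ h₀² = κ`.
  set Γ := A * L ^ 3 + B * L + C₁ * T + 1 with hΓ
  have hΓ0 : 0 < Γ := by positivity
  set h₀ := Real.sqrt (κ / Γ) with hh₀
  have hh₀2 : h₀ ^ 2 = κ / Γ := Real.sq_sqrt (by positivity)
  obtain ⟨C₂, hC₂, H₂⟩ := consistency P hT hΦ hΨ hsol (fun z => (FV z).1) (fun z => (FW z).1) dV dW hκ hm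
    (Real.pi / (2 * h₀))
  set Iφ := ∫ τ in (0 : ℝ)..T, bφ τ ^ 2 with hIφ
  set Iρ := ∫ τ in (0 : ℝ)..T, bρ τ ^ 2 with hIρ
  have Iφ0 : 0 ≤ Iφ := intervalIntegral.integral_nonneg hT.le fun _ _ => sq_nonneg _
  have Iρ0 : 0 ≤ Iρ := intervalIntegral.integral_nonneg hT.le fun _ _ => sq_nonneg _
  -- `Q₁` is for the residuals and increments, `Q₂` for the `H^{-1}` distance to the projection,
  -- `Q₃` for the dissipation of that distance.
  set Q₁ := 2 * L ^ 2 * (Iφ + Iρ) + T * (L ^ 2 * (4 * (C₁ + C₂) ^ 2 + 4 * Cφ ^ 2 + 4 * Cρ ^ 2)) with hQ₁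
  set Q₂ := 8 * L ^ 4 * Γ ^ 2 with hQ₂
  set Q₃ := L ^ 2 * (64 * P.η ^ 2 * A ^ 2 * L ^ 2 + 8 * P.ε * A ^ 2 * L ^ 4 + 8 * P.ξ * B ^ 2) with hQ₃
  have hε := P.ε_pos
  have hξ := P.ξ_pos
  have Q₁0 : 0 ≤ Q₁ := by positivity
  have Q₂0 : 0 ≤ Q₂ := by positivity
  have Q₃0 : 0 ≤ Q₃ := by positivity
  refine ⟨h₀, Q₁ + Q₂ + Q₃, by positivity, by positivity, ?_⟩
  intro K dt n hK hdt hn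
  have hN := mesh_mul L K
  have h0 : 0 < mesh L K := mesh_pos hL K
  have hle : mesh L K ≤ L := mesh_le K
  set h := mesh L K with hh
  have hh4 : h ^ 4 ≤ (dt + h ^ 2) ^ 2 := by
    rw [show h ^ 4 = (h ^ 2) ^ 2 by ring]
    exact pow_le_pow_left₀ (sq_nonneg h) (le_add_of_nonneg_left hdt.le) 2
  have hdt2 : dt ^ 2 ≤ (dt + h ^ 2) ^ 2 :=
    pow_le_pow_left₀ hdt.le (le_add_of_nonneg_right (sq_nonneg h)) 2
  have hq0 : 0 ≤ (dt + h ^ 2) ^ 2 := sq_nonneg _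
  set aφ := mean (proj K (Φ 0)) with haφ
  set aρ := mean (proj K (Ψ 0)) with haρ
  have h0T : (0 : ℝ) ∈ Icc 0 T := ⟨le_rfl, hT.le⟩
  have hmeans : ∀ t ∈ Icc 0 T, |mean (onGrid K fun z => V z t)| ≤ C₁ * h ^ 2
      ∧ |mean (onGrid K fun z => W z t)| ≤ C₁ * h ^ 2 := by
    intro t ht
    have := H₁ t ht 0 0 (by simpa using hκ.le) (by simpa using hκ.le) K _ _ rfl rfl
    exact ⟨abs_mean_le_of_lapH fun i j => (this i j).1, abs_mean_le_of_lapH fun i j => (this i j).2⟩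
  have hh5 : A * h ^ 5 ≤ A * L ^ 3 * h ^ 2 := by
    rw [show A * h ^ 5 = A * h ^ 3 * h ^ 2 by ring]
    gcongr
  have hh3 : B * h ^ 3 ≤ B * L * h ^ 2 := by
    rw [show B * h ^ 3 = B * h * h ^ 2 by ring]
    gcongr
  have hshift : ∀ t ∈ Icc 0 T, |aφ - mean (onGrid K (Φ t))| ≤ Γ * h ^ 2
      ∧ |aρ - mean (onGrid K (Ψ t))| ≤ Γ * h ^ 2 := by
    intro t ht
    have i1 : |aφ - mean (onGrid K (Φ 0))| ≤ A * h ^ 5 := by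
      rw [haφ, ← mean_sub]
      exact abs_mean_le fun i j => HA 0 h0T K i j
    have i2 : |aρ - mean (onGrid K (Ψ 0))| ≤ B * h ^ 3 := by
      rw [haρ, ← mean_sub]
      exact abs_mean_le fun i j => HB 0 h0T K i j
    have j1 := abs_shift_le hΦ.cont dV (by positivity) (fun t ht => (hmeans t ht).1) i1 ht
    have j2 := abs_shift_le hΨ.cont dW (by positivity) (fun t ht => (hmeans t ht).2) i2 ht
    have p1 : 0 ≤ A * L ^ 3 * h ^ 2 := by positivity
    have p2 : 0 ≤ B * L * h ^ 2 := by positivity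
    have p3 := sq_nonneg h
    have e : Γ * h ^ 2 = A * L ^ 3 * h ^ 2 + B * L * h ^ 2 + C₁ * h ^ 2 * T + h ^ 2 := by
      rw [hΓ]
      ring
    rw [e]
    constructor <;> linarith
  have hrep : ∀ t ∈ Icc 0 T, ∃ c d : ℝ, |c| ≤ κ ∧ |d| ≤ κ
      ∧ recentred K aφ (Φ t) = (fun a e => Φ t (node L K a e) + c * Real.sin (Real.pi / (2 * h₀) * h) ^ 2)
      ∧ recentred K aρ (Ψ t) = (fun a e => Ψ t (node L K a e) + d * Real.sin (Real.pi / (2 * h₀) * h) ^ 2) := by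
    intro t ht
    obtain ⟨c, hc, ec⟩ := abs_div_sin_sq_le hκ hΓ0 hh₀2 h0 hK (hshift t ht).1
    obtain ⟨d, hd, ed⟩ := abs_div_sin_sq_le hκ hΓ0 hh₀2 h0 hK (hshift t ht).2
    refine ⟨c, d, hc, hd, ?_, ?_⟩
    · rw [← ec]
      rfl
    · rw [← ed]
      rfl
  have hpos : ∀ t ∈ Icc 0 T, ∀ i j, 0 < recentred K aρ (Ψ t) i j ∧ recentred K aρ (Ψ t) i j < 1 := by
    intro t ht i j
    obtain ⟨c, d, -, hd, -, ed⟩ := hrep t ht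
    have h1 := hm t ht (node L K i j)
    have h2 : |d * Real.sin (Real.pi / (2 * h₀) * h) ^ 2| ≤ κ := by
      rw [abs_mul, abs_of_nonneg (sq_nonneg (Real.sin _))]
      calc _ ≤ κ * 1 := mul_le_mul hd (Real.sin_sq_le_one _) (sq_nonneg _) hκ.le
        _ = κ := mul_one κ
    have h3 := abs_le.1 h2
    rw [ed]
    constructor <;> linarith
  have htime : ∀ k < n, 0 ≤ (k : ℝ) * dt ∧ (k : ℝ) * dt < (k + 1) * dt ∧ ((k : ℝ) + 1) * dt ≤ T := by
    intro k hk
    have h1 : ((k : ℝ) + 1) ≤ n := by exact_mod_cast hk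
    exact ⟨by positivity, by linarith, (mul_le_mul_of_nonneg_right h1 hdt.le).trans hn⟩
  have htimen : ∀ k ≤ n, (k : ℝ) * dt ∈ Icc 0 T := by
    intro k hk
    have h1 : (k : ℝ) ≤ n := by exact_mod_cast hk
    exact ⟨by positivity, (mul_le_mul_of_nonneg_right h1 hdt.le).trans hn⟩
  have hstep : ∀ k : ℕ, ((k : ℝ) + 1) * dt - k * dt = dt := fun k => by ring
  refine ⟨fun k => recentred K aφ (Φ (k * dt)), fun k => recentred K aρ (Ψ (k * dt)), ?_, ?_, ?_, ?_, ?_, ?_⟩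
  · intro k _
    simp only [mean_recentred, Nat.cast_zero, zero_mul, haφ]
  · intro k _
    simp only [mean_recentred, Nat.cast_zero, zero_mul, haρ]
  · intro k hk i j
    exact hpos _ (htimen (k + 1) hk) i j
  · have hterm : ∀ k ∈ Finset.range n,
        normSq h (resPhi P h dt (recentred K aφ (Φ (k * dt))) (recentred K aφ (Φ ((k + 1 : ℕ) * dt)))
            (recentred K aρ (Ψ ((k + 1 : ℕ) * dt))))
          + normSq h (resRho P h dt (recentred K aρ (Ψ (k * dt))) (recentred K aρ (Ψ ((k + 1 : ℕ) * dt)))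
            (recentred K aφ (Φ ((k + 1 : ℕ) * dt))))
          + normSq h (recentred K aφ (Φ ((k + 1 : ℕ) * dt)) - recentred K aφ (Φ (k * dt)))
          + normSq h (recentred K aρ (Ψ ((k + 1 : ℕ) * dt)) - recentred K aρ (Ψ (k * dt)))
        ≤ 2 * L ^ 2 * ((∫ τ in (k * dt)..((k + 1) * dt), bφ τ) ^ 2
            + (∫ τ in (k * dt)..((k + 1) * dt), bρ τ) ^ 2)
          + L ^ 2 * (4 * (C₁ + C₂) ^ 2 + 4 * Cφ ^ 2 + 4 * Cρ ^ 2) * (dt + h ^ 2) ^ 2 := by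
      intro k hk
      rw [Finset.mem_range] at hk
      obtain ⟨t0, t1, t2⟩ := htime k hk
      rw [Nat.cast_succ]
      have ht : ((k : ℝ) + 1) * dt ∈ Icc 0 T := ⟨t0.trans t1.le, t2⟩
      obtain ⟨c, d, hc, hd, ec, ed⟩ := hrep _ ht
      have cons := H₂ _ ht c d hc hd K _ _ ec ed
      have s1 := abs_recentred_slope_le (K := K) (a := aφ) hΦ.cont dV (mφ.integrable (by norm_num)) nφ
        (fun z => (FV z).2.2.2) (fun t ht => (hmeans t ht).1) t0 t1 t2
      have s2 := abs_recentred_slope_le (K := K) (a := aρ) hΨ.cont dW (mρ.integrable (by norm_num)) nρ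
        (fun z => (FW z).2.2.2) (fun t ht => (hmeans t ht).2) t0 t1 t2
      have d1 := abs_recentred_sub_le (K := K) (a := aφ) hΦ.cont dV (fun z => (FV z).2.1) t0 t1 t2
      have d2 := abs_recentred_sub_le (K := K) (a := aρ) hΨ.cont dW (fun z => (FW z).2.1) t0 t1 t2
      rw [hstep] at s1 s2 d1 d2
      -- The residual consists of the error of the difference quotient, the drift of the mean
      -- (`C₁`), and the spatial consistency error (`C₂`).
      have r1 := normSq_le_of_abs_le_add (h := h) (a := ∫ τ in (k * dt)..((k + 1) * dt), bφ τ)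
          (b := (C₁ + C₂) * h ^ 2) (u := resPhi P h dt (recentred K aφ (Φ (k * dt)))
            (recentred K aφ (Φ ((k + 1) * dt))) (recentred K aρ (Ψ ((k + 1) * dt)))) fun i j => by
        have a1 := abs_le.1 (s1 i j)
        have a2 := abs_le.1 (cons i j).1
        rw [resPhi]
        exact abs_le.2 ⟨by linarith, by linarith⟩
      have r2 := normSq_le_of_abs_le_add (h := h) (a := ∫ τ in (k * dt)..((k + 1) * dt), bρ τ)
          (b := (C₁ + C₂) * h ^ 2) (u := resRho P h dt (recentred K aρ (Ψ (k * dt)))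
            (recentred K aρ (Ψ ((k + 1) * dt))) (recentred K aφ (Φ ((k + 1) * dt)))) fun i j => by
        have a1 := abs_le.1 (s2 i j)
        have a2 := abs_le.1 (cons i j).2
        rw [resRho]
        exact abs_le.2 ⟨by linarith, by linarith⟩
      have r3 := normSq_le_of_abs_le (h := h) d1
      have r4 := normSq_le_of_abs_le (h := h) d2
      rw [hN] at r1 r2 r3 r4
      refine (add_le_add (add_le_add (add_le_add r1 r2) r3) r4).trans ?_
      have b1 : L ^ 2 * (4 * (C₁ + C₂) ^ 2) * h ^ 4 ≤ L ^ 2 * (4 * (C₁ + C₂) ^ 2) * (dt + h ^ 2) ^ 2 := by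
        gcongr
      have b2 : L ^ 2 * (4 * Cφ ^ 2 + 4 * Cρ ^ 2) * dt ^ 2
          ≤ L ^ 2 * (4 * Cφ ^ 2 + 4 * Cρ ^ 2) * (dt + h ^ 2) ^ 2 := by
        gcongr
      linarith
    refine (mul_sum_le_of_le (by positivity) (by positivity) Iφ0 Iρ0 hdt hn hdt2 hterm
      (sum_integral_sq_le mφ hdt hn) (sum_integral_sq_le mρ hdt hn)).trans ?_
    refine mul_le_mul_of_nonneg_right ?_ hq0
    linarith
  · intro k hk
    have ht := htimen k hk
    have p1 : 0 ≤ B * L := by positivity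
    have p2 : 0 ≤ C₁ * T := by positivity
    have p3 : 0 ≤ A * L ^ 3 := by positivity
    have n1 := negSq_le_of_abs_le (b := 2 * (Γ * h ^ 2)) hL hN
        (u := proj K (Φ (k * dt)) - recentred K aφ (Φ (k * dt))) fun i j => by
      have a1 := abs_le.1 ((HA _ ht K i j).trans hh5)
      have a2 := abs_le.1 (hshift _ ht).1
      have a3 : A * L ^ 3 * h ^ 2 ≤ Γ * h ^ 2 := by
        refine mul_le_mul_of_nonneg_right ?_ (sq_nonneg h)
        linarith
      simp only [Pi.sub_apply, recentred, Pi.add_apply, onGrid] at a1 a2 ⊢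
      exact abs_le.2 ⟨by linarith, by linarith⟩
    have n2 := negSq_le_of_abs_le (b := 2 * (Γ * h ^ 2)) hL hN
        (u := proj K (Ψ (k * dt)) - recentred K aρ (Ψ (k * dt))) fun i j => by
      have a1 := abs_le.1 ((HB _ ht K i j).trans hh3)
      have a2 := abs_le.1 (hshift _ ht).2
      have a3 : B * L * h ^ 2 ≤ Γ * h ^ 2 := by
        refine mul_le_mul_of_nonneg_right ?_ (sq_nonneg h)
        linarith
      simp only [Pi.sub_apply, recentred, Pi.add_apply, onGrid] at a1 a2 ⊢
      exact abs_le.2 ⟨by linarith, by linarith⟩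
    have g : Q₂ * h ^ 4 ≤ Q₂ * (dt + h ^ 2) ^ 2 := by gcongr
    have g' : 0 ≤ (Q₁ + Q₃) * (dt + h ^ 2) ^ 2 := by positivity
    have e : Q₂ * h ^ 4 = L ^ 4 * (2 * (Γ * h ^ 2)) ^ 2 + L ^ 4 * (2 * (Γ * h ^ 2)) ^ 2 := by
      rw [hQ₂]
      ring
    linarith
  · intro k hk
    have ht := htimen k hk
    -- The dissipation ignores constants, so the shift disappears and only the projection error is
    -- left.
    have e1 : ∀ (a : ℝ) (u : Torus L → ℝ) (p : Grid (2 * K + 1)), p - recentred K a u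
        = (p - onGrid K u) - fun _ _ => a - mean (onGrid K u) := fun a u p => by
      rw [recentred, sub_sub]
    have d1 := dissip_le_of_abs_le P h0 (e := proj K (Φ (k * dt)) - onGrid K (Φ (k * dt)))
      (g := proj K (Ψ (k * dt)) - onGrid K (Ψ (k * dt))) (fun i j => HA _ ht K i j)
      (fun i j => HB _ ht K i j)
    rw [hN] at d1
    simp only [e1, dissip_sub_const]
    refine d1.trans ?_
    -- Inverse estimates suffice: `h⁵` loses two powers under `Δ_h`, and `h³` loses one under `∇_h`,
    -- which leaves at least `h²` before squaring.
    have e2 : L ^ 2 * (P.η ^ 2 * (8 * (A * h ^ 5) / h ^ 2) ^ 2 + P.ε * (8 * (A * h ^ 5) ^ 2 / h ^ 2)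
        + P.ξ * (8 * (B * h ^ 3) ^ 2 / h ^ 2))
        = L ^ 2 * (64 * P.η ^ 2 * A ^ 2 * h ^ 2 + 8 * P.ε * A ^ 2 * h ^ 4 + 8 * P.ξ * B ^ 2) * h ^ 4 := by
      field_simp
      ring
    rw [e2]
    have g : L ^ 2 * (64 * P.η ^ 2 * A ^ 2 * h ^ 2 + 8 * P.ε * A ^ 2 * h ^ 4 + 8 * P.ξ * B ^ 2) * h ^ 4
        ≤ Q₃ * (dt + h ^ 2) ^ 2 := by
      rw [hQ₃]
      gcongr
    have g' : 0 ≤ (Q₁ + Q₂) * (dt + h ^ 2) ^ 2 := by positivity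
    linarith

/-- On coarse grids, constants are a reference sequence. -/
theorem exists_reference_coarse (P : Params) (hT : 0 < T) {Φ Ψ : ℝ → C(Torus L, ℝ)}
    (hΦ : RegularClass 8 T Φ) (hΨ : RegularClass 6 T Ψ) {h₀ : ℝ} (hh₀ : 0 < h₀) :
    ∃ Q : ℝ, 0 ≤ Q ∧ ∀ (K : ℕ) (dt : ℝ) (n : ℕ), h₀ ≤ mesh L K → 0 < dt → n * dt ≤ T →
      0 < mean (proj K (Ψ 0)) → mean (proj K (Ψ 0)) < 1 →
      ∃ U R : ℕ → Grid (2 * K + 1), IsReference P (mesh L K) dt (Q * (dt + mesh L K ^ 2) ^ 2) n U R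
        (fun k => proj K (Φ (k * dt))) fun k => proj K (Ψ (k * dt)) := by
  have hL : 0 < L := Fact.out
  have hsup : ∀ {m : ℕ} {u : ℝ → C(Torus L, ℝ)}, RegularClass (m + 3) T u →
      ∃ S : ℝ, 0 ≤ S ∧ ∀ t ∈ Icc 0 T, ∀ K i j, |proj K (u t) i j| ≤ S := by
    intro m u hu
    obtain ⟨A, hA, HA⟩ := proj_error hT hu
    obtain ⟨B, hB⟩ := isCompact_Icc.exists_bound_of_continuousOn hu.cont
    have hB0 : 0 ≤ B := (norm_nonneg _).trans (hB 0 ⟨le_rfl, hT.le⟩)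
    refine ⟨B + A * L ^ m, by positivity, fun t ht K i j => ?_⟩
    have h1 : A * mesh L K ^ m ≤ A * L ^ m :=
      mul_le_mul_of_nonneg_left (pow_le_pow_left₀ (mesh_pos hL K).le (mesh_le K) m) hA
    have h2 := abs_le.1 ((HA t ht K i j).trans h1)
    have h3 := abs_le.1 (((u t).norm_coe_le_norm (node L K i j)).trans (hB t ht))
    exact abs_le.2 ⟨by linarith, by linarith⟩
  obtain ⟨S, hS, HS⟩ := hsup (m := 5) hΦ
  obtain ⟨S', hS', HS'⟩ := hsup (m := 3) hΨ
  have hε := P.ε_pos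
  have hξ := P.ξ_pos
  -- Bounded quantities are divided by `h₀⁴`, because `h₀⁴ ≤ (dt + h²)²` on coarse grids.
  set Q₁ := (L ^ 4 * (2 * S) ^ 2 + L ^ 4 * (2 * S') ^ 2) / h₀ ^ 4 with hQ₁
  set Q₂ := L ^ 2 * (P.η ^ 2 * (8 * S / h₀ ^ 2) ^ 2 + P.ε * (8 * S ^ 2 / h₀ ^ 2)
      + P.ξ * (8 * S' ^ 2 / h₀ ^ 2)) / h₀ ^ 4 with hQ₂
  have Q₁0 : 0 ≤ Q₁ := by positivity
  have Q₂0 : 0 ≤ Q₂ := by positivity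
  refine ⟨Q₁ + Q₂, by positivity, fun K dt n hK hdt hn hm0 hm1 => ?_⟩
  have hN := mesh_mul L K
  set h := mesh L K with hh
  have h0 : 0 < h := hh₀.trans_le hK
  have hq : h₀ ^ 4 ≤ (dt + h ^ 2) ^ 2 := by
    rw [show h₀ ^ 4 = (h₀ ^ 2) ^ 2 by ring]
    refine pow_le_pow_left₀ (sq_nonneg _) ?_ 2
    have := pow_le_pow_left₀ hh₀.le hK 2
    linarith
  have hge : ∀ x : ℝ, 0 ≤ x → x ≤ x / h₀ ^ 4 * (dt + h ^ 2) ^ 2 := by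
    intro x hx
    calc x = x / h₀ ^ 4 * h₀ ^ 4 := by field_simp
      _ ≤ _ := by gcongr
  have htimen : ∀ k ≤ n, (k : ℝ) * dt ∈ Icc 0 T := by
    intro k hk
    have h1 : (k : ℝ) ≤ n := by exact_mod_cast hk
    exact ⟨by positivity, (mul_le_mul_of_nonneg_right h1 hdt.le).trans hn⟩
  have h0T : (0 : ℝ) ∈ Icc 0 T := ⟨le_rfl, hT.le⟩
  set a := mean (proj K (Φ 0)) with ha
  set c := mean (proj K (Ψ 0)) with hc
  have haS : |a| ≤ S := abs_mean_le (HS 0 h0T K)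
  have hcS : |c| ≤ S' := abs_mean_le (HS' 0 h0T K)
  refine ⟨fun _ _ _ => a, fun _ _ _ => c, ?_, ?_, fun _ _ _ _ => ⟨hm0, hm1⟩, ?_, ?_, ?_⟩
  · intro k _
    simp only [mean_const, Nat.cast_zero, zero_mul, ha]
  · intro k _
    simp only [mean_const, Nat.cast_zero, zero_mul, hc]
  · have z1 : resPhi P h dt (fun _ _ => a : Grid (2 * K + 1)) (fun _ _ => a) (fun _ _ => c) = 0 := by
      funext i j
      simp [resPhi, lapH_muPhiH_const]
    have z2 : resRho P h dt (fun _ _ => c : Grid (2 * K + 1)) (fun _ _ => c) (fun _ _ => a) = 0 := by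
      funext i j
      simp [resRho, lapH_muRhoH_const]
    have z3 : normSq h (0 : Grid (2 * K + 1)) = 0 := by simp [normSq, inner2]
    simp only [z1, z2, z3, sub_self, add_zero, Finset.sum_const_zero, mul_zero]
    positivity
  · intro k hk
    have ht := htimen k hk
    have n1 := negSq_le_of_abs_le (b := 2 * S) hL hN
        (u := proj K (Φ (k * dt)) - fun _ _ => a) fun i j => by
      have a1 := abs_le.1 (HS _ ht K i j)
      have a2 := abs_le.1 haS
      simp only [Pi.sub_apply]
      exact abs_le.2 ⟨by linarith, by linarith⟩
    have n2 := negSq_le_of_abs_le (b := 2 * S') hL hN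
        (u := proj K (Ψ (k * dt)) - fun _ _ => c) fun i j => by
      have a1 := abs_le.1 (HS' _ ht K i j)
      have a2 := abs_le.1 hcS
      simp only [Pi.sub_apply]
      exact abs_le.2 ⟨by linarith, by linarith⟩
    have g := hge (L ^ 4 * (2 * S) ^ 2 + L ^ 4 * (2 * S') ^ 2) (by positivity)
    have g' : 0 ≤ Q₂ * (dt + h ^ 2) ^ 2 := by positivity
    rw [add_mul]
    linarith
  · intro k hk
    have ht := htimen k hk
    simp only [dissip_sub_const]
    have d1 := dissip_le_of_abs_le P h0 (fun i j => HS _ ht K i j) (fun i j => HS' _ ht K i j)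
    rw [hN] at d1
    have d2 : L ^ 2 * (P.η ^ 2 * (8 * S / h ^ 2) ^ 2 + P.ε * (8 * S ^ 2 / h ^ 2)
        + P.ξ * (8 * S' ^ 2 / h ^ 2)) ≤ L ^ 2 * (P.η ^ 2 * (8 * S / h₀ ^ 2) ^ 2
        + P.ε * (8 * S ^ 2 / h₀ ^ 2) + P.ξ * (8 * S' ^ 2 / h₀ ^ 2)) := by
      gcongr
    have g := hge (L ^ 2 * (P.η ^ 2 * (8 * S / h₀ ^ 2) ^ 2
        + P.ε * (8 * S ^ 2 / h₀ ^ 2) + P.ξ * (8 * S' ^ 2 / h₀ ^ 2))) (by positivity)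
    have g' : 0 ≤ Q₁ * (dt + h ^ 2) ^ 2 := by positivity
    rw [add_mul]
    linarith

end Reference

/-! ### Conservation of mass and assembly of the estimate -/

theorem sqrt_add_sqrt_add_sqrt_le {x y s Q r : ℝ} (hx : 0 ≤ x) (hy : 0 ≤ y) (hs : 0 ≤ s) (hr : 0 ≤ r)
    (h : x + y + s ≤ Q * r ^ 2) : Real.sqrt x + Real.sqrt y + Real.sqrt s ≤ 3 * Real.sqrt Q * r := by
  have h1 : ∀ z, z ≤ Q * r ^ 2 → Real.sqrt z ≤ Real.sqrt Q * r := by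
    intro z hz
    refine (Real.sqrt_le_sqrt hz).trans (le_of_eq ?_)
    rw [Real.sqrt_mul' Q (sq_nonneg r), Real.sqrt_sq hr]
  linarith [h1 x (by linarith), h1 y (by linarith), h1 s (by linarith)]

/-- The update is a multiple of a discrete Laplacian, which has mean zero. -/
theorem mean_eq_of_step {N : ℕ} [NeZero N] {h dt m : ℝ} (hdt : dt ≠ 0) {u v w : Grid N}
    (H : ∀ i j, (v i j - u i j) / dt = m * lapH h w i j) : mean v = mean u := by
  have e : v - u = (dt * m) • lapH h w := by
    funext i j
    have := H i j
    rw [div_eq_iff hdt] at this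
    simp only [Pi.sub_apply, Pi.smul_apply, smul_eq_mul, this]
    ring
  have h1 := congrArg mean e
  rw [mean_sub, mean_smul, mean_lapH, mul_zero, sub_eq_zero] at h1
  exact h1

theorem mean_mem_of_pos {N : ℕ} [NeZero N] {u : Grid N} (hu : ∀ i j, 0 < u i j ∧ u i j < 1) :
    0 < mean u ∧ mean u < 1 := by
  have hN : (0 : ℝ) < (N : ℝ) ^ 2 := pow_pos (Nat.cast_pos.2 (NeZero.pos N)) 2
  rw [mean, div_lt_one hN]
  refine ⟨div_pos (Finset.sum_pos (fun i _ => Finset.sum_pos (fun j _ => (hu i j).1)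
    Finset.univ_nonempty) Finset.univ_nonempty) hN, ?_⟩
  calc _ < ∑ _i : ZMod N, ∑ _j : ZMod N, (1 : ℝ) := Finset.sum_lt_sum_of_nonempty Finset.univ_nonempty
        fun i _ => Finset.sum_lt_sum_of_nonempty Finset.univ_nonempty fun j _ => (hu i j).2
    _ = _ := by rw [sum_const_grid, mul_one]

end Surfactant

end

theorem theorem3p3 {L : ℝ} [Fact (0 < L)] (P : Params) :
    ∃ dt₀ : ℝ, 0 < dt₀ ∧
      ∀ (T : ℝ) (Φ Ψ : ℝ → C(Torus L, ℝ)), 0 < T →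
        RegularClass 8 T Φ → RegularClass 6 T Ψ → IsExactSolution P T Φ Ψ →
        ∃ C : ℝ, 0 < C ∧
          ∀ (K : ℕ) (dt : ℝ) (φ ρ : ℕ → Grid (2 * K + 1)), 0 < dt → dt ≤ dt₀ →
            IsNumericalSolution P T K dt (Φ 0) (Ψ 0) φ ρ →
            ∀ n : ℕ, ((n : ℝ) + 1) * dt ≤ T →
              negNorm (mesh L K) (err K dt Φ φ (n + 1))
                + negNorm (mesh L K) (err K dt Ψ ρ (n + 1))
                + Real.sqrt (P.M * dt * ∑ k ∈ Finset.range (n + 2),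
                    (P.η ^ 2 * normSq (mesh L K) (lapH (mesh L K) (err K dt Φ φ k))
                      + P.ε * gradSq (mesh L K) (err K dt Φ φ k)
                      + P.ξ * gradSq (mesh L K) (err K dt Ψ ρ k)))
                ≤ C * (dt + mesh L K ^ 2) := by
  have hL : 0 < L := Fact.out
  obtain ⟨C₀, hC₀, H⟩ := comparison P hL
  -- `C₀` comes from the energy inequality, before `T` and the solution are introduced.
  refine ⟨1 / (2 * C₀), by positivity, fun T Φ Ψ hT hΦ hΨ hsol => ?_⟩
  obtain ⟨A, hA, H⟩ := H T hT.le
  obtain ⟨h₀, Q, hh₀, hQ, hfine⟩ := exists_reference_fine P hT hΦ hΨ hsol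
  obtain ⟨Q', hQ', hcoarse⟩ := exists_reference_coarse P hT hΦ hΨ hh₀
  -- The `1` only ensures that the constant is positive.
  refine ⟨3 * Real.sqrt (A * (Q + Q')) + 1, by positivity, ?_⟩
  intro K dt φ ρ hdt hdt₀ hnum n hn
  have hsm : C₀ * dt ≤ 1 / 2 := by
    rw [le_div_iff₀ (by positivity)] at hdt₀
    linarith
  have hn' : ((n + 1 : ℕ) : ℝ) * dt ≤ T := by
    push_cast
    exact hn
  have hk : ∀ k < n + 1, ((k : ℝ) + 1) * dt ≤ T := by
    intro k hk
    have h1 : (k : ℝ) ≤ n := by exact_mod_cast Nat.lt_succ_iff.1 hk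
    exact (mul_le_mul_of_nonneg_right (by linarith) hdt.le).trans hn
  have hmφ : ∀ k ≤ n + 1, mean (φ k) = mean (φ 0) := by
    intro k
    induction k with
    | zero => exact fun _ => rfl
    | succ k ih => exact fun h => (mean_eq_of_step hdt.ne' (hnum.phi_step k (hk k h))).trans (ih (by omega))
  have hmρ : ∀ k ≤ n + 1, mean (ρ k) = mean (ρ 0) := by
    intro k
    induction k with
    | zero => exact fun _ => rfl
    | succ k ih => exact fun h => (mean_eq_of_step hdt.ne' (hnum.rho_step k (hk k h))).trans (ih (by omega))
  -- The projected initial datum need not lie in `(0, 1)` pointwise, but its mean does: it equals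
  -- the mean of the first computed step.
  have hmean : 0 < mean (proj K (Ψ 0)) ∧ mean (proj K (Ψ 0)) < 1 := by
    rw [← hnum.rho_zero, ← hmρ 1 (by omega)]
    exact mean_mem_of_pos (hnum.pos 0 (hk 0 (by omega)))
  have hq : 0 ≤ (dt + mesh L K ^ 2) ^ 2 := sq_nonneg _
  obtain ⟨U, R, hUR⟩ : ∃ U R : ℕ → Grid (2 * K + 1), IsReference P (mesh L K) dt
      ((Q + Q') * (dt + mesh L K ^ 2) ^ 2) (n + 1) U R
      (fun k => proj K (Φ (k * dt))) fun k => proj K (Ψ (k * dt)) := by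
    rcases le_total (mesh L K) h₀ with hle | hle
    · obtain ⟨U, R, h⟩ := hfine K dt (n + 1) hle hdt hn'
      exact ⟨U, R, h.mono (mul_le_mul_of_nonneg_right (by linarith) hq)⟩
    · obtain ⟨U, R, h⟩ := hcoarse K dt (n + 1) hle hdt hn' hmean.1 hmean.2
      exact ⟨U, R, h.mono (mul_le_mul_of_nonneg_right (by linarith) hq)⟩
  have f0 : φ 0 = proj K (Φ ((0 : ℕ) * dt)) := by
    rw [Nat.cast_zero, zero_mul, hnum.phi_zero]
  have s0 : ρ 0 = proj K (Ψ ((0 : ℕ) * dt)) := by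
    rw [Nat.cast_zero, zero_mul, hnum.rho_zero]
  have key := H (2 * K + 1) (mesh L K) dt _ (mesh_mul L K) hdt hsm (by positivity) (n + 1) U R φ ρ
    (fun k => proj K (Φ (k * dt))) (fun k => proj K (Ψ (k * dt))) hn'
    (fun k h => by rw [hUR.mean_phi k h, hmφ k h, f0]) (fun k h => by rw [hUR.mean_rho k h, hmρ k h, s0])
    hUR.pos (fun k h => hnum.pos k (hk k h)) (fun k h => hnum.phi_step k (hk k h))
    (fun k h => hnum.rho_step k (hk k h)) f0 s0 hUR.residual hUR.neg hUR.dis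
  have hr : 0 ≤ dt + mesh L K ^ 2 := by positivity
  rw [← mul_assoc] at key
  refine (sqrt_add_sqrt_add_sqrt_le (negSq_nonneg _) (negSq_nonneg _) ?_ hr key).trans ?_
  · exact mul_nonneg (mul_nonneg P.M_pos.le hdt.le) (Finset.sum_nonneg fun k _ => dissip_nonneg P _ _)
  · exact mul_le_mul_of_nonneg_right (by linarith) hr
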